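/- Let $\Omega$ be a smooth connected manifold of dimension $n\ge 2$ (Hausdorff, second countable, without boundary; for instance a domain in $\mathbb R^n$), and let $\nu$ be a positive Borel measure on $\Omega$ which in local charts has a density with respect to Lebesgue measure that is bounded above and bounded away from $0$ on compact sets. Let $P u=-\mathrm{div}(A\nabla u)+cu$, where $-\mathrm{div}$ is the formal adjoint of the gradient with respect to $\nu$, $A(x)$ is symmetric and positive definite for every $x\in\Omega$, $P$ is locally uniformly elliptic, and $A$, $c$ are real, measurable and locally bounded. Assume that the quadratic form $$q(u)=\int_\Omega\big(\langle A\nabla u,\nabla u\rangle+cu^2\big)\,d\nu,\qquad u\in C_0^\infty(\Omega),$$ is nonnegative. Let $W>0$ be a measurable function on $\Omega$ such that, for some $\lambda>0$, the Hardy inequality $$\lambda\int_\Omega Wu^2\,d\nu\le q(u)\qquad\text{for all }u\in C_0^\infty(\Omega)$$ holds. Let $V>0$ be a measurable function on $\Omega$ with $V(x)/W(x)\to0$ as $x\to\infty$ in the one-point compactification of $\Omega$. 1. One has $\lambda_\infty(\Omega,P,V)=+\infty$, where $\lambda_\infty(\Omega,P,V)$ is the supremum of all $\alpha\ge 0$ for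 which there is a compact set $K\subset\Omega$ with $\alpha\int_{\Omega\setminus K}Vu^2\,d\nu\le q(u)$ for all $u\in C_0^\infty(\Omega\setminus K)$. 2. If $V\in L^\infty_{loc}(\Omega)$, then $V^{-1}P$, that is, the operator on $L^2(\Omega,V\,d\nu)$ associated with the closure of the form $q$ on $C_0^\infty(\Omega)$ (the Friedrichs extension), is well defined and self-adjoint; its spectrum consists of a strictly increasing sequence of eigenvalues of finite multiplicity tending to $+\infty$; and for every $z\in\mathbb R$ outside the spectrum of $V^{-1}P$ the resolvent $(V^{-1}P-z)^{-1}$ is compact. 3. If the Agmon metric $|\xi|_{Ag}^2=W\langle A^{-1}\xi,\xi\rangle$ is complete and $V\in L^\infty_{loc}(\Omega)$, then $\mathcal D^{1,2}(\Omega,P,V)$, the completion of $C_0^\infty(\Omega)$ for the norm $\big(q(u)+\int_\Omega u^2V\,d\nu\big)^{1/2}$, injects compactly into $L^2(\Omega,V\,d\nu)$: the inclusion of $C_0^\infty(\Omega)$ extends to an injective compact linear operator $\mathcal D^{1,2}(\Omega,P,V)\to L^2(\Omega,V\,d\nu)$. -/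

import Mathlib

open MeasureTheory Filter Topology Set
open scoped ENNReal NNReal Manifold ContDiff

set_option linter.unusedSectionVars false

noncomputable section

/-- The Euclidean model space `ℝⁿ`. -/
abbrev Euc (n : ℕ) : Type := EuclideanSpace ℝ (Fin n)

/-- `ν` has, in every chart, a density with respect to Lebesgue measure that is bounded above and
bounded away from zero on compact sets (`a vol ≤ ν ≤ b vol` on each compact subset of a chart). -/
class IsLocallyLebesgue (n : ℕ) {M : Type*} [TopologicalSpace M] [ChartedSpace (Euc n) M]
    [MeasurableSpace M] (ν : Measure M) : Prop where
  bounds : ∀ φ ∈ atlas (Euc n) M, ∀ K : Set M, IsCompact K → K ⊆ φ.source →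
    ∃ a b : ℝ≥0, 0 < a ∧ ∀ B : Set M, B ⊆ K → MeasurableSet B →
      a * volume (φ '' B) ≤ ν B ∧ ν B ≤ b * volume (φ '' B)

/-- `f` belongs to `L^∞_loc`. -/
def IsLocEssBdd {M : Type*} [TopologicalSpace M] [MeasurableSpace M] (ν : Measure M)
    (f : M → ℝ) : Prop :=
  ∀ K : Set M, IsCompact K → ∃ C : ℝ, ∀ᵐ x ∂ν, x ∈ K → |f x| ≤ C

section Manifold

variable (n : ℕ) (M : Type*) [TopologicalSpace M] [ChartedSpace (Euc n) M]

/-- The cotangent space `T*ₓM`. -/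
abbrev Cotangent (x : M) : Type := TangentSpace 𝓘(ℝ, Euc n) x →L[ℝ] ℝ

/-- The space `C₀^∞(M)` of smooth compactly supported real functions. -/
def TestFn : Submodule ℝ (M → ℝ) where
  carrier := {u | ContMDiff 𝓘(ℝ, Euc n) 𝓘(ℝ, ℝ) ∞ u ∧ HasCompactSupport u}
  add_mem' := fun hu hv => ⟨hu.1.add hv.1, hu.2.add hv.2⟩
  zero_mem' := ⟨contMDiff_const, HasCompactSupport.zero⟩
  smul_mem' := fun t _ hu => ⟨(contMDiff_const (c := t)).mul hu.1, hu.2.smul_left (f := fun _ => t)⟩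

variable {M}

/-- The differential `duₓ`, as a cotangent vector. -/
def diffAt (u : M → ℝ) (x : M) : Cotangent n M x :=
  mfderiv 𝓘(ℝ, Euc n) 𝓘(ℝ, ℝ) u x

/-- The differential `dφₓ : TₓM → ℝⁿ` of a chart. -/
def chartDiff (φ : OpenPartialHomeomorph M (Euc n)) (x : M) :
    TangentSpace 𝓘(ℝ, Euc n) x →L[ℝ] Euc n :=
  mfderiv 𝓘(ℝ, Euc n) 𝓘(ℝ, Euc n) φ x

/-- The covector `ξ` on `ℝⁿ`, read as a cotangent vector at `x` in the coordinates given by the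
chart `φ`, i.e. `∑ ξᵢ dφⁱ`. -/
def chartCovector (φ : OpenPartialHomeomorph M (Euc n)) (x : M) (ξ : Euc n →L[ℝ] ℝ) :
    Cotangent n M x :=
  ξ.comp (chartDiff n φ x)

variable (M)

/-- The data of a symmetric second-order operator `Pu = -div(A∇u) + cu` in divergence form with
respect to the measure `ν`: `A` is a measurable field of symmetric positive definite maps
`T*M → TM`, and `c` is a measurable real function; the operator is locally uniformly elliptic, and
`A` and `c` are locally bounded. -/
structure DivFormOperator [MeasurableSpace M] (ν : Measure M) where
  A : ∀ x : M, Cotangent n M x →L[ℝ] TangentSpace 𝓘(ℝ, Euc n) x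
  c : M → ℝ
  symm : ∀ x (ξ η : Cotangent n M x), ξ (A x η) = η (A x ξ)
  posDef : ∀ x (ξ : Cotangent n M x), ξ ≠ 0 → 0 < ξ (A x ξ)
  aemeasurable_A : ∀ φ ∈ atlas (Euc n) M, ∀ ξ η : Euc n →L[ℝ] ℝ,
    AEMeasurable (fun x => chartCovector n φ x ξ (A x (chartCovector n φ x η)))
      (ν.restrict φ.source)
  aemeasurable_c : AEMeasurable c ν
  elliptic : ∀ φ ∈ atlas (Euc n) M, ∀ K : Set M, IsCompact K → K ⊆ φ.source →
    ∃ θ Θ : ℝ, 0 < θ ∧ ∀ᵐ x ∂ν, x ∈ K → ∀ ξ : Euc n →L[ℝ] ℝ,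
      θ * ‖ξ‖ ^ 2 ≤ chartCovector n φ x ξ (A x (chartCovector n φ x ξ)) ∧
      chartCovector n φ x ξ (A x (chartCovector n φ x ξ)) ≤ Θ * ‖ξ‖ ^ 2
  bdd_c : IsLocEssBdd ν c

end Manifold

section Operator

variable {n : ℕ} {M : Type*} [TopologicalSpace M] [ChartedSpace (Euc n) M]
  [MeasurableSpace M] {ν : Measure M}

namespace DivFormOperator

/-- The integrand `⟨A∇u, ∇v⟩ + cuv`. -/
def density (P : DivFormOperator n M ν) (u v : M → ℝ) (x : M) : ℝ :=
  diffAt n v x (P.A x (diffAt n u x)) + P.c x * (u x * v x)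

/-- The symmetric bilinear form of `P`. -/
def form (P : DivFormOperator n M ν) (u v : M → ℝ) : ℝ :=
  ∫ x, P.density u v x ∂ν

/-- The quadratic form `q` of `P`. -/
def q (P : DivFormOperator n M ν) (u : M → ℝ) : ℝ := P.form u u

/-- The quadratic form of `P` is nonnegative on `C₀^∞`. -/
def Nonneg (P : DivFormOperator n M ν) : Prop := ∀ u ∈ TestFn n M, 0 ≤ P.q u

/-- The Hardy inequality `l ∫_Ω W u² dν ≤ q(u)` for all `u ∈ C₀^∞(Ω)`. -/
def Hardy (P : DivFormOperator n M ν) (W : M → ℝ) (l : ℝ≥0) : Prop :=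
  ∀ u ∈ TestFn n M,
    l * ∫⁻ x, ENNReal.ofReal (W x * u x ^ 2) ∂ν ≤ ENNReal.ofReal (P.q u)

/-- The inequality `l ∫_{Ω∖K} W u² dν ≤ q(u)` for all `u ∈ C₀^∞(Ω∖K)`. -/
def HardyOutside (P : DivFormOperator n M ν) (W : M → ℝ) (K : Set M) (l : ℝ≥0) : Prop :=
  ∀ u ∈ TestFn n M, tsupport u ⊆ Kᶜ →
    l * ∫⁻ x in Kᶜ, ENNReal.ofReal (W x * u x ^ 2) ∂ν ≤ ENNReal.ofReal (P.q u)

/-- The best constant at infinity `λ_∞(Ω, P, W) ∈ [0, ∞]`. -/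
def lambdaInfty (P : DivFormOperator n M ν) (W : M → ℝ) : ℝ≥0∞ :=
  ⨆ (l : ℝ≥0) (_ : ∃ K : Set M, IsCompact K ∧ P.HardyOutside W K l), (l : ℝ≥0∞)

/-- The Agmon norm `(W ⟨A⁻¹ξ, ξ⟩)^{1/2}` of a tangent vector. -/
def agmonNorm (P : DivFormOperator n M ν) (W : M → ℝ) (x : M)
    (ξ : TangentSpace 𝓘(ℝ, Euc n) x) : ℝ :=
  Real.sqrt (W x * ((P.A x).inverse ξ) ξ)

/-- The distance of the Agmon metric: the infimum of the lengths of the `C¹` curves joining two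
points. -/
def agmonEDist (P : DivFormOperator n M ν) (W : M → ℝ) (x y : M) : ℝ≥0∞ :=
  ⨅ (γ : ℝ → M) (_ : ContMDiffOn 𝓘(ℝ, ℝ) 𝓘(ℝ, Euc n) 1 γ (Icc 0 1)) (_ : γ 0 = x)
    (_ : γ 1 = y),
    ∫⁻ t in Icc (0 : ℝ) 1, ENNReal.ofReal
      (P.agmonNorm W (γ t) (mfderivWithin 𝓘(ℝ, ℝ) 𝓘(ℝ, Euc n) γ (Icc 0 1) t (1 : ℝ)))

/-- The Agmon metric is complete: every Cauchy sequence converges. -/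
def AgmonComplete (P : DivFormOperator n M ν) (W : M → ℝ) : Prop :=
  ∀ s : ℕ → M,
    (∀ ε : ℝ≥0∞, 0 < ε → ∃ N, ∀ i ≥ N, ∀ j ≥ N, P.agmonEDist W (s i) (s j) < ε) →
    ∃ y, Tendsto (fun i => P.agmonEDist W (s i) y) atTop (𝓝 0)

end DivFormOperator

/-- The measure `V dν`. -/
def weighted (ν : Measure M) (V : M → ℝ) : Measure M :=
  ν.withDensity fun x => ENNReal.ofReal (V x)

/-- The real Hilbert space `L²(Ω, V dν)`. -/
abbrev WeightedL2 (ν : Measure M) (V : M → ℝ) : Type _ := Lp ℝ 2 (weighted ν V)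

/-- The graph of the Friedrichs operator `V⁻¹P` on `L²(Ω, V dν)`, the operator associated with the
closure in `L²(V dν)` of the form `q` on `C₀^∞`. A pair `(f, g)` belongs to it when `f` lies in the
domain of the closed form `q̄`, i.e. `f` is the limit in `L²(V dν)` of a `q`-Cauchy sequence `uₖ` of
test functions, and `q̄(f, v) = lim q(uₖ, v) = ∫ g v V dν` for every test function `v`. -/
def FriedrichsRel (P : DivFormOperator n M ν) (V : M → ℝ) (f g : WeightedL2 ν V) : Prop :=
  ∃ u : ℕ → M → ℝ, (∀ k, u k ∈ TestFn n M) ∧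
    Tendsto (fun k => eLpNorm (fun x => u k x - f x) 2 (weighted ν V)) atTop (𝓝 0) ∧
    (∀ ε : ℝ, 0 < ε → ∃ N, ∀ i ≥ N, ∀ j ≥ N, P.q (u i - u j) < ε) ∧
    ∀ v ∈ TestFn n M,
      Tendsto (fun k => P.form (u k) v) atTop (𝓝 (∫ x, g x * v x ∂(weighted ν V)))

end Operator

section Completion

variable {n : ℕ} {M : Type*} [TopologicalSpace M] [ChartedSpace (Euc n) M]
  [MeasurableSpace M] {ν : Measure M}

theorem TestFn.mdiff {u : M → ℝ} (hu : u ∈ TestFn n M) (x : M) :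
    MDifferentiableAt 𝓘(ℝ, Euc n) 𝓘(ℝ, ℝ) u x :=
  hu.1.mdifferentiableAt (by simp)

theorem diffAt_add {u v : M → ℝ} (hu : u ∈ TestFn n M) (hv : v ∈ TestFn n M) (x : M) :
    diffAt n (u + v) x = diffAt n u x + diffAt n v x :=
  mfderiv_add (TestFn.mdiff hu x) (TestFn.mdiff hv x)

theorem diffAt_smul {u : M → ℝ} (hu : u ∈ TestFn n M) (t : ℝ) (x : M) :
    diffAt n (t • u) x = t • diffAt n u x :=
  const_smul_mfderiv (TestFn.mdiff hu x) t

theorem diffAt_eq_zero {u : M → ℝ} {x : M} (hx : x ∉ tsupport u) : diffAt n u x = 0 := by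
  have h : u =ᶠ[𝓝 x] fun _ => (0 : ℝ) := notMem_tsupport_iff_eventuallyEq.1 hx
  unfold diffAt
  rw [h.mfderiv_eq]
  exact mfderiv_const

theorem isLocallyFinite_of_isLocallyLebesgue [T2Space M] [BorelSpace M]
    [hν : IsLocallyLebesgue n ν] : IsLocallyFiniteMeasure ν := by
  refine ⟨fun x => ?_⟩
  have : LocallyCompactSpace M := ChartedSpace.locallyCompactSpace (Euc n) M
  obtain ⟨K, hKx, hKs, hK⟩ := local_compact_nhds
    ((chartAt (Euc n) x).open_source.mem_nhds (mem_chart_source (Euc n) x))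
  obtain ⟨a, b, -, h⟩ := hν.bounds _ (chart_mem_atlas (Euc n) x) K hK hKs
  refine ⟨K, hKx, ((h K subset_rfl hK.isClosed.measurableSet).2).trans_lt ?_⟩
  refine ENNReal.mul_lt_top ENNReal.coe_lt_top ?_
  exact (hK.image_of_continuousOn ((chartAt (Euc n) x).continuousOn.mono hKs)).measure_lt_top

theorem diffAt_eq_chartCovector [IsManifold 𝓘(ℝ, Euc n) ∞ M] {φ : OpenPartialHomeomorph M (Euc n)}
    (hφ : φ ∈ atlas (Euc n) M) {u : M → ℝ} (hu : u ∈ TestFn n M) {x : M} (hx : x ∈ φ.source) :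
    diffAt n u x = chartCovector n φ x (fderiv ℝ (u ∘ φ.symm) (φ x)) := by
  have : IsManifold 𝓘(ℝ, Euc n) 1 M := IsManifold.of_le (n := ∞) (by simp)
  have h1 : MDifferentiableAt 𝓘(ℝ, Euc n) 𝓘(ℝ, Euc n) φ x := mdifferentiableAt_atlas hφ hx
  have h2 : MDifferentiableAt 𝓘(ℝ, Euc n) 𝓘(ℝ, ℝ) (u ∘ φ.symm) (φ x) := by
    refine MDifferentiableAt.comp (φ x) (I' := 𝓘(ℝ, Euc n)) ?_ ?_
    · exact TestFn.mdiff hu _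
    · exact mdifferentiableAt_atlas_symm hφ (φ.map_source hx)
  have h3 : u =ᶠ[𝓝 x] (u ∘ φ.symm) ∘ φ := by
    filter_upwards [φ.open_source.mem_nhds hx] with y hy
    simp [φ.left_inv hy]
  unfold diffAt chartCovector
  rw [h3.mfderiv_eq, mfderiv_comp x h2 h1, mfderiv_eq_fderiv]
  rfl

theorem continuousOn_fderiv_chart [IsManifold 𝓘(ℝ, Euc n) ∞ M]
    {φ : OpenPartialHomeomorph M (Euc n)}
    (hφ : φ ∈ atlas (Euc n) M) {u : M → ℝ} (hu : u ∈ TestFn n M) :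
    ContinuousOn (fun x => fderiv ℝ (u ∘ φ.symm) (φ x)) φ.source := by
  have h1 : ContMDiffOn 𝓘(ℝ, Euc n) 𝓘(ℝ, Euc n) ∞ φ.symm φ.target :=
    contMDiffOn_symm_of_mem_maximalAtlas (IsManifold.subset_maximalAtlas hφ)
  have h2 : ContDiffOn ℝ ∞ (u ∘ φ.symm) φ.target := by
    rw [← contMDiffOn_iff_contDiffOn]
    exact hu.1.comp_contMDiffOn h1
  have h3 := h2.continuousOn_fderiv_of_isOpen φ.open_target (by simp)
  exact h3.comp φ.continuousOn φ.mapsTo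

theorem covector_eq_sum (ξ : Euc n →L[ℝ] ℝ) :
    ξ = ∑ i, ξ (EuclideanSpace.single i 1) • (EuclideanSpace.proj i : Euc n →L[ℝ] ℝ) := by
  ext v
  have hv : v = ∑ i, v i • EuclideanSpace.single i (1 : ℝ) := by
    ext j
    simp [Finset.sum_apply, Pi.single_apply]
  conv_lhs => rw [hv]
  simp [mul_comm]

namespace DivFormOperator

variable (P : DivFormOperator n M ν)

theorem abs_pair_le {x : M} {ξ η : Cotangent n M x} :
    |ξ (P.A x η)| ≤ (ξ (P.A x ξ) + η (P.A x η)) / 2 := by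
  have hs := P.symm x ξ η
  have hp : ∀ ζ : Cotangent n M x, 0 ≤ ζ (P.A x ζ) := fun ζ => by
    by_cases h : ζ = 0
    · simp [h]
    · exact (P.posDef x ζ h).le
  have h1 := hp (ξ + η)
  have h2 := hp (ξ - η)
  simp only [map_add, map_sub, _root_.add_apply, _root_.sub_apply] at h1 h2
  rw [abs_le]
  constructor <;> linarith

theorem density_symm (u v : M → ℝ) (x : M) : P.density u v x = P.density v u x := by
  unfold density
  rw [P.symm, mul_comm (u x)]

theorem locallyIntegrable_density [T2Space M] [BorelSpace M] [IsManifold 𝓘(ℝ, Euc n) ∞ M]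
    [IsLocallyLebesgue n ν] {u v : M → ℝ} (hu : u ∈ TestFn n M) (hv : v ∈ TestFn n M) :
    LocallyIntegrable (P.density u v) ν := by
  have : IsLocallyFiniteMeasure ν := isLocallyFinite_of_isLocallyLebesgue (n := n)
  have : LocallyCompactSpace M := ChartedSpace.locallyCompactSpace (Euc n) M
  intro x
  set φ := chartAt (Euc n) x with hφ
  have hφa : φ ∈ atlas (Euc n) M := chart_mem_atlas (Euc n) x
  obtain ⟨K, hKx, hKs, hK⟩ := local_compact_nhds
    (φ.open_source.mem_nhds (mem_chart_source (Euc n) x))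
  have hKm : MeasurableSet K := hK.isClosed.measurableSet
  refine ⟨K, hKx, ?_⟩
  obtain ⟨θ, Θ, -, hell⟩ := P.elliptic φ hφa K hK hKs
  obtain ⟨C, hC⟩ := P.bdd_c K hK
  have hcu := (continuousOn_fderiv_chart hφa hu).mono hKs
  have hcv := (continuousOn_fderiv_chart hφa hv).mono hKs
  obtain ⟨a, ha⟩ := hK.exists_bound_of_continuousOn hcu
  obtain ⟨b, hb⟩ := hK.exists_bound_of_continuousOn hcv
  obtain ⟨a', ha'⟩ := hK.exists_bound_of_continuousOn hu.1.continuous.continuousOn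
  obtain ⟨b', hb'⟩ := hK.exists_bound_of_continuousOn hv.1.continuous.continuousOn
  have hmeas : AEStronglyMeasurable (P.density u v) (ν.restrict K) := by
    refine AEMeasurable.aestronglyMeasurable ?_
    refine AEMeasurable.add ?_ ?_
    · have h1 : AEMeasurable (fun y => ∑ i, ∑ j,
          fderiv ℝ (v ∘ φ.symm) (φ y) (EuclideanSpace.single i 1) *
          (fderiv ℝ (u ∘ φ.symm) (φ y) (EuclideanSpace.single j 1) *
          chartCovector n φ y (EuclideanSpace.proj i)
            (P.A y (chartCovector n φ y (EuclideanSpace.proj j))))) (ν.restrict K) := by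
        refine Finset.aemeasurable_fun_sum _ fun i _ => Finset.aemeasurable_fun_sum _ fun j _ => ?_
        refine AEMeasurable.mul ?_ (AEMeasurable.mul ?_ ?_)
        · exact (hcv.clm_apply continuousOn_const).aemeasurable hKm
        · exact (hcu.clm_apply continuousOn_const).aemeasurable hKm
        · exact (P.aemeasurable_A φ hφa _ _).mono_measure (Measure.restrict_mono hKs le_rfl)
      refine h1.congr ?_
      filter_upwards [ae_restrict_mem hKm] with y hy
      rw [diffAt_eq_chartCovector hφa hu (hKs hy), diffAt_eq_chartCovector hφa hv (hKs hy)]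
      have hlin : ∀ ξ : Euc n →L[ℝ] ℝ, chartCovector n φ y ξ =
          ∑ i, ξ (EuclideanSpace.single i 1) •
            chartCovector n φ y (EuclideanSpace.proj i) := by
        intro ξ
        conv_lhs => rw [covector_eq_sum ξ]
        ext w
        simp [chartCovector]
      rw [hlin (fderiv ℝ (v ∘ φ.symm) (φ y)), hlin (fderiv ℝ (u ∘ φ.symm) (φ y))]
      simp [Finset.mul_sum, map_sum]
      rw [Finset.sum_comm]
      refine Finset.sum_congr rfl fun i _ => Finset.sum_congr rfl fun j _ => ?_
      ring
    · exact (P.aemeasurable_c.restrict).mul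
        ((hu.1.continuous.mul hv.1.continuous).aemeasurable)
  have : IsFiniteMeasure (ν.restrict K) := ⟨by
    rw [Measure.restrict_apply_univ]; exact hK.measure_lt_top⟩
  refine Integrable.of_bound hmeas
    ((|Θ| * b ^ 2 + |Θ| * a ^ 2) / 2 + C * (a' * b')) ?_
  filter_upwards [ae_restrict_mem hKm, ae_restrict_of_ae hell, ae_restrict_of_ae hC]
    with y hy h1 h2
  have hpt : ∀ w : M → ℝ, ∀ e : ℝ, w ∈ TestFn n M → ‖fderiv ℝ (w ∘ φ.symm) (φ y)‖ ≤ e →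
      diffAt n w y (P.A y (diffAt n w y)) ≤ |Θ| * e ^ 2 := by
    intro w e hw he
    rw [diffAt_eq_chartCovector hφa hw (hKs hy)]
    refine (h1 hy _).2.trans ?_
    gcongr
    exact le_abs_self Θ
  have e1 := (P.abs_pair_le (ξ := diffAt n v y) (η := diffAt n u y)).trans
    (div_le_div_of_nonneg_right (add_le_add (hpt v b hv (hb y hy)) (hpt u a hu (ha y hy)))
      zero_le_two)
  have e2 : |P.c y * (u y * v y)| ≤ C * (a' * b') := by
    rw [abs_mul, abs_mul]
    have h3 := ha' y hy
    have h4 := hb' y hy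
    rw [Real.norm_eq_abs] at h3 h4
    have := (abs_nonneg _).trans (h2 hy)
    have := (abs_nonneg _).trans h3
    gcongr
    exact h2 hy
  rw [Real.norm_eq_abs]
  exact (abs_add_le _ _).trans (add_le_add e1 e2)

theorem integrable_density [T2Space M] [BorelSpace M] [IsManifold 𝓘(ℝ, Euc n) ∞ M]
    [IsLocallyLebesgue n ν] {u v : M → ℝ} (hu : u ∈ TestFn n M) (hv : v ∈ TestFn n M) :
    Integrable (P.density u v) ν := by
  refine (integrableOn_iff_integrable_of_support_subset (s := tsupport u) ?_).1
    ((P.locallyIntegrable_density hu hv).integrableOn_isCompact hu.2)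
  intro x hx
  by_contra h
  apply hx
  simp [density, diffAt_eq_zero h, image_eq_zero_of_notMem_tsupport h]

theorem form_symm (u v : M → ℝ) : P.form u v = P.form v u := by
  unfold form
  exact integral_congr_ae (Eventually.of_forall fun x => P.density_symm u v x)

section

variable [T2Space M] [BorelSpace M] [IsManifold 𝓘(ℝ, Euc n) ∞ M] [IsLocallyLebesgue n ν]

theorem form_add_left {u v w : M → ℝ} (hu : u ∈ TestFn n M) (hv : v ∈ TestFn n M)
    (hw : w ∈ TestFn n M) : P.form (u + v) w = P.form u w + P.form v w := by
  unfold form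
  rw [← integral_add (P.integrable_density hu hw) (P.integrable_density hv hw)]
  refine integral_congr_ae (Eventually.of_forall fun x => ?_)
  simp only [density, diffAt_add hu hv, map_add, Pi.add_apply]
  ring

theorem form_smul_left {u w : M → ℝ} (hu : u ∈ TestFn n M) (t : ℝ) :
    P.form (t • u) w = t * P.form u w := by
  unfold form
  rw [← integral_const_mul]
  refine integral_congr_ae (Eventually.of_forall fun x => ?_)
  simp only [density, diffAt_smul hu, map_smul, Pi.smul_apply, smul_eq_mul]
  ring

end

end DivFormOperator

theorem IsLocEssBdd.locallyIntegrable [T2Space M] [BorelSpace M] [IsLocallyLebesgue n ν]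
    {V : M → ℝ} (hV : IsLocEssBdd ν V) (hm : AEMeasurable V ν) : LocallyIntegrable V ν := by
  have : IsLocallyFiniteMeasure ν := isLocallyFinite_of_isLocallyLebesgue (n := n)
  have : LocallyCompactSpace M := ChartedSpace.locallyCompactSpace (Euc n) M
  intro x
  obtain ⟨K, hK, hKx⟩ := exists_compact_mem_nhds x
  obtain ⟨C, hC⟩ := hV K hK
  have : IsFiniteMeasure (ν.restrict K) := ⟨by
    rw [Measure.restrict_apply_univ]; exact hK.measure_lt_top⟩
  refine ⟨K, hKx, Integrable.of_bound hm.restrict.aestronglyMeasurable C ?_⟩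
  filter_upwards [ae_restrict_mem hK.isClosed.measurableSet, ae_restrict_of_ae hC] with y hy h
  exact h hy

theorem integrable_mul_testFn [T2Space M] [BorelSpace M] {V : M → ℝ}
    (hV : LocallyIntegrable V ν) {u v : M → ℝ} (hu : u ∈ TestFn n M) (hv : v ∈ TestFn n M) :
    Integrable (fun x => V x * (u x * v x)) ν := by
  have hc : Continuous fun x => u x * v x := hu.1.continuous.mul hv.1.continuous
  have hs : HasCompactSupport fun x => u x * v x := hu.2.mul_right
  have := hV.integrable_smul_left_of_hasCompactSupport hc hs
  simpa [mul_comm] using this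

variable (P : DivFormOperator n M ν)

/-- The space `C₀^∞(Ω)`, to be equipped with the norm `(q(u) + ∫ u² V dν)^{1/2}`. -/
@[nolint unusedArguments]
def PreD12 (_hP : P.Nonneg) {V : M → ℝ} (_hV : ∀ x, 0 < V x) (_hVi : LocallyIntegrable V ν) :
    Type _ := TestFn n M

namespace PreD12

variable {P} {hP : P.Nonneg} {V : M → ℝ} {hV : ∀ x, 0 < V x} {hVi : LocallyIntegrable V ν}

instance : AddCommGroup (PreD12 P hP hV hVi) := inferInstanceAs (AddCommGroup (TestFn n M))

instance : Module ℝ (PreD12 P hP hV hVi) := inferInstanceAs (Module ℝ (TestFn n M))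

/-- The test function underlying an element. -/
def toFun (u : PreD12 P hP hV hVi) : M → ℝ := (show TestFn n M from u).1

theorem toFun_mem (u : PreD12 P hP hV hVi) : u.toFun ∈ TestFn n M :=
  (show TestFn n M from u).2

variable [T2Space M] [BorelSpace M] [IsManifold 𝓘(ℝ, Euc n) ∞ M] [IsLocallyLebesgue n ν]

instance core : PreInnerProductSpace.Core ℝ (PreD12 P hP hV hVi) where
  inner u v := P.form u.toFun v.toFun + ∫ x, V x * (u.toFun x * v.toFun x) ∂ν
  conj_inner_symm u v := by
    simp only [conj_trivial]
    rw [P.form_symm]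
    simp only [mul_comm (u.toFun _)]
  re_inner_nonneg u := by
    refine add_nonneg (hP _ u.toFun_mem) (integral_nonneg fun x => ?_)
    exact mul_nonneg (hV x).le (mul_self_nonneg _)
  add_left u v w := by
    have h : (u + v).toFun = u.toFun + v.toFun := rfl
    rw [h, P.form_add_left u.toFun_mem v.toFun_mem w.toFun_mem, add_add_add_comm,
      ← integral_add (integrable_mul_testFn hVi u.toFun_mem w.toFun_mem)
        (integrable_mul_testFn hVi v.toFun_mem w.toFun_mem)]
    simp only [Pi.add_apply]
    congr 2
    ext x
    ring
  smul_left u v t := by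
    have h : (t • u).toFun = t • u.toFun := rfl
    rw [h, P.form_smul_left u.toFun_mem, conj_trivial, mul_add, ← integral_const_mul]
    simp only [Pi.smul_apply, smul_eq_mul]
    congr 2
    ext x
    ring

instance : SeminormedAddCommGroup (PreD12 P hP hV hVi) :=
  InnerProductSpace.Core.toSeminormedAddCommGroup (𝕜 := ℝ)

instance : InnerProductSpace ℝ (PreD12 P hP hV hVi) := InnerProductSpace.ofCore core

theorem norm_sq_eq (u : PreD12 P hP hV hVi) :
    ‖u‖ ^ 2 = P.q u.toFun + ∫ x, V x * u.toFun x ^ 2 ∂ν := by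
  rw [← real_inner_self_eq_norm_sq]
  simp only [sq]
  rfl

end PreD12

/-- The space `𝒟^{1,2}(Ω, P, V)`, the completion of `C₀^∞(Ω)` for the norm
`(q(u) + ∫ u² V dν)^{1/2}`. -/
abbrev D12 [T2Space M] [BorelSpace M] [IsManifold 𝓘(ℝ, Euc n) ∞ M] [IsLocallyLebesgue n ν]
    (hP : P.Nonneg) {V : M → ℝ} (hV : ∀ x, 0 < V x) (hVi : LocallyIntegrable V ν) : Type _ :=
  UniformSpace.Completion (PreD12 P hP hV hVi)

end Completion

section Spectrum

variable {H : Type*} [NormedAddCommGroup H] [InnerProductSpace ℝ H]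

/-- `R` is the bounded inverse `(T - z)⁻¹` of the unbounded operator `T - z`. -/
def IsResolventAt (T : H →ₗ.[ℝ] H) (z : ℝ) (R : H →L[ℝ] H) : Prop :=
  (∀ f : H, ∃ h : R f ∈ T.domain, T ⟨R f, h⟩ - z • R f = f) ∧
  ∀ u : T.domain, R (T u - z • (u : H)) = u

/-- The spectrum of an unbounded operator: the set of `z` at which there is no bounded resolvent. -/
def unboundedSpectrum (T : H →ₗ.[ℝ] H) : Set ℝ :=
  {z | ¬ ∃ R : H →L[ℝ] H, IsResolventAt T z R}

/-- The eigenspace of an unbounded operator. -/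
def unboundedEigenspace (T : H →ₗ.[ℝ] H) (z : ℝ) : Submodule ℝ H where
  carrier := {f | ∃ h : f ∈ T.domain, T ⟨f, h⟩ = z • f}
  add_mem' := by
    rintro f g ⟨hf, hf'⟩ ⟨hg, hg'⟩
    refine ⟨T.domain.add_mem hf hg, ?_⟩
    have := T.map_add ⟨f, hf⟩ ⟨g, hg⟩
    rw [hf', hg', ← smul_add] at this
    exact this
  zero_mem' := ⟨T.domain.zero_mem, by
    rw [smul_zero]; exact T.map_zero⟩
  smul_mem' := by
    rintro t f ⟨hf, hf'⟩
    refine ⟨T.domain.smul_mem t hf, ?_⟩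
    have := T.map_smul t ⟨f, hf⟩
    rw [hf', smul_comm] at this
    exact this

/-- The spectrum of `T` consists of a strictly increasing sequence of eigenvalues of finite
multiplicity tending to `+∞`. -/
def HasDiscreteSpectrum (T : H →ₗ.[ℝ] H) : Prop :=
  ∃ m : ℕ → ℝ, StrictMono m ∧ Tendsto m atTop atTop ∧ unboundedSpectrum T = range m ∧
    ∀ k, unboundedEigenspace T (m k) ≠ ⊥ ∧ FiniteDimensional ℝ (unboundedEigenspace T (m k))

end Spectrum
end

/-!
The claim on `λ_∞` is a direct comparison: off a compact set `V ≤ ε W`, so the Hardy inequality for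
`W` gives one for `V` with an arbitrarily large constant (`DivFormOperator.lambdaInfty_eq_top`). The
substance of the other claims is a local estimate, `exists_coordBall_integral_le`: near every point
there are a coordinate ball `B` and a constant `C` with `∫_B (u² + |∇u|²) ≤ C q(u)` for all test
functions `u`. It needs neither a ground state nor a Harnack inequality, and is obtained as follows.

* The form is nonnegative at `√(u² + ψ²)` (smoothed). Since the modulus has less energy than the
  pair `(u, ψ)`, taking `ψ = 1` on a compact set bounds the energy of `arsinh u` there by
  `q(u) + q(ψ)` (`DivFormOperator.setIntegral_energy_div_le`). The Cauchy-Schwarz inequality for the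
  form with the test functions `χ² u` and `χ² u (1 + u²)^(s - 1)` then gives Caccioppoli
  inequalities for `u` and for small powers of `1 + u²`, the latter with a constant independent of
  `s` (`DivFormOperator.integral_sq_mul_energy_le`,
  `DivFormOperator.exists_integral_rpow_mul_energy_le`).
* As `W > 0`, the Hardy inequality shows that `|u| ≤ 1` outside a set of small measure when `q(u)`
  is small (`DivFormOperator.exists_measure_one_lt_le`). A Poincaré inequality in which the mean
  value is replaced by the integral over a set filling half of every small ball
  (`lintegral_sq_le_of_volume_diff_le`) therefore applies to `z = (1 + u²)^(s/2)`.
* The gradient of `z` carries a factor `s`. For small `s` the boundary term of the Caccioppoli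
  inequality can be absorbed on one fixed ball if the cutoff itself satisfies a Hardy inequality,
  and `χ = exp (-1 / t)` does (`exists_hardy_weight`). So `∫ (1 + u²)^s` is bounded, and a second
  absorption argument over concentric balls raises this to a bound for `∫ u²`
  (`exists_setIntegral_sq_le`). Homogeneity makes the bound proportional to `q(u)`.

Together with the Rellich theorem on coordinate balls and with `V ≤ ε W` at infinity, the local
estimate bounds `∫ V u²` by `ε q(u)` and finitely many bounded functionals
(`SmallModuloFinite.univ`), so the extension `j` of the inclusion to `𝒟^{1,2}` is compact. It also
makes `q` closable (`tendsto_form_zero`), so that `j` is injective. By the Riesz representation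
theorem the Friedrichs operator is `S⁻¹ - 1` with `S = j j†` (`friedrichsRel_iff`), and its spectral
properties are those of the compact, positive, injective operator `S` on an infinite-dimensional
space (`hasDiscreteSpectrum_inverseOperator`).
-/

noncomputable section

/-! ### Poincaré and Rellich inequalities through averages over small balls -/

section Euclidean

variable {n : ℕ}

theorem ofReal_sq_le_two_mul (a b : ℝ) :
    ENNReal.ofReal (a ^ 2) ≤
      2 * ENNReal.ofReal ((b - a) ^ 2) + 2 * ENNReal.ofReal (b ^ 2) := by
  rw [← ENNReal.ofReal_ofNat 2, ← ENNReal.ofReal_mul zero_le_two,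
    ← ENNReal.ofReal_mul zero_le_two, ← ENNReal.ofReal_add (by positivity) (by positivity)]
  refine ENNReal.ofReal_le_ofReal ?_
  nlinarith [sq_nonneg (2 * b - a)]

/-- The fundamental theorem of calculus along a segment, with the Cauchy-Schwarz inequality. -/
theorem sq_sub_le_lintegral_fderiv {f : Euc n → ℝ} (hf : ContDiff ℝ 1 f) {r : ℝ} (x h : Euc n)
    (hr : ‖h‖ ≤ r) :
    ENNReal.ofReal ((f (x + h) - f x) ^ 2) ≤ ENNReal.ofReal (r ^ 2) *
      ∫⁻ t in Icc (0 : ℝ) 1, ENNReal.ofReal (‖fderiv ℝ f (x + t • h)‖ ^ 2) := by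
  have hr0 : 0 ≤ r := (norm_nonneg h).trans hr
  have hc : Continuous fun t : ℝ => fderiv ℝ f (x + t • h) :=
    (hf.continuous_fderiv one_ne_zero).comp (by fun_prop)
  have hd : ∀ t : ℝ, HasDerivAt (fun t : ℝ => f (x + t • h)) (fderiv ℝ f (x + t • h) h) t := by
    intro t
    have h1 : HasDerivAt (fun t : ℝ => x + t • h) h t := by
      simpa using ((hasDerivAt_id t).smul_const h).const_add x
    exact ((hf.differentiable one_ne_zero _).hasFDerivAt).comp_hasDerivAt t h1
  have hi : ∫ t in (0 : ℝ)..1, fderiv ℝ f (x + t • h) h = f (x + h) - f x := by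
    rw [intervalIntegral.integral_eq_sub_of_hasDerivAt (fun t _ => hd t)
      ((hc.clm_apply continuous_const).intervalIntegrable _ _)]
    simp
  have hcs : (f (x + h) - f x) ^ 2 ≤ r ^ 2 * ∫ t in (0 : ℝ)..1, ‖fderiv ℝ f (x + t • h)‖ ^ 2 := by
    have hn : Continuous fun t : ℝ => ‖fderiv ℝ f (x + t • h)‖ := hc.norm
    set a := ∫ t in (0 : ℝ)..1, ‖fderiv ℝ f (x + t • h)‖ with ha
    have h1 : |f (x + h) - f x| ≤ r * a := by
      rw [← hi, ha, ← intervalIntegral.integral_const_mul, ← Real.norm_eq_abs]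
      refine intervalIntegral.norm_integral_le_of_norm_le zero_le_one
        (Eventually.of_forall fun t _ => ?_) ((hn.const_mul r).intervalIntegrable _ _)
      refine (ContinuousLinearMap.le_opNorm _ _).trans ?_
      rw [mul_comm]
      gcongr
    have h2 : a ^ 2 ≤ ∫ t in (0 : ℝ)..1, ‖fderiv ℝ f (x + t • h)‖ ^ 2 := by
      have : 0 ≤ ∫ t in (0 : ℝ)..1, (‖fderiv ℝ f (x + t • h)‖ - a) ^ 2 :=
        intervalIntegral.integral_nonneg zero_le_one fun t _ => sq_nonneg _
      have e : ∫ t in (0 : ℝ)..1, (‖fderiv ℝ f (x + t • h)‖ - a) ^ 2 =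
          (∫ t in (0 : ℝ)..1, ‖fderiv ℝ f (x + t • h)‖ ^ 2) - 2 * a * a + a ^ 2 := by
        have : ∀ t : ℝ, (‖fderiv ℝ f (x + t • h)‖ - a) ^ 2 = ‖fderiv ℝ f (x + t • h)‖ ^ 2 -
          2 * a * ‖fderiv ℝ f (x + t • h)‖ + a ^ 2 := fun t => by ring
        simp_rw [this]
        have i1 : IntervalIntegrable (fun t : ℝ => ‖fderiv ℝ f (x + t • h)‖ ^ 2) volume 0 1 :=
          (hn.pow 2).intervalIntegrable _ _
        have i2 : IntervalIntegrable (fun t : ℝ => 2 * a * ‖fderiv ℝ f (x + t • h)‖) volume 0 1 :=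
          (hn.const_mul _).intervalIntegrable _ _
        rw [intervalIntegral.integral_add (i1.sub i2) intervalIntegrable_const,
          intervalIntegral.integral_sub i1 i2, intervalIntegral.integral_const_mul]
        simp [ha]
      rw [e] at this
      linarith
    calc (f (x + h) - f x) ^ 2 = |f (x + h) - f x| ^ 2 := (sq_abs _).symm
      _ ≤ (r * a) ^ 2 := by gcongr
      _ = r ^ 2 * a ^ 2 := by ring
      _ ≤ _ := by gcongr
  rw [intervalIntegral.integral_of_le zero_le_one, ← integral_Icc_eq_integral_Ioc] at hcs
  refine (ENNReal.ofReal_le_ofReal hcs).trans ?_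
  rw [ENNReal.ofReal_mul (sq_nonneg r), ofReal_integral_eq_lintegral_ofReal]
  · exact (hc.norm.pow 2).continuousOn.integrableOn_compact isCompact_Icc
  · exact Eventually.of_forall fun t => by positivity

/-- Translating by `h` changes a `C¹` function, in `L²` of a ball, by at most `‖h‖` times the
`L²` norm of its gradient on a slightly larger ball. -/
theorem lintegral_sq_translate_sub_le {f : Euc n → ℝ} (hf : ContDiff ℝ 1 f) {r : ℝ} (ρ : ℝ)
    (y h : Euc n) (hr : ‖h‖ ≤ r) :
    ∫⁻ x in Metric.closedBall y ρ, ENNReal.ofReal ((f (x + h) - f x) ^ 2) ≤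
      ENNReal.ofReal (r ^ 2) *
        ∫⁻ x in Metric.closedBall y (ρ + r), ENNReal.ofReal (‖fderiv ℝ f x‖ ^ 2) := by
  set F : Euc n → ℝ≥0∞ := fun x => ENNReal.ofReal (‖fderiv ℝ f x‖ ^ 2) with hF
  have hFc : Continuous F := ENNReal.continuous_ofReal.comp
    ((hf.continuous_fderiv one_ne_zero).norm.pow 2)
  have hswap : ∫⁻ x in Metric.closedBall y ρ, ∫⁻ t in Icc (0 : ℝ) 1, F (x + t • h) =
      ∫⁻ t in Icc (0 : ℝ) 1, ∫⁻ x in Metric.closedBall y ρ, F (x + t • h) := by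
    refine lintegral_lintegral_swap ?_
    have : Continuous fun p : Euc n × ℝ => F (p.1 + p.2 • h) := hFc.comp (by fun_prop)
    exact this.measurable.aemeasurable
  calc _ ≤ ∫⁻ x in Metric.closedBall y ρ, ENNReal.ofReal (r ^ 2) *
        ∫⁻ t in Icc (0 : ℝ) 1, F (x + t • h) :=
        lintegral_mono fun x => sq_sub_le_lintegral_fderiv hf x h hr
    _ = ENNReal.ofReal (r ^ 2) * ∫⁻ t in Icc (0 : ℝ) 1,
        ∫⁻ x in Metric.closedBall y ρ, F (x + t • h) := by
        rw [lintegral_const_mul' _ _ ENNReal.ofReal_ne_top, hswap]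
    _ ≤ ENNReal.ofReal (r ^ 2) * ∫⁻ t in Icc (0 : ℝ) 1,
        ∫⁻ x in Metric.closedBall y (ρ + r), F x := by
        refine mul_le_mul_right (setLIntegral_mono' measurableSet_Icc fun t ht => ?_) _
        rw [← lintegral_indicator measurableSet_closedBall,
          ← lintegral_indicator measurableSet_closedBall,
          ← lintegral_add_right_eq_self (μ := volume)
            ((Metric.closedBall y (ρ + r)).indicator F) (t • h)]
        refine lintegral_mono fun x => ?_
        by_cases hx : x ∈ Metric.closedBall y ρ
        · rw [indicator_of_mem hx, indicator_of_mem]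
          rw [Metric.mem_closedBall, dist_eq_norm] at hx ⊢
          have e : x + t • h - y = (x - y) + t • h := by abel
          rw [e]
          refine (norm_add_le _ _).trans (add_le_add hx ?_)
          rw [norm_smul, Real.norm_eq_abs, abs_of_nonneg ht.1]
          exact (mul_le_of_le_one_left (norm_nonneg h) ht.2).trans hr
        · rw [indicator_of_notMem hx]; exact zero_le
    _ = _ := by simp

theorem lintegral_ball_translate_le {F : Euc n → ℝ≥0∞} (hF : Measurable F) {r : ℝ} (ρ : ℝ)
    (y : Euc n) :
    ∫⁻ x in Metric.closedBall y ρ, ∫⁻ h in Metric.ball (0 : Euc n) r, F (x + h) ≤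
      volume (Metric.ball (0 : Euc n) r) * ∫⁻ x in Metric.closedBall y (ρ + r), F x := by
  rw [lintegral_lintegral_swap]
  · calc _ ≤ ∫⁻ _ in Metric.ball (0 : Euc n) r, ∫⁻ x in Metric.closedBall y (ρ + r), F x := by
          refine setLIntegral_mono' measurableSet_ball fun h hh => ?_
          rw [← lintegral_indicator measurableSet_closedBall,
            ← lintegral_indicator measurableSet_closedBall,
            ← lintegral_add_right_eq_self (μ := volume)
              ((Metric.closedBall y (ρ + r)).indicator F) h]
          refine lintegral_mono fun x => ?_
          by_cases hx : x ∈ Metric.closedBall y ρ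
          · rw [indicator_of_mem hx, indicator_of_mem]
            rw [Metric.mem_closedBall, dist_eq_norm] at hx ⊢
            have e : x + h - y = (x - y) + h := by abel
            rw [e]
            rw [mem_ball_zero_iff] at hh
            exact (norm_add_le _ _).trans (add_le_add hx hh.le)
          · rw [indicator_of_notMem hx]; exact zero_le
      _ = _ := by rw [lintegral_const, Measure.restrict_apply_univ, mul_comm]
  · exact (hF.comp (measurable_fst.add measurable_snd)).aemeasurable

/-- A Poincaré inequality in which the mean value is replaced by the integral over a set `G`
filling at least half of every ball of radius `r`. -/
theorem lintegral_sq_le_of_volume_diff_le {f : Euc n → ℝ} (hf : ContDiff ℝ 1 f) {r : ℝ}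
    (hr : 0 < r) (ρ : ℝ) (y : Euc n) {G : Set (Euc n)} (hG : MeasurableSet G)
    (hvol : volume (Metric.closedBall y (ρ + r) \ G) ≤ volume (Metric.ball (0 : Euc n) r) / 2) :
    ∫⁻ x in Metric.closedBall y ρ, ENNReal.ofReal (f x ^ 2) ≤
      4 * (ENNReal.ofReal (r ^ 2) *
        ∫⁻ x in Metric.closedBall y (ρ + r), ENNReal.ofReal (‖fderiv ℝ f x‖ ^ 2)) +
      4 * ∫⁻ x in Metric.closedBall y (ρ + r) ∩ G, ENNReal.ofReal (f x ^ 2) := by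
  set v := volume (Metric.ball (0 : Euc n) r) with hv
  have hv0 : v ≠ 0 := (Metric.measure_ball_pos _ _ hr).ne'
  have hvt : v ≠ ⊤ := measure_ball_lt_top.ne
  set F : Euc n → ℝ≥0∞ := G.indicator fun x => ENNReal.ofReal (f x ^ 2) with hF
  have hfm : Measurable fun x => ENNReal.ofReal (f x ^ 2) :=
    (ENNReal.continuous_ofReal.comp (hf.continuous.pow 2)).measurable
  have hFm : Measurable F := hfm.indicator hG
  have key : ∀ x ∈ Metric.closedBall y ρ, ENNReal.ofReal (f x ^ 2) * (v / 2) ≤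
      2 * (∫⁻ h in Metric.ball (0 : Euc n) r, ENNReal.ofReal ((f (x + h) - f x) ^ 2)) +
      2 * ∫⁻ h in Metric.ball (0 : Euc n) r, F (x + h) := by
    intro x hx
    set Gx := Metric.ball (0 : Euc n) r ∩ (fun h => x + h) ⁻¹' G with hGx
    have hGxm : MeasurableSet Gx := measurableSet_ball.inter ((measurable_const_add x) hG)
    have h1 : v / 2 ≤ volume Gx := by
      have h2 : volume (Metric.ball (0 : Euc n) r \ (fun h => x + h) ⁻¹' G) ≤ v / 2 := by
        refine le_trans ?_ hvol
        rw [← measure_preimage_add volume x (Metric.closedBall y (ρ + r) \ G)]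
        refine measure_mono fun h hh => ⟨?_, hh.2⟩
        have := hh.1
        rw [mem_ball_zero_iff] at this
        simp only [mem_closedBall_iff_norm] at hx ⊢
        have e : x + h - y = (x - y) + h := by abel
        rw [e]
        exact (norm_add_le _ _).trans (add_le_add hx this.le)
      have h3 : v ≤ volume Gx + v / 2 := by
        rw [hv, ← measure_inter_add_sdiff (Metric.ball (0 : Euc n) r)
          ((measurable_const_add x) hG)]
        exact add_le_add le_rfl (h2.trans (by rw [hv, measure_inter_add_sdiff _
          ((measurable_const_add x) hG)]))
      have h4 : v / 2 + v / 2 ≤ volume Gx + v / 2 := by rwa [ENNReal.add_halves]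
      exact (ENNReal.add_le_add_iff_right (ENNReal.div_ne_top hvt two_ne_zero)).1 h4
    calc ENNReal.ofReal (f x ^ 2) * (v / 2) ≤ ENNReal.ofReal (f x ^ 2) * volume Gx := by gcongr
      _ = ∫⁻ h in Gx, ENNReal.ofReal (f x ^ 2) := by simp
      _ ≤ ∫⁻ h in Gx, (2 * ENNReal.ofReal ((f (x + h) - f x) ^ 2) + 2 * F (x + h)) := by
          refine setLIntegral_mono' hGxm fun h hh => ?_
          rw [hF, indicator_of_mem (show x + h ∈ G from hh.2)]
          exact ofReal_sq_le_two_mul _ _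
      _ ≤ ∫⁻ h in Metric.ball (0 : Euc n) r,
          (2 * ENNReal.ofReal ((f (x + h) - f x) ^ 2) + 2 * F (x + h)) :=
          lintegral_mono_set inter_subset_left
      _ = _ := by
          rw [lintegral_add_right, lintegral_const_mul' _ _ (by simp),
            lintegral_const_mul' _ _ (by simp)]
          exact (hFm.comp (measurable_const_add x)).const_mul 2
  have key2 : (∫⁻ x in Metric.closedBall y ρ, ENNReal.ofReal (f x ^ 2)) * (v / 2) ≤
      2 * (v * (ENNReal.ofReal (r ^ 2) *
        ∫⁻ x in Metric.closedBall y (ρ + r), ENNReal.ofReal (‖fderiv ℝ f x‖ ^ 2))) +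
      2 * (v * ∫⁻ x in Metric.closedBall y (ρ + r) ∩ G, ENNReal.ofReal (f x ^ 2)) := by
    rw [← lintegral_mul_const' _ _ (ENNReal.div_ne_top hvt two_ne_zero)]
    refine (setLIntegral_mono' measurableSet_closedBall key).trans ?_
    rw [lintegral_add_right, lintegral_const_mul' _ _ (by simp),
      lintegral_const_mul' _ _ (by simp)]
    · refine add_le_add (mul_le_mul_right ?_ _) (mul_le_mul_right ?_ _)
      · rw [lintegral_lintegral_swap]
        · refine (setLIntegral_mono' measurableSet_ball fun h hh =>
            lintegral_sq_translate_sub_le hf ρ y h (r := r) ?_).trans ?_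
          · exact (mem_ball_zero_iff.1 hh).le
          · rw [lintegral_const, Measure.restrict_apply_univ, mul_comm]
        · have : Continuous fun p : Euc n × Euc n =>
              ENNReal.ofReal ((f (p.1 + p.2) - f p.1) ^ 2) := by
            have := hf.continuous
            exact ENNReal.continuous_ofReal.comp (by fun_prop)
          exact this.measurable.aemeasurable
      · refine (lintegral_ball_translate_le hFm ρ y).trans (le_of_eq ?_)
        rw [hF, setLIntegral_indicator hG, inter_comm]
    · refine Measurable.const_mul ?_ 2
      exact Measurable.lintegral_prod_right' (f := fun p : Euc n × Euc n => F (p.1 + p.2))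
        (hFm.comp (measurable_fst.add measurable_snd))
  rw [← ENNReal.mul_le_mul_iff_left (c := v / 2) (by simp [hv0])
    (ENNReal.div_ne_top hvt two_ne_zero)]
  refine key2.trans (le_of_eq ?_)
  have e : ∀ X : ℝ≥0∞, 2 * (v * X) = 4 * X * (v / 2) := by
    intro X
    have h4 : (4 : ℝ≥0∞) = 2 * 2 := by norm_num
    rw [h4, mul_assoc, mul_assoc, mul_comm X, ← mul_assoc 2 (v / 2),
      ENNReal.mul_div_cancel two_ne_zero (by simp)]
  rw [e, e, ← add_mul]

theorem setIntegral_sq_le_of_volume_diff_le {f : Euc n → ℝ} (hf : ContDiff ℝ 1 f) {r : ℝ}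
    (hr : 0 < r) (ρ : ℝ) (y : Euc n) {G : Set (Euc n)} (hG : MeasurableSet G)
    (hvol : volume (Metric.closedBall y (ρ + r) \ G) ≤ volume (Metric.ball (0 : Euc n) r) / 2) :
    ∫ x in Metric.closedBall y ρ, f x ^ 2 ≤
      4 * (r ^ 2 * ∫ x in Metric.closedBall y (ρ + r), ‖fderiv ℝ f x‖ ^ 2) +
      4 * ∫ x in Metric.closedBall y (ρ + r) ∩ G, f x ^ 2 := by
  have hfc : Continuous fun x => f x ^ 2 := hf.continuous.pow 2
  have hgc : Continuous fun x => ‖fderiv ℝ f x‖ ^ 2 :=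
    (hf.continuous_fderiv one_ne_zero).norm.pow 2
  have i1 : ∀ ρ, IntegrableOn (fun x => f x ^ 2) (Metric.closedBall y ρ) := fun ρ =>
    hfc.continuousOn.integrableOn_compact (isCompact_closedBall _ _)
  have i2 : ∀ ρ, IntegrableOn (fun x => ‖fderiv ℝ f x‖ ^ 2) (Metric.closedBall y ρ) := fun ρ =>
    hgc.continuousOn.integrableOn_compact (isCompact_closedBall _ _)
  have h := lintegral_sq_le_of_volume_diff_le hf hr ρ y hG hvol
  rw [← ofReal_integral_eq_lintegral_ofReal (i1 ρ) (Eventually.of_forall fun x => sq_nonneg _),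
    ← ofReal_integral_eq_lintegral_ofReal (i2 _) (Eventually.of_forall fun x => sq_nonneg _),
    ← ofReal_integral_eq_lintegral_ofReal ((i1 _).mono_set inter_subset_left)
      (Eventually.of_forall fun x => sq_nonneg _), ← ENNReal.ofReal_mul (sq_nonneg r),
    ← ENNReal.ofReal_ofNat 4, ← ENNReal.ofReal_mul (by norm_num),
    ← ENNReal.ofReal_mul (by norm_num), ← ENNReal.ofReal_add] at h
  · refine (ENNReal.ofReal_le_ofReal_iff ?_).1 h
    have := integral_nonneg (μ := volume.restrict (Metric.closedBall y (ρ + r)))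
      (f := fun x => ‖fderiv ℝ f x‖ ^ 2) fun x => sq_nonneg _
    have := integral_nonneg (μ := volume.restrict (Metric.closedBall y (ρ + r) ∩ G))
      (f := fun x => f x ^ 2) fun x => sq_nonneg _
    positivity
  · have := integral_nonneg (μ := volume.restrict (Metric.closedBall y (ρ + r)))
      (f := fun x => ‖fderiv ℝ f x‖ ^ 2) fun x => sq_nonneg _
    positivity
  · have := integral_nonneg (μ := volume.restrict (Metric.closedBall y (ρ + r) ∩ G))
      (f := fun x => f x ^ 2) fun x => sq_nonneg _
    positivity

/-- A quantitative Rellich theorem: up to a small multiple of the gradient, the `L²` norm on a ball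
is controlled by the mean values over finitely many small balls. -/
theorem exists_finset_setIntegral_sq_le (y : Euc n) {ρ r : ℝ} (hr : 0 < r) :
    ∃ t : Finset (Euc n), (∀ p ∈ t, p ∈ Metric.closedBall y ρ) ∧
      ∀ f : Euc n → ℝ, ContDiff ℝ 1 f →
      ∫ x in Metric.closedBall y ρ, f x ^ 2 ≤
        2 ^ (n + 1) * (2 * r) ^ 2 *
          (∫ x in Metric.closedBall y (ρ + 2 * r), ‖fderiv ℝ f x‖ ^ 2) +
        2 * volume.real (Metric.closedBall y ρ) *
          ∑ p ∈ t, (⨍ x in Metric.ball p r, f x) ^ 2 := by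
  obtain ⟨t, htK, htf, ht⟩ :=
    (isCompact_closedBall y ρ).finite_cover_balls hr
  lift t to Finset (Euc n) using htf
  refine ⟨t, fun p hp => htK hp, fun f hf => ?_⟩
  set v := volume.real (Metric.ball (0 : Euc n) r) with hv
  have hv0 : 0 < v := ENNReal.toReal_pos (Metric.measure_ball_pos _ _ hr).ne' measure_ball_lt_top.ne
  have hvp : ∀ p : Euc n, volume.real (Metric.ball p r) = v := fun p => by
    rw [hv, Measure.real, Measure.real, Measure.addHaar_ball_center]
  have hv2 : volume (Metric.ball (0 : Euc n) (2 * r)) = ENNReal.ofReal (2 ^ n * v) := by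
    rw [Measure.addHaar_ball_mul_of_pos _ _ zero_lt_two, finrank_euclideanSpace_fin,
      ENNReal.ofReal_mul (by positivity), hv, ofReal_measureReal]
  have hfc := hf.continuous
  set S := ∑ p ∈ t, (⨍ x in Metric.ball p r, f x) ^ 2 with hS
  have key : ∀ x ∈ Metric.closedBall y ρ, ENNReal.ofReal (f x ^ 2) ≤
      ENNReal.ofReal (2 / v) * (∫⁻ h in Metric.ball (0 : Euc n) (2 * r),
        ENNReal.ofReal ((f (x + h) - f x) ^ 2)) + ENNReal.ofReal (2 * S) := by
    intro x hx
    obtain ⟨p, hpt, hxp⟩ : ∃ p ∈ t, x ∈ Metric.ball p r := by simpa using ht hx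
    set c := ⨍ x in Metric.ball p r, f x with hc
    have hint : IntegrableOn f (Metric.ball p r) :=
      (hfc.continuousOn.integrableOn_compact (isCompact_closedBall p r)).mono_set
        Metric.ball_subset_closedBall
    have hcS : c ^ 2 ≤ S := Finset.single_le_sum (f := fun p => (⨍ x in Metric.ball p r, f x) ^ 2)
      (fun _ _ => sq_nonneg _) hpt
    have hint2 : IntegrableOn (fun w => (f w - f x) ^ 2) (Metric.ball p r) := by
      have : Continuous fun w => (f w - f x) ^ 2 := by fun_prop
      exact (this.continuousOn.integrableOn_compact (isCompact_closedBall p r)).mono_set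
        Metric.ball_subset_closedBall
    have hint0 : ∀ a : ℝ, IntegrableOn (fun _ : Euc n => a) (Metric.ball p r) := fun _ =>
      integrableOn_const measure_ball_lt_top.ne
    have hvI : ∫ w in Metric.ball p r, f w = v * c := by
      rw [hc, setAverage_eq, hvp, smul_eq_mul, mul_inv_cancel_left₀ hv0.ne']
    -- the mean square distance of `f x` to the values on the ball dominates the distance to `c`
    have hJ : v * (c - f x) ^ 2 ≤ ∫ w in Metric.ball p r, (f w - f x) ^ 2 := by
      have e : ∫ w in Metric.ball p r, ((f w - f x) ^ 2 - (2 * (c - f x)) * (f w - c)) =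
          ∫ w in Metric.ball p r, ((c - f x) ^ 2 + (f w - c) ^ 2) := by
        congr 1; ext w; ring
      have e2 : ∫ w in Metric.ball p r, (2 * (c - f x)) * (f w - c) = 0 := by
        rw [integral_const_mul, integral_sub hint (hint0 _), hvI,
          setIntegral_const, hvp]
        simp
      have i3 : IntegrableOn (fun w => (2 * (c - f x)) * (f w - c)) (Metric.ball p r) :=
        (hint.sub (hint0 c)).const_mul _
      rw [integral_sub hint2 i3, e2, sub_zero] at e
      rw [e]
      have i4 : IntegrableOn (fun w => (f w - c) ^ 2) (Metric.ball p r) := by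
        have : Continuous fun w => (f w - c) ^ 2 := by fun_prop
        exact (this.continuousOn.integrableOn_compact (isCompact_closedBall p r)).mono_set
          Metric.ball_subset_closedBall
      rw [integral_add (hint0 _) i4, setIntegral_const, hvp,
        smul_eq_mul]
      have := integral_nonneg (μ := volume.restrict (Metric.ball p r))
        (f := fun w => (f w - c) ^ 2) fun x => sq_nonneg _
      linarith
    have hsub : ∫⁻ w in Metric.ball p r, ENNReal.ofReal ((f w - f x) ^ 2) ≤
        ∫⁻ h in Metric.ball (0 : Euc n) (2 * r), ENNReal.ofReal ((f (x + h) - f x) ^ 2) := by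
      rw [← lintegral_indicator measurableSet_ball, ← lintegral_indicator measurableSet_ball,
        ← lintegral_add_left_eq_self (μ := volume) _ x]
      refine lintegral_mono fun h => ?_
      by_cases hh : x + h ∈ Metric.ball p r
      · rw [indicator_of_mem hh, indicator_of_mem]
        rw [mem_ball_zero_iff]
        rw [Metric.mem_ball, dist_eq_norm] at hh hxp
        have e : h = (x + h - p) - (x - p) := by abel
        rw [e]
        exact (norm_sub_le _ _).trans_lt (by linarith)
      · rw [indicator_of_notMem hh]; exact zero_le
    calc ENNReal.ofReal (f x ^ 2) ≤ ENNReal.ofReal (2 / v * (v * (c - f x) ^ 2) + 2 * S) := by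
          refine ENNReal.ofReal_le_ofReal ?_
          rw [← mul_assoc, div_mul_cancel₀ _ hv0.ne']
          nlinarith [sq_nonneg (2 * c - f x)]
      _ ≤ ENNReal.ofReal (2 / v * (∫ w in Metric.ball p r, (f w - f x) ^ 2) + 2 * S) := by
          gcongr
      _ ≤ _ := by
          rw [ENNReal.ofReal_add, ENNReal.ofReal_mul (by positivity),
            ofReal_integral_eq_lintegral_ofReal hint2
              (Eventually.of_forall fun x => sq_nonneg _)]
          · gcongr
          · exact mul_nonneg (by positivity) (integral_nonneg fun x => sq_nonneg _)
          · exact mul_nonneg zero_le_two ((sq_nonneg c).trans hcS)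
  have hS0 : 0 ≤ S := Finset.sum_nonneg fun _ _ => sq_nonneg _
  have hgc : Continuous fun x => ‖fderiv ℝ f x‖ ^ 2 :=
    (hf.continuous_fderiv one_ne_zero).norm.pow 2
  have hg0 := integral_nonneg (μ := volume.restrict (Metric.closedBall y (ρ + 2 * r)))
      (f := fun x => ‖fderiv ℝ f x‖ ^ 2) fun x => sq_nonneg _
  have i1 : IntegrableOn (fun x => f x ^ 2) (Metric.closedBall y ρ) :=
    (hfc.pow 2).continuousOn.integrableOn_compact (isCompact_closedBall _ _)
  have i2 : IntegrableOn (fun x => ‖fderiv ℝ f x‖ ^ 2) (Metric.closedBall y (ρ + 2 * r)) :=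
    hgc.continuousOn.integrableOn_compact (isCompact_closedBall _ _)
  have h := setLIntegral_mono' (μ := volume) measurableSet_closedBall key
  rw [lintegral_add_right _ measurable_const, lintegral_const_mul' _ _ ENNReal.ofReal_ne_top,
    lintegral_lintegral_swap] at h
  · have h2 := h.trans (add_le_add (mul_le_mul_right (setLIntegral_mono' measurableSet_ball
      fun h hh => lintegral_sq_translate_sub_le hf ρ y h (r := 2 * r)
        (mem_ball_zero_iff.1 hh).le) _)
      le_rfl)
    rw [lintegral_const, lintegral_const, Measure.restrict_apply_univ, Measure.restrict_apply_univ,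
      hv2, ← ofReal_integral_eq_lintegral_ofReal i1 (Eventually.of_forall fun x => sq_nonneg _),
      ← ofReal_integral_eq_lintegral_ofReal i2 (Eventually.of_forall fun x => sq_nonneg _),
      ← ofReal_measureReal (μ := volume) (s := Metric.closedBall y ρ) measure_closedBall_lt_top.ne,
      ← ENNReal.ofReal_mul (by positivity), ← ENNReal.ofReal_mul (by positivity),
      ← ENNReal.ofReal_mul (by positivity), ← ENNReal.ofReal_mul (by positivity),
      ← ENNReal.ofReal_add (by positivity) (by positivity)] at h2
    refine ((ENNReal.ofReal_le_ofReal_iff (by positivity)).1 h2).trans (le_of_eq ?_)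
    field_simp
    ring
  · have : Continuous fun p : Euc n × Euc n => ENNReal.ofReal ((f (p.1 + p.2) - f p.1) ^ 2) :=
      ENNReal.continuous_ofReal.comp (by fun_prop)
    exact this.measurable.aemeasurable

end Euclidean

/-! ### A Hardy inequality for a weight vanishing at the boundary of a ball -/

section HardyWeight

variable {n : ℕ}

/-- The divergence theorem for the field `h(x) (x - y)`. -/
theorem integral_fderiv_apply_sub_self {h : Euc n → ℝ} (hh : ContDiff ℝ 1 h)
    (hs : HasCompactSupport h) (y : Euc n) :
    ∫ x, fderiv ℝ h x (x - y) = -(n * ∫ x, h x) := by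
  have hdc : Continuous (fderiv ℝ h) := hh.continuous_fderiv one_ne_zero
  have hds : HasCompactSupport (fderiv ℝ h) := hs.fderiv ℝ
  have key : ∀ i : Fin n, ∫ x, (x - y) i * fderiv ℝ h x (EuclideanSpace.single i 1) =
      -∫ x, h x := by
    intro i
    have hd : ∀ x : Euc n, HasFDerivAt (fun x : Euc n => (x - y) i)
        (EuclideanSpace.proj i : Euc n →L[ℝ] ℝ) x := fun x => by
      have := (EuclideanSpace.proj i : Euc n →L[ℝ] ℝ).hasFDerivAt (x := x)
      simpa using this.sub_const (y i)
    have hc : Continuous fun x : Euc n => (x - y) i := by fun_prop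
    have e : ∀ x : Euc n, fderiv ℝ (fun x : Euc n => (x - y) i) x (EuclideanSpace.single i 1) *
        h x = h x := fun x => by
      rw [(hd x).fderiv]; simp
    rw [integral_mul_fderiv_eq_neg_fderiv_mul_of_integrable]
    · simp_rw [e]
    · simp_rw [e]
      exact hh.continuous.integrable_of_hasCompactSupport hs
    · refine (hc.mul (hdc.clm_apply continuous_const)).integrable_of_hasCompactSupport ?_
      refine HasCompactSupport.mul_left ?_
      exact hds.comp_left (g := fun L : Euc n →L[ℝ] ℝ => L (EuclideanSpace.single i 1)) (by simp)
    · exact (hc.mul hh.continuous).integrable_of_hasCompactSupport hs.mul_left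
    · exact fun x _ => (hd x).differentiableAt
    · exact fun x _ => hh.differentiable one_ne_zero x
  have hsum : ∀ x : Euc n, fderiv ℝ h x (x - y) =
      ∑ i, (x - y) i * fderiv ℝ h x (EuclideanSpace.single i 1) := by
    intro x
    conv_lhs => rw [covector_eq_sum (fderiv ℝ h x)]
    simp [mul_comm]
  simp_rw [hsum]
  rw [integral_finsetSum]
  · rw [Finset.sum_congr rfl fun i _ => key i]
    simp
  · intro i _
    have hc : Continuous fun x : Euc n => (x - y) i := by fun_prop
    refine (hc.mul (hdc.clm_apply continuous_const)).integrable_of_hasCompactSupport ?_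
    refine HasCompactSupport.mul_left ?_
    exact hds.comp_left (g := fun L : Euc n →L[ℝ] ℝ => L (EuclideanSpace.single i 1)) (by simp)

theorem expNegInvGlue_le_one (t : ℝ) : expNegInvGlue t ≤ 1 := by
  unfold expNegInvGlue
  split_ifs with h
  · exact zero_le_one
  · exact Real.exp_le_one_iff.2 (by have := inv_pos.2 (not_le.1 h); linarith)

theorem hasDerivAt_expNegInvGlue (t : ℝ) :
    HasDerivAt expNegInvGlue (t⁻¹ ^ 2 * expNegInvGlue t) t := by
  simpa using expNegInvGlue.hasDerivAt_polynomial_eval_inv_mul 1 t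

theorem hasDerivAt_sq_inv_mul_expNegInvGlue (t : ℝ) :
    HasDerivAt (fun t => t⁻¹ ^ 2 * expNegInvGlue t)
      (t⁻¹ ^ 2 * (t⁻¹ ^ 2 - 2 * t⁻¹) * expNegInvGlue t) t := by
  have h := expNegInvGlue.hasDerivAt_polynomial_eval_inv_mul (Polynomial.X ^ 2) t
  simp only [Polynomial.eval_mul, Polynomial.eval_pow, Polynomial.eval_X, Polynomial.eval_sub,
    Polynomial.derivative_X_pow, Polynomial.eval_C] at h
  convert h using 3
  norm_num

/-- The pointwise comparison behind the Hardy weight: in the boundary layer `τ < t₀` the lower order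
terms are small because `G = τ² G₁`, outside of it they are bounded by `I`. -/
theorem hardy_boundary_layer {G G₁ τ t₀ ν Z N I : ℝ} (hG0 : 0 ≤ G) (hG1 : G ≤ 1) (hZ : 0 ≤ Z)
    (hI : 0 ≤ I) (ht₀ : 0 < t₀) (ht₀8 : t₀ ≤ 1 / 8) (hνt : ν * t₀ ≤ 1 / 8) (hν : 0 ≤ ν)
    (hneg : τ ≤ 0 → G = 0) (hpos : 0 < τ → G = τ ^ 2 * G₁)
    (hbig : t₀ ≤ τ → I = Z ∧ 0 ≤ G₁ ∧ G₁ ≤ t₀⁻¹ ^ 2) (hN : N = G₁ ^ 2 * Z * (1 - 2 * τ))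
    (hN0 : 0 ≤ N) :
    ν * (G * G₁) * Z ≤ N / 4 + ν * t₀⁻¹ ^ 2 * I ∧ G ^ 2 * Z ≤ N + I := by
  have hB : 0 ≤ G₁ ^ 2 * Z := by positivity
  have hMI : 0 ≤ ν * t₀⁻¹ ^ 2 * I := by positivity
  rcases lt_or_ge τ t₀ with h0 | h0
  · rcases le_or_gt τ 0 with h1 | h1
    · rw [hneg h1]
      constructor
      · simp only [zero_mul, mul_zero]; positivity
      · simp only [ne_eq, OfNat.ofNat_ne_zero, not_false_eq_true, zero_pow, zero_mul]
        positivity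
    · have hA : G₁ ^ 2 * Z ≤ 2 * N := by
        rw [hN]
        nlinarith
      have ht2 : τ ^ 2 ≤ t₀ ^ 2 := by gcongr
      rw [hpos h1]
      constructor
      · have h2 : ν * τ ^ 2 ≤ 1 / 8 := by
          calc ν * τ ^ 2 ≤ ν * t₀ ^ 2 := by gcongr
            _ = (ν * t₀) * t₀ := by ring
            _ ≤ 1 / 8 * 1 := by gcongr; linarith
            _ = 1 / 8 := mul_one _
        have := mul_le_mul_of_nonneg_right h2 hB
        linarith
      · have h2 : (τ ^ 2) ^ 2 ≤ 1 / 2 := by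
          have : t₀ ^ 2 ≤ 1 / 2 := by nlinarith
          nlinarith [sq_nonneg τ]
        have := mul_le_mul_of_nonneg_right h2 hB
        linarith
  · obtain ⟨hIZ, hG₁0, hG₁⟩ := hbig h0
    subst hIZ
    constructor
    · have h2 : ν * (G * G₁) ≤ ν * t₀⁻¹ ^ 2 := by
        gcongr
        calc G * G₁ ≤ 1 * t₀⁻¹ ^ 2 := by gcongr
          _ = t₀⁻¹ ^ 2 := one_mul _
      have := mul_le_mul_of_nonneg_right h2 hI
      linarith
    · have : G ^ 2 ≤ 1 := pow_le_one₀ hG0 hG1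
      have := mul_le_mul_of_nonneg_right this hI
      linarith

/-- The linear combination of the boundary layer bounds in which `N`, the term with `|∇χ|²`, is
eliminated: `X` is the weighted gradient, `I` the contribution of the smaller ball, and `D` is a
divergence. -/
theorem hardy_combine {a b M I X D N Y : ℝ} (ha : 0 ≤ a) (hb : 0 ≤ b) (hM : 0 ≤ M) (hI : 0 ≤ I)
    (hX : 0 ≤ X) (hN : N / 4 ≤ 2 * b * X + M * I - D) (hY : Y ≤ N + I) :
    a * N + Y ≤ (4 * (1 + a) * (2 * b + M) + 1) * X +
      (4 * (1 + a) * (2 * b + M) + 1) * I - 4 * (1 + a) * D := by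
  have h1 : (1 + a) * N ≤ 4 * (1 + a) * (2 * b * X + M * I - D) := by nlinarith
  have h2 : 0 ≤ (1 + a) * M * X := by positivity
  have h3 : 0 ≤ (1 + a) * b * I := by positivity
  nlinarith

/-- Integration of the pointwise inequality: the last term is the divergence of `h(x) (x - y)` and
integrates to `0`. -/
theorem integral_weight_le {y : Euc n} {R₁ C c : ℝ} {χ z h : Euc n → ℝ} (hχ : ContDiff ℝ 1 χ)
    (hχs : HasCompactSupport χ) (hz : ContDiff ℝ 1 z) (hh : ContDiff ℝ 1 h)
    (hhs : HasCompactSupport h)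
    (hpt : ∀ x, (χ x ^ 2 + ‖fderiv ℝ χ x‖ ^ 2) * z x ^ 2 ≤
      C * (χ x ^ 2 * ‖fderiv ℝ z x‖ ^ 2) +
      C * (Metric.closedBall y R₁).indicator (fun x => z x ^ 2) x -
      c * (fderiv ℝ h x (x - y) + n * h x)) :
    ∫ x, (χ x ^ 2 + ‖fderiv ℝ χ x‖ ^ 2) * z x ^ 2 ≤
      C * ((∫ x, χ x ^ 2 * ‖fderiv ℝ z x‖ ^ 2) + ∫ x in Metric.closedBall y R₁, z x ^ 2) := by
  have hdiv := integral_fderiv_apply_sub_self hh hhs y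
  have hzc := hz.continuous
  have hdzc : Continuous (fderiv ℝ z) := hz.continuous_fderiv one_ne_zero
  have hdχc : Continuous (fderiv ℝ χ) := hχ.continuous_fderiv one_ne_zero
  have hχ2 : HasCompactSupport fun x => χ x ^ 2 :=
    hχs.comp_left (g := fun a : ℝ => a ^ 2) (by simp)
  have hdχ2 : HasCompactSupport fun x => ‖fderiv ℝ χ x‖ ^ 2 :=
    (hχs.fderiv ℝ).norm.comp_left (g := fun a : ℝ => a ^ 2) (by simp)
  have i1 : Integrable fun x => χ x ^ 2 * ‖fderiv ℝ z x‖ ^ 2 :=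
    ((hχ.continuous.pow 2).mul (hdzc.norm.pow 2)).integrable_of_hasCompactSupport hχ2.mul_right
  have i2 : Integrable ((Metric.closedBall y R₁).indicator fun x => z x ^ 2) :=
    ((hzc.pow 2).continuousOn.integrableOn_compact
      (isCompact_closedBall _ _)).integrable_indicator measurableSet_closedBall
  have i3 : Integrable fun x => fderiv ℝ h x (x - y) := by
    refine ((hh.continuous_fderiv one_ne_zero).clm_apply
      (by fun_prop)).integrable_of_hasCompactSupport ?_
    refine (hhs.fderiv ℝ).mono' ?_
    intro x hx
    apply subset_tsupport
    intro h0
    apply hx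
    simp only [h0]
    rfl
  have i4 : Integrable h := hh.continuous.integrable_of_hasCompactSupport hhs
  have i0 : Integrable fun x => (χ x ^ 2 + ‖fderiv ℝ χ x‖ ^ 2) * z x ^ 2 :=
    (((hχ.continuous.pow 2).add (hdχc.norm.pow 2)).mul
      (hzc.pow 2)).integrable_of_hasCompactSupport (hχ2.add hdχ2).mul_right
  have i12 : Integrable fun x => C * (χ x ^ 2 * ‖fderiv ℝ z x‖ ^ 2) +
      C * (Metric.closedBall y R₁).indicator (fun x => z x ^ 2) x :=
    (i1.const_mul C).add (i2.const_mul C)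
  have i34 : Integrable fun x => fderiv ℝ h x (x - y) + n * h x := i3.add (i4.const_mul _)
  refine (integral_mono i0 (i12.sub (i34.const_mul c)) hpt).trans (le_of_eq ?_)
  simp only [Pi.sub_apply]
  rw [integral_sub i12 (i34.const_mul c), integral_add (i1.const_mul C) (i2.const_mul C),
    integral_const_mul, integral_const_mul, integral_const_mul,
    integral_add i3 (i4.const_mul _), integral_const_mul, hdiv,
    integral_indicator measurableSet_closedBall]
  ring

set_option maxHeartbeats 1000000 in
/-- There is a smooth weight on a ball, vanishing to infinite order at the boundary, for which a
Hardy inequality holds: the term with `|∇χ|²`, which is produced by every cut-off argument, is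
controlled by the weighted gradient and by the function on a smaller ball. The weight is
`exp (-1 / t)` with `t = (R² - |x - y|²) / (2R²)`. -/
theorem exists_hardy_weight (y : Euc n) {R : ℝ} (hR : 0 < R) :
    ∃ χ : Euc n → ℝ, ContDiff ℝ ∞ χ ∧ (∀ x, 0 ≤ χ x) ∧ (∀ x, χ x ≤ 1) ∧
      (∀ x, x ∉ Metric.ball y R → χ x = 0) ∧ (∀ x ∈ Metric.ball y R, 0 < χ x) ∧
      ∃ R₁ C : ℝ, 0 < R₁ ∧ R₁ < R ∧ 0 ≤ C ∧ ∀ z : Euc n → ℝ, ContDiff ℝ 1 z →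
        ∫ x, (χ x ^ 2 + ‖fderiv ℝ χ x‖ ^ 2) * z x ^ 2 ≤
          C * ((∫ x, χ x ^ 2 * ‖fderiv ℝ z x‖ ^ 2) +
            ∫ x in Metric.closedBall y R₁, z x ^ 2) := by
  set G := expNegInvGlue with hG
  set G₁ : ℝ → ℝ := fun t => t⁻¹ ^ 2 * expNegInvGlue t with hG₁
  set t : Euc n → ℝ := fun x => (R ^ 2 - ‖x - y‖ ^ 2) / (2 * R ^ 2) with ht
  have htd : ContDiff ℝ ∞ t := by
    have : ContDiff ℝ ∞ fun x : Euc n => ‖x - y‖ ^ 2 := (contDiff_id.sub contDiff_const).norm_sq ℝ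
    exact (contDiff_const.sub this).div_const _
  have hR2 : 0 < R ^ 2 := by positivity
  have htf : ∀ x, HasFDerivAt t (-(R ^ 2)⁻¹ • innerSL ℝ (x - y)) x := by
    intro x
    have h1 := ((hasFDerivAt_id x).sub_const y).norm_sq
    have h2 := (h1.const_sub (R ^ 2)).const_mul (2 * R ^ 2)⁻¹
    have e : (fun x : Euc n => (2 * R ^ 2)⁻¹ * (R ^ 2 - ‖id x - y‖ ^ 2)) = t := by
      ext x; simp only [ht, id]; rw [div_eq_inv_mul]
    rw [e] at h2
    refine h2.congr_fderiv (ContinuousLinearMap.ext fun v => ?_)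
    simp only [_root_.smul_apply, innerSL_apply_apply, smul_eq_mul, nsmul_eq_mul,
      ContinuousLinearMap.comp_apply, ContinuousLinearMap.id_apply, _root_.neg_apply, id]
    push_cast
    field_simp
  have hGc : ContDiff ℝ ∞ G := expNegInvGlue.contDiff
  have hG₁c : ContDiff ℝ ∞ G₁ := by
    have := expNegInvGlue.contDiff_polynomial_eval_inv_mul (n := ⊤) (Polynomial.X ^ 2)
    simp only [Polynomial.eval_pow, Polynomial.eval_X] at this
    exact this
  have htpos : ∀ x, x ∈ Metric.ball y R ↔ 0 < t x := by
    intro x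
    rw [ht, mem_ball_iff_norm]
    simp only
    rw [div_pos_iff_of_pos_right (by positivity), sub_pos, sq_lt_sq₀ (norm_nonneg _) hR.le]
  have hsupp : ∀ x, x ∉ Metric.ball y R → G (t x) = 0 := fun x hx =>
    expNegInvGlue.zero_of_nonpos (not_lt.1 fun h => hx ((htpos x).2 h))
  refine ⟨fun x => G (t x), hGc.comp htd, fun x => expNegInvGlue.nonneg _,
    fun x => expNegInvGlue_le_one _, hsupp,
    fun x hx => expNegInvGlue.pos_of_pos ((htpos x).1 hx), ?_⟩
  -- `t < t₀` is the boundary layer, in which the lower order terms are absorbed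
  set t₀ : ℝ := 1 / (8 * (n + 1)) with ht₀
  have ht₀p : 0 < t₀ := by positivity
  have ht₀8 : t₀ ≤ 1 / 8 := by
    rw [ht₀]
    apply one_div_le_one_div_of_le <;> [norm_num; skip]
    have : (0 : ℝ) ≤ n := Nat.cast_nonneg n
    linarith
  have hnt₀ : n * t₀ ≤ 1 / 8 := by
    rw [ht₀, mul_one_div, div_le_div_iff₀ (by positivity) (by norm_num)]
    linarith
  set R₁ := R * Real.sqrt (1 - 2 * t₀) with hR₁
  have hR₁sq : R₁ ^ 2 = R ^ 2 * (1 - 2 * t₀) := by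
    rw [hR₁, mul_pow, Real.sq_sqrt (by linarith)]
  have hR₁p : 0 < R₁ := mul_pos hR (Real.sqrt_pos.2 (by linarith))
  have hR₁t : ∀ x, t₀ ≤ t x → x ∈ Metric.closedBall y R₁ := by
    intro x hx
    rw [mem_closedBall_iff_norm, ← sq_le_sq₀ (norm_nonneg _) hR₁p.le, hR₁sq]
    rw [ht] at hx
    simp only at hx
    rw [le_div_iff₀ (by positivity)] at hx
    linarith
  set M : ℝ := n * t₀⁻¹ ^ 2 with hM
  have hM0 : 0 ≤ M := by positivity
  set C : ℝ := 4 * (1 + (R ^ 2)⁻¹) * (2 * R ^ 2 + M) + 1 with hC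
  refine ⟨R₁, C, hR₁p, ?_, by positivity, ?_⟩
  · rw [← sq_lt_sq₀ hR₁p.le hR.le, hR₁sq]
    nlinarith
  intro z hz
  have hzd := hz.differentiable one_ne_zero
  set h : Euc n → ℝ := fun x => G (t x) * G₁ (t x) * z x ^ 2 with hh
  have htd1 : ContDiff ℝ 1 t := htd.of_le (by simp)
  have hGc1 : ContDiff ℝ 1 G := hGc.of_le (by simp)
  have hhc : ContDiff ℝ 1 h := ((hGc1.comp htd1).mul
    ((hG₁c.of_le (by simp)).comp htd1)).mul (hz.pow 2)
  have hcs : ∀ f : Euc n → ℝ, (∀ x, x ∉ Metric.ball y R → f x = 0) → HasCompactSupport f :=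
    fun f hf => HasCompactSupport.intro (isCompact_closedBall y R) fun x hx =>
      hf x fun h => hx (Metric.ball_subset_closedBall h)
  have hhs : HasCompactSupport h := hcs h fun x hx => by simp [hh, hsupp x hx]
  have hχf : ∀ x, HasFDerivAt (fun x => G (t x)) (G₁ (t x) • (-(R ^ 2)⁻¹ • innerSL ℝ (x - y))) x :=
    fun x => (hasDerivAt_expNegInvGlue (t x)).comp_hasFDerivAt x (htf x)
  set G₂ : ℝ → ℝ := fun t => t⁻¹ ^ 2 * (t⁻¹ ^ 2 - 2 * t⁻¹) * expNegInvGlue t with hG₂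
  have hG₁f : ∀ x, HasFDerivAt (fun x => G₁ (t x))
      (G₂ (t x) • (-(R ^ 2)⁻¹ • innerSL ℝ (x - y))) x :=
    fun x => (hasDerivAt_sq_inv_mul_expNegInvGlue (t x)).comp_hasFDerivAt x (htf x)
  have hhf : ∀ x, fderiv ℝ h x (x - y) =
      -((G₁ (t x) ^ 2 + G (t x) * G₂ (t x)) * (R ^ 2)⁻¹ * ‖x - y‖ ^ 2 * z x ^ 2) +
      2 * (G (t x) * G₁ (t x)) * z x * fderiv ℝ z x (x - y) := by
    intro x
    have h1 := ((hχf x).mul (hG₁f x)).mul ((hzd x).hasFDerivAt.pow 2)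
    have h2 : HasFDerivAt h _ x := h1
    rw [h2.fderiv]
    simp only [Pi.mul_apply, _root_.add_apply, _root_.smul_apply, innerSL_apply_apply,
      real_inner_self_eq_norm_sq, smul_eq_mul, nsmul_eq_mul]
    push_cast
    ring
  -- the pointwise inequality to be integrated
  have hpt : ∀ x, (G (t x) ^ 2 + ‖fderiv ℝ (fun x => G (t x)) x‖ ^ 2) * z x ^ 2 ≤
      C * (G (t x) ^ 2 * ‖fderiv ℝ z x‖ ^ 2) +
      C * (Metric.closedBall y R₁).indicator (fun x => z x ^ 2) x -
      4 * (1 + (R ^ 2)⁻¹) * (fderiv ℝ h x (x - y) + n * h x) := by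
    intro x
    set g := ‖x - y‖ with hg
    set d := ‖fderiv ℝ z x‖ with hd
    set I := (Metric.closedBall y R₁).indicator (fun x => z x ^ 2) x with hI
    have hI0 : 0 ≤ I := indicator_nonneg (fun x _ => sq_nonneg _) _
    have hGn : 0 ≤ G (t x) := expNegInvGlue.nonneg _
    have hG1 : G (t x) ≤ 1 := expNegInvGlue_le_one _
    have hG₁n : 0 ≤ G₁ (t x) := mul_nonneg (sq_nonneg _) (expNegInvGlue.nonneg _)
    have hgx : g ^ 2 = R ^ 2 * (1 - 2 * t x) := by
      rw [ht]; field_simp; ring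
    have htle : t x ≤ 1 / 2 := by
      have : 0 ≤ R ^ 2 * (1 - 2 * t x) := hgx ▸ sq_nonneg g
      have := nonneg_of_mul_nonneg_right this hR2
      linarith
    set N := G₁ (t x) ^ 2 * (R ^ 2)⁻¹ * g ^ 2 * z x ^ 2 with hN
    have hN0 : 0 ≤ N := by positivity
    have hGG₂ : 0 ≤ G (t x) * G₂ (t x) := by
      rcases le_or_gt (t x) 0 with h0 | h0
      · rw [hG, expNegInvGlue.zero_of_nonpos h0, zero_mul]
      · refine mul_nonneg hGn (mul_nonneg (mul_nonneg (sq_nonneg _) ?_) hGn)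
        have h2 : 2 ≤ (t x)⁻¹ := by
          rw [le_inv_comm₀ two_pos h0]; linarith
        nlinarith
    have hχ : ‖fderiv ℝ (fun x => G (t x)) x‖ ^ 2 * z x ^ 2 = (R ^ 2)⁻¹ * N := by
      rw [(hχf x).fderiv, norm_smul, norm_smul, innerSL_apply_norm, norm_neg, norm_inv,
        Real.norm_eq_abs, Real.norm_eq_abs, abs_of_nonneg hG₁n, abs_of_pos hR2, hN]
      ring
    have hcross : |2 * (G (t x) * G₁ (t x)) * z x * fderiv ℝ z x (x - y)| ≤
        N / 2 + 2 * R ^ 2 * (G (t x) ^ 2 * d ^ 2) := by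
      have h1 : |fderiv ℝ z x (x - y)| ≤ d * g := (fderiv ℝ z x).le_opNorm (x - y)
      rw [abs_mul]
      have h2 : |2 * (G (t x) * G₁ (t x)) * z x| = 2 * (G (t x) * G₁ (t x)) * |z x| := by
        rw [abs_mul, abs_of_nonneg (by positivity)]
      rw [h2]
      calc 2 * (G (t x) * G₁ (t x)) * |z x| * |fderiv ℝ z x (x - y)|
          ≤ 2 * (G (t x) * G₁ (t x)) * |z x| * (d * g) := by gcongr
        _ = 2 * (R⁻¹ * G₁ (t x) * g * |z x|) * (R * G (t x) * d) := by field_simp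
        _ ≤ (R⁻¹ * G₁ (t x) * g * |z x|) ^ 2 / 2 + 2 * (R * G (t x) * d) ^ 2 := by
            nlinarith [sq_nonneg ((R⁻¹ * G₁ (t x) * g * |z x|) - 2 * (R * G (t x) * d))]
        _ = _ := by rw [hN, mul_pow, mul_pow, mul_pow, sq_abs, inv_pow]; ring
    have hboundary : n * (G (t x) * G₁ (t x)) * z x ^ 2 ≤ N / 4 + M * I ∧
        G (t x) ^ 2 * z x ^ 2 ≤ N + I := by
      refine hardy_boundary_layer (τ := t x) (Z := z x ^ 2) hGn hG1 (sq_nonneg _) hI0 ht₀p ht₀8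
        hnt₀ (Nat.cast_nonneg n) (fun h => expNegInvGlue.zero_of_nonpos h) (fun h => ?_)
        (fun h => ⟨indicator_of_mem (hR₁t x h) _, hG₁n, ?_⟩) ?_ hN0
      · simp only [hG₁, hG]
        field_simp
      · have h1 : (t x)⁻¹ ≤ t₀⁻¹ := inv_anti₀ ht₀p h
        have h1' : 0 ≤ (t x)⁻¹ := inv_nonneg.2 (ht₀p.le.trans h)
        calc G₁ (t x) ≤ t₀⁻¹ ^ 2 * 1 := by
              exact mul_le_mul (pow_le_pow_left₀ h1' h1 2) hG1 hGn (by positivity)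
          _ = t₀⁻¹ ^ 2 := mul_one _
      · rw [hN, hgx]
        field_simp
    have hlow : N ≤ (G₁ (t x) ^ 2 + G (t x) * G₂ (t x)) * (R ^ 2)⁻¹ * g ^ 2 * z x ^ 2 := by
      rw [hN]
      gcongr
      linarith
    rw [hhf x]
    have hq : N / 4 ≤ 2 * R ^ 2 * (G (t x) ^ 2 * d ^ 2) + M * I -
        (-((G₁ (t x) ^ 2 + G (t x) * G₂ (t x)) * (R ^ 2)⁻¹ * g ^ 2 * z x ^ 2) +
          2 * (G (t x) * G₁ (t x)) * z x * fderiv ℝ z x (x - y) + n * h x) := by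
      have h1 := (abs_le.1 hcross).2
      have h2 := hboundary.1
      have e : n * h x = n * (G (t x) * G₁ (t x)) * z x ^ 2 := by rw [hh]; ring
      rw [e]
      linarith
    set D := -((G₁ (t x) ^ 2 + G (t x) * G₂ (t x)) * (R ^ 2)⁻¹ * g ^ 2 * z x ^ 2) +
          2 * (G (t x) * G₁ (t x)) * z x * fderiv ℝ z x (x - y) + n * h x with hD
    rw [add_mul, hχ, add_comm]
    exact hardy_combine (by positivity) hR2.le hM0 hI0 (by positivity) hq hboundary.2
  exact integral_weight_le (hGc1.comp htd1) (hcs _ hsupp) hz hhc hhs hpt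

end HardyWeight

/-! ### From small powers to the local `L²` bound -/

section SmallPower

variable {n : ℕ}

/-- Iterating a bound that gains a factor `1/2` at each step. -/
theorem le_two_mul_of_forall_exists_le_half {ι : Type*} {H : ι → ℝ} {B D : ℝ}
    (hB : ∀ i, H i ≤ B) (hD : 0 ≤ D) (h : ∀ i, ∃ j, H i ≤ H j / 2 + D) (i : ι) : H i ≤ 2 * D := by
  have key : ∀ (k : ℕ) (i : ι), H i ≤ 2 * D + |B| * (1 / 2) ^ k := by
    intro k
    induction k with
    | zero =>
      intro i
      have := (hB i).trans (le_abs_self B)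
      simp only [pow_zero, mul_one]
      linarith
    | succ k ih =>
      intro i
      obtain ⟨j, hj⟩ := h i
      have := ih j
      rw [pow_succ]
      linarith
  have ht : Tendsto (fun k : ℕ => 2 * D + |B| * (1 / 2 : ℝ) ^ k) atTop (𝓝 (2 * D + |B| * 0)) :=
    ((tendsto_pow_atTop_nhds_zero_of_lt_one (by norm_num) (by norm_num)).const_mul _).const_add _
  rw [mul_zero, add_zero] at ht
  exact ge_of_tendsto' ht fun k => key k i

/-- If small powers of `f` are integrable on a ball and `f` satisfies Caccioppoli inequalities,
then `f` is bounded in `L²` of a smaller ball. -/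
theorem exists_setIntegral_sq_le_of_rpow (y : Euc n) {R A M : ℝ} (hR : 0 < R) (hA : 0 ≤ A)
    (hM : 0 < M) {k : ℕ} (hk : k ≠ 0) :
    ∃ C : ℝ, ∀ f : Euc n → ℝ, ContDiff ℝ 1 f →
      ∫ x in Metric.closedBall y R, (1 + f x ^ 2) ^ (1 / k : ℝ) ≤ M →
      (∀ a b : ℝ, 0 < a → a < b → b ≤ R →
        ∫ x in Metric.closedBall y a, ‖fderiv ℝ f x‖ ^ 2 ≤
          A * (1 + ((b - a) ^ 2)⁻¹ * ∫ x in Metric.closedBall y b, f x ^ 2)) →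
      ∫ x in Metric.closedBall y (R / 2), f x ^ 2 ≤ C := by
  set w₁ := volume.real (Metric.ball (0 : Euc n) 1) with hw₁
  have hw₁0 : 0 < w₁ := ENNReal.toReal_pos (Metric.measure_ball_pos _ _ one_pos).ne'
    measure_ball_lt_top.ne
  set v := volume.real (Metric.closedBall y R) with hv
  have hv0 : 0 ≤ v := measureReal_nonneg
  set m := n * k with hm
  -- the Poincaré inequality is used at the scale `η σ`, where `σ` is half the distance to the
  -- boundary; `η` is so small that the Caccioppoli term is absorbed with a factor `1/2`
  set Q := 2 ^ m * 16 * A with hQ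
  have hQ0 : 0 ≤ Q := by positivity
  set η : ℝ := 1 / (2 * (1 + Q)) with hη
  have hη0 : 0 < η := by positivity
  have hη2 : η ≤ 1 / 2 := by
    rw [hη]
    apply one_div_le_one_div_of_le two_pos
    linarith
  have hηQ : Q * η ^ 2 ≤ 1 / 2 := by
    have h1 : Q * η ≤ 1 := by
      rw [hη, mul_one_div, div_le_one (by positivity)]
      linarith
    calc Q * η ^ 2 = (Q * η) * η := by ring
      _ ≤ 1 * (1 / 2) := by gcongr
      _ = 1 / 2 := one_mul _
  set D : ℝ := 2 ^ m * (4 * η ^ 2 * A * R ^ (m + 2) +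
    4 * v * ((2 * M / w₁) ^ k * (η ^ m)⁻¹)) with hD
  have hD0 : 0 ≤ D := by positivity
  refine ⟨2 * D / (R / 2) ^ m, fun f hf hfM hcac => ?_⟩
  have hfc : Continuous fun x => f x ^ 2 := hf.continuous.pow 2
  have i1 : ∀ ρ, IntegrableOn (fun x => f x ^ 2) (Metric.closedBall y ρ) := fun ρ =>
    hfc.continuousOn.integrableOn_compact (isCompact_closedBall _ _)
  set F : ℝ → ℝ := fun ρ => ∫ x in Metric.closedBall y ρ, f x ^ 2 with hF
  have hFmono : ∀ a b, a ≤ b → F a ≤ F b := fun a b hab =>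
    setIntegral_mono_set (i1 b) (Eventually.of_forall fun x => sq_nonneg _)
      (Metric.closedBall_subset_closedBall hab).eventuallyLE
  have hF0 : ∀ a, 0 ≤ F a := fun a => integral_nonneg fun x => sq_nonneg _
  have step : ∀ ρ, 0 < ρ → ρ < R → ∀ σ, σ = (R - ρ) / 2 →
      F ρ ≤ 4 * η ^ 2 * σ ^ 2 * A + 16 * A * η ^ 2 * F (ρ + σ) +
        4 * v * ((2 * M / w₁) ^ k * (η ^ m * σ ^ m)⁻¹) := by
    intro ρ hρ hρR σ hσ
    have hσ0 : 0 < σ := by rw [hσ]; linarith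
    set r := η * σ with hr
    have hr0 : 0 < r := by positivity
    have hrσ : r ≤ σ / 2 := by rw [hr]; nlinarith
    set L := 2 * M / (w₁ * r ^ n) with hL
    have hL0 : 0 < L := by positivity
    set G : Set (Euc n) := {x | f x ^ 2 ≤ L ^ k} with hG
    have hGm : MeasurableSet G := measurableSet_le hfc.measurable measurable_const
    have hsub : Metric.closedBall y (ρ + r) ⊆ Metric.closedBall y R :=
      Metric.closedBall_subset_closedBall (by linarith)
    have hgc : Continuous fun x => (1 + f x ^ 2) ^ (1 / k : ℝ) :=
      (continuous_const.add hfc).rpow_const fun x => Or.inr (by positivity)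
    -- Chebyshev's inequality for the power `1 / k` of `1 + f²`
    have hvol : volume (Metric.closedBall y (ρ + r) \ G) ≤
        volume (Metric.ball (0 : Euc n) r) / 2 := by
      set S := Metric.closedBall y (ρ + r) \ G with hS
      have hSm : MeasurableSet S := measurableSet_closedBall.diff hGm
      have hSfin : volume S ≠ ⊤ :=
        measure_ne_top_of_subset (sdiff_subset.trans hsub) measure_closedBall_lt_top.ne
      have hgi : IntegrableOn (fun x => (1 + f x ^ 2) ^ (1 / k : ℝ)) (Metric.closedBall y R) :=
        hgc.continuousOn.integrableOn_compact (isCompact_closedBall _ _)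
      have h1 : volume.real S * L ≤ M := by
        calc volume.real S * L = ∫ x in S, L := by rw [setIntegral_const, smul_eq_mul]
          _ ≤ ∫ x in S, (1 + f x ^ 2) ^ (1 / k : ℝ) := by
              refine setIntegral_mono_on (integrableOn_const hSfin)
                (hgi.mono_set (sdiff_subset.trans hsub)) hSm fun x hx => ?_
              have hx2 : L ^ k < f x ^ 2 := not_le.1 hx.2
              calc L = (L ^ k) ^ (1 / k : ℝ) := by
                    rw [one_div, Real.pow_rpow_inv_natCast hL0.le hk]
                _ ≤ _ := by
                    gcongr
                    linarith
          _ ≤ ∫ x in Metric.closedBall y R, (1 + f x ^ 2) ^ (1 / k : ℝ) :=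
              setIntegral_mono_set hgi (Eventually.of_forall fun x => by positivity)
                (sdiff_subset.trans hsub).eventuallyLE
          _ ≤ M := hfM
      have h2 : volume (Metric.ball (0 : Euc n) r) = ENNReal.ofReal (r ^ n * w₁) := by
        rw [Measure.addHaar_ball_of_pos _ _ hr0, finrank_euclideanSpace_fin,
          ENNReal.ofReal_mul (by positivity), hw₁, ofReal_measureReal]
      have h3 : ENNReal.ofReal (r ^ n * w₁) / 2 = ENNReal.ofReal (r ^ n * w₁ / 2) := by
        rw [ENNReal.ofReal_div_of_pos two_pos, ENNReal.ofReal_ofNat]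
      rw [h2, ← ofReal_measureReal hSfin, h3]
      refine ENNReal.ofReal_le_ofReal ?_
      rw [hL, mul_div_assoc', div_le_iff₀ (by positivity)] at h1
      have h3 : M * (2 * volume.real S) ≤ M * (w₁ * r ^ n) := by linarith
      have := le_of_mul_le_mul_left h3 hM
      linarith
    have hgp := setIntegral_sq_le_of_volume_diff_le hf hr0 ρ y hGm hvol
    have hG2 : ∫ x in Metric.closedBall y (ρ + r) ∩ G, f x ^ 2 ≤ v * L ^ k := by
      calc ∫ x in Metric.closedBall y (ρ + r) ∩ G, f x ^ 2
          ≤ ∫ x in Metric.closedBall y (ρ + r) ∩ G, L ^ k :=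
            setIntegral_mono_on ((i1 _).mono_set inter_subset_left)
              (integrableOn_const (measure_ne_top_of_subset inter_subset_left
                measure_closedBall_lt_top.ne)) (measurableSet_closedBall.inter hGm) fun x hx => hx.2
        _ = volume.real (Metric.closedBall y (ρ + r) ∩ G) * L ^ k := by
            rw [setIntegral_const, smul_eq_mul]
        _ ≤ v * L ^ k := by
            gcongr
            exact measureReal_mono (inter_subset_left.trans hsub) measure_closedBall_lt_top.ne
    have hLk : L ^ k = (2 * M / w₁) ^ k * (η ^ m * σ ^ m)⁻¹ := by
      rw [hL, hr, hm, pow_mul, pow_mul, ← mul_pow, ← inv_pow, ← mul_pow, ← mul_pow]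
      congr 1
      field_simp
    have hc := hcac (ρ + r) (ρ + σ) (by positivity) (by linarith) (by linarith)
    have hinv : ((ρ + σ - (ρ + r)) ^ 2)⁻¹ ≤ 4 * (σ ^ 2)⁻¹ := by
      have : (σ / 2) ^ 2 ≤ (ρ + σ - (ρ + r)) ^ 2 := by
        apply pow_le_pow_left₀ (by positivity)
        linarith
      calc _ ≤ ((σ / 2) ^ 2)⁻¹ := inv_anti₀ (by positivity) this
        _ = _ := by field_simp; norm_num
    have hc2 : ∫ x in Metric.closedBall y (ρ + r), ‖fderiv ℝ f x‖ ^ 2 ≤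
        A * (1 + 4 * (σ ^ 2)⁻¹ * F (ρ + σ)) := by
      refine hc.trans ?_
      have := hF0 (ρ + σ)
      gcongr
    calc F ρ ≤ 4 * (r ^ 2 * (A * (1 + 4 * (σ ^ 2)⁻¹ * F (ρ + σ)))) + 4 * (v * L ^ k) := by
          refine hgp.trans ?_
          gcongr
      _ = _ := by
          rw [hLk, hr]
          field_simp
          ring
  -- the factor `(R - ρ)^m` compensates the blow-up of the last term of `step` as `ρ → R`
  set H : Ioo (0 : ℝ) R → ℝ := fun ρ => (R - ρ) ^ m * F ρ with hH
  have hHB : ∀ ρ : Ioo (0 : ℝ) R, H ρ ≤ R ^ m * F R := by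
    intro ρ
    have h1 := ρ.2.1
    have h2 := ρ.2.2
    have := hF0 R
    have h3 : (0 : ℝ) ≤ R - ρ := by linarith
    exact mul_le_mul (pow_le_pow_left₀ h3 (by linarith) m) (hFmono _ _ h2.le) (hF0 _)
      (by positivity)
  have hHs : ∀ ρ : Ioo (0 : ℝ) R, ∃ ρ' : Ioo (0 : ℝ) R, H ρ ≤ H ρ' / 2 + D := by
    intro ρ
    have h1 := ρ.2.1
    have h2 := ρ.2.2
    set σ : ℝ := (R - ρ) / 2 with hσ
    have hσ0 : 0 < σ := by rw [hσ]; linarith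
    have hσR : σ ≤ R := by rw [hσ]; linarith
    refine ⟨⟨ρ + σ, by linarith, by rw [hσ]; linarith⟩, ?_⟩
    have h3 := step ρ h1 h2 σ hσ
    have e1 : R - ρ = 2 * σ := by rw [hσ]; ring
    have e2 : R - (ρ + σ) = σ := by rw [hσ]; ring
    simp only [hH, e1, e2]
    have hFn := hF0 (ρ + σ)
    calc (2 * σ) ^ m * F ρ ≤ (2 * σ) ^ m * (4 * η ^ 2 * σ ^ 2 * A +
          16 * A * η ^ 2 * F (ρ + σ) + 4 * v * ((2 * M / w₁) ^ k * (η ^ m * σ ^ m)⁻¹)) := by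
          gcongr
      _ = 2 ^ m * (4 * η ^ 2 * A * σ ^ (m + 2) + 4 * v * ((2 * M / w₁) ^ k * (η ^ m)⁻¹)) +
          (Q * η ^ 2) * (σ ^ m * F (ρ + σ)) := by
          rw [hQ, mul_pow]
          field_simp
          ring
      _ ≤ D + 1 / 2 * (σ ^ m * F (ρ + σ)) := by
          rw [hD]
          gcongr
      _ = _ := by ring
  have hfin := le_two_mul_of_forall_exists_le_half hHB hD0 hHs ⟨R / 2, by constructor <;> linarith⟩
  rw [le_div_iff₀ (by positivity), mul_comm]
  have e : R - R / 2 = R / 2 := by ring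
  simpa only [hH, e] using hfin

theorem contDiff_one_add_sq_rpow {f : Euc n → ℝ} (hf : ContDiff ℝ 1 f) (s : ℝ) :
    ContDiff ℝ 1 fun x => (1 + f x ^ 2) ^ s := by
  refine (contDiff_const.add (hf.pow 2)).rpow_const_of_ne fun x => ?_
  positivity

theorem norm_fderiv_one_add_sq_rpow_sq_le {f : Euc n → ℝ} (hf : ContDiff ℝ 1 f) {s : ℝ}
    (x : Euc n) :
    ‖fderiv ℝ (fun x => (1 + f x ^ 2) ^ (s / 2)) x‖ ^ 2 ≤
      s ^ 2 * ((1 + f x ^ 2) ^ (s - 1) * ‖fderiv ℝ f x‖ ^ 2) := by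
  have hY : 0 < 1 + f x ^ 2 := by positivity
  have h1 : HasFDerivAt (fun x => 1 + f x ^ 2) ((2 * f x) • fderiv ℝ f x) x := by
    have := ((hf.differentiable one_ne_zero x).hasFDerivAt.pow 2).const_add 1
    refine this.congr_fderiv ?_
    ext v
    simp
  have h2 := h1.rpow_const (p := s / 2) (Or.inl hY.ne')
  rw [h2.fderiv, smul_smul, norm_smul, mul_pow, Real.norm_eq_abs, sq_abs]
  have e : (s / 2 * (1 + f x ^ 2) ^ (s / 2 - 1) * (2 * f x)) ^ 2 =
      s ^ 2 * ((1 + f x ^ 2) ^ (s - 2) * f x ^ 2) := by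
    have : ((1 + f x ^ 2) ^ (s / 2 - 1)) ^ 2 = (1 + f x ^ 2) ^ (s - 2) := by
      rw [← Real.rpow_natCast, ← Real.rpow_mul hY.le]
      congr 1
      push_cast
      ring
    rw [← this]
    ring
  rw [e, mul_assoc]
  gcongr
  have e2 : (1 + f x ^ 2) ^ (s - 1) = (1 + f x ^ 2) ^ (s - 2) * (1 + f x ^ 2) := by
    rw [← Real.rpow_add_one hY.ne']
    congr 1
    ring
  rw [e2]
  gcongr
  linarith

/-- The local `L²` bound: a function that is at most `1` on most of a ball, whose small powers
satisfy a weighted Caccioppoli inequality with a constant uniform in the power, and which satisfies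
Caccioppoli inequalities itself, is bounded in `L²` of a smaller ball. For a small power `s` the
gradient of `z = (1 + f²)^(s/2)` carries a factor `s²`, so that the Hardy inequality of the weight
lets one absorb the boundary term on a single ball. -/
theorem exists_setIntegral_sq_le (y : Euc n) {R : ℝ} (hR : 0 < R) :
    ∃ χ : Euc n → ℝ, ContDiff ℝ ∞ χ ∧ (∀ x, 0 ≤ χ x) ∧ (∀ x, χ x ≤ 1) ∧
      (∀ x, x ∉ Metric.ball y R → χ x = 0) ∧
      ∃ R' : ℝ, 0 < R' ∧ R' < R ∧ ∀ A : ℝ, 0 ≤ A → ∃ (ε : ℝ≥0∞) (C : ℝ), 0 < ε ∧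
      ∀ f : Euc n → ℝ, ContDiff ℝ 1 f →
      volume (Metric.closedBall y R ∩ {x | 1 < |f x|}) ≤ ε →
      (∀ s : ℝ, 0 < s → s ≤ 1 / 4 →
        ∫ x, χ x ^ 2 * ((1 + f x ^ 2) ^ (s - 1) * ‖fderiv ℝ f x‖ ^ 2) ≤
          A * (1 + ∫ x, (χ x ^ 2 + ‖fderiv ℝ χ x‖ ^ 2) * (1 + f x ^ 2) ^ s)) →
      (∀ a b : ℝ, 0 < a → a < b → b < R →
        ∫ x in Metric.closedBall y a, ‖fderiv ℝ f x‖ ^ 2 ≤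
          A * (1 + ((b - a) ^ 2)⁻¹ * ∫ x in Metric.closedBall y b, f x ^ 2)) →
      ∫ x in Metric.closedBall y R', f x ^ 2 ≤ C := by
  obtain ⟨χ, hχ, hχ0, hχ1, hχs, hχp, R₁, CH, hR₁, hR₁R, hCH, hH⟩ := exists_hardy_weight y hR
  refine ⟨χ, hχ, hχ0, hχ1, hχs, R₁ / 2, by positivity, by linarith, fun A hA => ?_⟩
  set r := (R - R₁) / 2 with hr
  have hr0 : 0 < r := by rw [hr]; linarith
  have hRr : R₁ + r < R := by rw [hr]; linarith
  obtain ⟨c₀, hc₀, hχc⟩ : ∃ c₀ > 0, ∀ x ∈ Metric.closedBall y (R₁ + r), c₀ ≤ χ x := by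
    obtain ⟨x₀, hx₀, hmin⟩ := (isCompact_closedBall y (R₁ + r)).exists_isMinOn
      ⟨y, Metric.mem_closedBall_self (by positivity)⟩ hχ.continuous.continuousOn
    exact ⟨χ x₀, hχp x₀ (Metric.closedBall_subset_ball hRr hx₀), fun x hx => hmin hx⟩
  set v := volume.real (Metric.closedBall y R) with hv
  have hv0 : 0 ≤ v := measureReal_nonneg
  set K₁ := 4 * (r ^ 2 * (c₀ ^ 2)⁻¹) with hK₁
  have hK₁0 : 0 ≤ K₁ := by positivity
  set Q := CH * (1 + K₁) * A with hQ
  have hQ0 : 0 ≤ Q := by positivity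
  -- `Q s²` will be the coefficient of the term to be absorbed; `s = 1 / k` is taken so small that
  -- it is at most `1/2`
  obtain ⟨k, hk⟩ := exists_nat_ge (4 + Q)
  have hk4 : (4 : ℝ) ≤ k := by linarith
  have hk0 : k ≠ 0 := by rintro rfl; norm_num at hk4
  set s : ℝ := 1 / k with hs
  have hs0 : 0 < s := by positivity
  have hs4 : s ≤ 1 / 4 := one_div_le_one_div_of_le (by norm_num) hk4
  have hsQ : Q * s ^ 2 ≤ 1 / 2 := by
    have h1 : Q * s ≤ 1 := by
      rw [hs, mul_one_div, div_le_one (by positivity)]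
      linarith
    calc Q * s ^ 2 = (Q * s) * s := by ring
      _ ≤ 1 * (1 / 2) := by gcongr; linarith
      _ = 1 / 2 := one_mul _
  set Z₀ := 1 + 16 * CH * v with hZ₀
  set M := K₁ * (s ^ 2 * (A * (1 + Z₀))) + 8 * v + 1 with hM
  have hM0 : 0 < M := by positivity
  obtain ⟨C, hC⟩ := exists_setIntegral_sq_le_of_rpow y hR₁ hA hM0 hk0
  refine ⟨volume (Metric.ball (0 : Euc n) r) / 2, C,
    ENNReal.half_pos (Metric.measure_ball_pos _ _ hr0).ne', fun f hf h1 h2 h3 => ?_⟩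
  refine hC f hf ?_ fun a b ha hab hb => h3 a b ha hab (by linarith)
  set z : Euc n → ℝ := fun x => (1 + f x ^ 2) ^ (s / 2) with hz
  have hzc : ContDiff ℝ 1 z := contDiff_one_add_sq_rpow hf _
  have hzsq : ∀ x, z x ^ 2 = (1 + f x ^ 2) ^ s := fun x => by
    rw [hz, ← Real.rpow_natCast, ← Real.rpow_mul (by positivity)]
    congr 1
    push_cast
    ring
  have hχcs : HasCompactSupport χ := HasCompactSupport.intro (isCompact_closedBall y R)
    fun x hx => hχs x fun h => hx (Metric.ball_subset_closedBall h)
  have hχ2 : HasCompactSupport fun x => χ x ^ 2 :=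
    hχcs.comp_left (g := fun a : ℝ => a ^ 2) (by simp)
  have hdz : Continuous fun x => ‖fderiv ℝ z x‖ ^ 2 :=
    (hzc.continuous_fderiv one_ne_zero).norm.pow 2
  have hdf : Continuous fun x => ‖fderiv ℝ f x‖ ^ 2 :=
    (hf.continuous_fderiv one_ne_zero).norm.pow 2
  have hIi : Integrable fun x => χ x ^ 2 * ‖fderiv ℝ z x‖ ^ 2 :=
    ((hχ.continuous.pow 2).mul hdz).integrable_of_hasCompactSupport hχ2.mul_right
  set I := ∫ x, χ x ^ 2 * ‖fderiv ℝ z x‖ ^ 2 with hI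
  set Z := ∫ x, (χ x ^ 2 + ‖fderiv ℝ χ x‖ ^ 2) * z x ^ 2 with hZ
  set J := ∫ x in Metric.closedBall y R₁, z x ^ 2 with hJ
  have hI0 : 0 ≤ I := integral_nonneg fun x => by positivity
  -- `Z` is bounded by `I` and `J` (Hardy), `J` by `I` (Poincaré, on the set where `|f| ≤ 1`), and
  -- `I` by `s² Z`, which closes the loop
  have hII : I ≤ s ^ 2 * (A * (1 + Z)) := by
    have e : ∫ x, (χ x ^ 2 + ‖fderiv ℝ χ x‖ ^ 2) * (1 + f x ^ 2) ^ s = Z := by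
      simp only [hZ, hzsq]
    have h4 := h2 s hs0 hs4
    rw [e] at h4
    refine le_trans ?_ (mul_le_mul_of_nonneg_left h4 (sq_nonneg s))
    rw [← integral_const_mul]
    refine integral_mono hIi (Integrable.const_mul ?_ _) fun x => ?_
    · exact ((hχ.continuous.pow 2).mul ((contDiff_one_add_sq_rpow hf _).continuous.mul
        hdf)).integrable_of_hasCompactSupport hχ2.mul_right
    · have := mul_le_mul_of_nonneg_left (norm_fderiv_one_add_sq_rpow_sq_le hf (s := s) x)
        (sq_nonneg (χ x))
      simp only
      linarith
  have hJJ : J ≤ K₁ * I + 8 * v := by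
    set G : Set (Euc n) := {x | |f x| ≤ 1} with hG
    have hGm : MeasurableSet G := measurableSet_le hf.continuous.abs.measurable measurable_const
    have hvol : volume (Metric.closedBall y (R₁ + r) \ G) ≤
        volume (Metric.ball (0 : Euc n) r) / 2 := by
      refine (measure_mono (show _ ⊆ Metric.closedBall y R ∩ {x | 1 < |f x|} from
        fun x hx => ⟨?_, ?_⟩)).trans h1
      · exact Metric.closedBall_subset_closedBall hRr.le hx.1
      · exact not_le.1 (show ¬ |f x| ≤ 1 from hx.2)
    refine (setIntegral_sq_le_of_volume_diff_le hzc hr0 R₁ y hGm hvol).trans ?_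
    have h5 : ∫ x in Metric.closedBall y (R₁ + r), ‖fderiv ℝ z x‖ ^ 2 ≤ (c₀ ^ 2)⁻¹ * I := by
      rw [hI, ← integral_const_mul]
      refine le_trans (setIntegral_mono_on (hdz.continuousOn.integrableOn_compact
        (isCompact_closedBall _ _)) (hIi.const_mul _).integrableOn measurableSet_closedBall
        fun x hx => ?_) (setIntegral_le_integral (hIi.const_mul _)
          (Eventually.of_forall fun x => by positivity))
      have h6 : c₀ ^ 2 ≤ χ x ^ 2 := pow_le_pow_left₀ hc₀.le (hχc x hx) 2
      rw [← mul_assoc]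
      refine le_mul_of_one_le_left (by positivity) ?_
      rw [inv_mul_eq_div]
      exact (one_le_div (by positivity)).2 h6
    have h7 : ∫ x in Metric.closedBall y (R₁ + r) ∩ G, z x ^ 2 ≤ 2 * v := by
      have hfin : volume (Metric.closedBall y (R₁ + r) ∩ G) ≠ ⊤ :=
        measure_ne_top_of_subset inter_subset_left measure_closedBall_lt_top.ne
      calc ∫ x in Metric.closedBall y (R₁ + r) ∩ G, z x ^ 2
          ≤ ∫ x in Metric.closedBall y (R₁ + r) ∩ G, (2 : ℝ) := by
            refine setIntegral_mono_on (((hzc.continuous.pow 2).continuousOn.integrableOn_compact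
              (isCompact_closedBall y (R₁ + r))).mono_set inter_subset_left)
              (integrableOn_const hfin) (measurableSet_closedBall.inter hGm) fun x hx => ?_
            rw [hzsq]
            have h8 : f x ^ 2 ≤ 1 := by
              rw [← sq_abs]
              exact pow_le_one₀ (abs_nonneg _) hx.2
            calc (1 + f x ^ 2) ^ s ≤ (2 : ℝ) ^ s := by gcongr; linarith
              _ ≤ 2 ^ (1 : ℝ) := by
                  apply Real.rpow_le_rpow_of_exponent_le one_le_two
                  linarith
              _ = 2 := Real.rpow_one 2
        _ = volume.real (Metric.closedBall y (R₁ + r) ∩ G) * 2 := by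
            rw [setIntegral_const, smul_eq_mul]
        _ ≤ v * 2 := by
            gcongr
            exact measureReal_mono (inter_subset_left.trans
              (Metric.closedBall_subset_closedBall hRr.le)) measure_closedBall_lt_top.ne
        _ = 2 * v := mul_comm _ _
    have h9 : r ^ 2 * ∫ x in Metric.closedBall y (R₁ + r), ‖fderiv ℝ z x‖ ^ 2 ≤
        r ^ 2 * ((c₀ ^ 2)⁻¹ * I) := by gcongr
    rw [hK₁]
    linarith
  have hZZ : Z ≤ Z₀ := by
    have h4 : Z ≤ CH * (I + J) := hH z hzc
    have h5 : CH * (I + J) ≤ CH * ((1 + K₁) * I + 8 * v) :=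
      mul_le_mul_of_nonneg_left (by linarith) hCH
    have h6 : CH * (1 + K₁) * I ≤ CH * (1 + K₁) * (s ^ 2 * (A * (1 + Z))) := by gcongr
    have h7 : CH * (1 + K₁) * (s ^ 2 * (A * (1 + Z))) = Q * s ^ 2 * (1 + Z) := by
      rw [hQ]; ring
    have hZ0 : 0 ≤ Z := integral_nonneg fun x => by positivity
    have h8 : Q * s ^ 2 * (1 + Z) ≤ 1 / 2 * (1 + Z) := by gcongr
    rw [hZ₀]
    linarith
  have e : ∫ x in Metric.closedBall y R₁, (1 + f x ^ 2) ^ s = J := by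
    simp only [hJ, hzsq]
  rw [e]
  have h4 : K₁ * I ≤ K₁ * (s ^ 2 * (A * (1 + Z₀))) := by
    refine mul_le_mul_of_nonneg_left (hII.trans ?_) hK₁0
    gcongr
  rw [hM]
  linarith

end SmallPower

/-! ### Energy densities -/

section Energy

variable {n : ℕ} {M : Type*} [TopologicalSpace M] [ChartedSpace (Euc n) M]
  [MeasurableSpace M] {ν : Measure M}

theorem TestFn.mul {u v : M → ℝ} (hu : u ∈ TestFn n M) (hv : v ∈ TestFn n M) :
    u * v ∈ TestFn n M := ⟨hu.1.mul hv.1, hu.2.mul_right⟩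

theorem diffAt_mul {u v : M → ℝ} (hu : u ∈ TestFn n M) (hv : v ∈ TestFn n M) (x : M) :
    diffAt n (u * v) x = u x • diffAt n v x + v x • diffAt n u x :=
  ((TestFn.mdiff hu x).hasMFDerivAt.mul (TestFn.mdiff hv x).hasMFDerivAt).mfderiv

theorem TestFn.comp {g : ℝ → ℝ} (hg : ContDiff ℝ ∞ g) (h0 : g 0 = 0) {u : M → ℝ}
    (hu : u ∈ TestFn n M) : (fun x => g (u x)) ∈ TestFn n M :=
  ⟨hg.comp_contMDiff hu.1, hu.2.comp_left h0⟩

theorem diffAt_comp {g : ℝ → ℝ} {g' : ℝ} {u : M → ℝ} (hu : u ∈ TestFn n M) (x : M)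
    (hg : HasDerivAt g g' (u x)) :
    diffAt n (fun x => g (u x)) x = g' • diffAt n u x := by
  have := HasMFDerivAt.comp x hg.hasFDerivAt.hasMFDerivAt (TestFn.mdiff hu x).hasMFDerivAt
  unfold diffAt
  refine this.mfderiv.trans ?_
  ext v
  exact @mul_comm ℝ _ _ _

/-- `√(u² + v² + ε²) - ε`, a smooth approximation of `√(u² + v²)` with compact support. -/
def smoothHypot (ε : ℝ) (u v : M → ℝ) (x : M) : ℝ := Real.sqrt (u x ^ 2 + v x ^ 2 + ε ^ 2) - ε

theorem TestFn.smoothHypot {ε : ℝ} (hε : 0 < ε) {u v : M → ℝ} (hu : u ∈ TestFn n M)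
    (hv : v ∈ TestFn n M) : smoothHypot ε u v ∈ TestFn n M := by
  have hF : ContDiff ℝ ∞ fun p : ℝ × ℝ => Real.sqrt (p.1 ^ 2 + p.2 ^ 2 + ε ^ 2) - ε := by
    refine ContDiff.sub (ContDiff.sqrt (by fun_prop) fun p => ?_) contDiff_const
    positivity
  refine ⟨hF.comp_contMDiff (hu.1.prodMk_space hv.1), ?_⟩
  refine (hu.2.union hv.2).of_isClosed_subset (isClosed_tsupport _) ?_
  refine closure_minimal (fun x hx => ?_) ((isClosed_tsupport _).union (isClosed_tsupport _))
  by_contra h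
  rw [mem_union, not_or] at h
  apply hx
  unfold _root_.smoothHypot
  simp [image_eq_zero_of_notMem_tsupport h.1, image_eq_zero_of_notMem_tsupport h.2,
    Real.sqrt_sq hε.le]

theorem sq_smoothHypot_add (ε : ℝ) (u v : M → ℝ) (x : M) :
    (smoothHypot ε u v x + ε) ^ 2 = u x ^ 2 + v x ^ 2 + ε ^ 2 := by
  unfold smoothHypot
  rw [sub_add_cancel, Real.sq_sqrt (by positivity)]

theorem smoothHypot_nonneg (ε : ℝ) (u v : M → ℝ) (x : M) :
    0 ≤ smoothHypot ε u v x :=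
  sub_nonneg.2 (Real.le_sqrt_of_sq_le (by nlinarith [sq_nonneg (u x), sq_nonneg (v x)]))

theorem smoothHypot_le {ε : ℝ} (hε : 0 < ε) (u v : M → ℝ) (x : M) :
    smoothHypot ε u v x ≤ |u x| + |v x| := by
  unfold smoothHypot
  rw [sub_le_iff_le_add]
  refine Real.sqrt_le_iff.2 ⟨by positivity, ?_⟩
  nlinarith [abs_nonneg (u x), abs_nonneg (v x), sq_abs (u x), sq_abs (v x),
    mul_nonneg (abs_nonneg (u x)) (abs_nonneg (v x)), mul_nonneg (abs_nonneg (u x)) hε.le,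
    mul_nonneg (abs_nonneg (v x)) hε.le]

theorem diffAt_smoothHypot {ε : ℝ} (hε : 0 < ε) {u v : M → ℝ} (hu : u ∈ TestFn n M)
    (hv : v ∈ TestFn n M) (x : M) :
    (smoothHypot ε u v x + ε) • diffAt n (smoothHypot ε u v) x =
      u x • diffAt n u x + v x • diffAt n v x := by
  have hr := TestFn.smoothHypot hε hu hv
  have e : smoothHypot ε u v * smoothHypot ε u v + (2 * ε) • smoothHypot ε u v = u * u + v * v := by
    ext y
    have := sq_smoothHypot_add ε u v y
    simp only [Pi.add_apply, Pi.mul_apply, Pi.smul_apply, smul_eq_mul]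
    linarith
  have h := congrArg (fun w => diffAt n w x) e
  simp only [diffAt_add (TestFn.mul hr hr) ((TestFn n M).smul_mem _ hr),
    diffAt_add (TestFn.mul hu hu) (TestFn.mul hv hv), diffAt_mul hr hr, diffAt_mul hu hu,
    diffAt_mul hv hv, diffAt_smul hr] at h
  have h2 : (2 : ℝ) • ((smoothHypot ε u v x + ε) • diffAt n (smoothHypot ε u v) x) =
      (2 : ℝ) • (u x • diffAt n u x + v x • diffAt n v x) := by
    rw [smul_add, two_smul ℝ (u x • _), two_smul ℝ (v x • _), ← h]
    module
  exact smul_right_injective _ two_ne_zero h2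

namespace DivFormOperator

variable (P : DivFormOperator n M ν)

/-- The energy density `⟨A∇u, ∇v⟩` of `P`. -/
def energy (u v : M → ℝ) (x : M) : ℝ := diffAt n v x (P.A x (diffAt n u x))

theorem density_eq (u v : M → ℝ) (x : M) :
    P.density u v x = P.energy u v x + P.c x * (u x * v x) := rfl

theorem pair_self_nonneg {x : M} (ξ : Cotangent n M x) : 0 ≤ ξ (P.A x ξ) := by
  by_cases h : ξ = 0
  · simp [h]
  · exact (P.posDef x ξ h).le

theorem energy_self_nonneg (u : M → ℝ) (x : M) : 0 ≤ P.energy u u x := P.pair_self_nonneg _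

/-- Cauchy-Schwarz for the energy density, with a parameter. -/
theorem abs_energy_le (u v : M → ℝ) (x : M) (a b : ℝ) :
    2 * |a * b * P.energy u v x| ≤ a ^ 2 * P.energy u u x + b ^ 2 * P.energy v v x := by
  have h := P.abs_pair_le (ξ := b • diffAt n v x) (η := a • diffAt n u x)
  simp only [map_smul, _root_.smul_apply, smul_eq_mul] at h
  have e : a * b * P.energy u v x = a * (b * (diffAt n v x) (P.A x (diffAt n u x))) := by
    unfold energy; ring
  rw [e]
  unfold energy
  linarith

theorem energy_add_self_le (u v : M → ℝ) {w : M → ℝ} {x : M} {a b : ℝ}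
    (h : diffAt n w x = a • diffAt n u x + b • diffAt n v x) :
    P.energy w w x ≤ 2 * a ^ 2 * P.energy u u x + 2 * b ^ 2 * P.energy v v x := by
  have h1 := P.pair_self_nonneg (a • diffAt n u x - b • diffAt n v x)
  simp only [energy, h, map_add, map_sub, map_smul, _root_.add_apply, _root_.sub_apply,
    _root_.smul_apply, smul_eq_mul] at h1 ⊢
  linarith

theorem energy_right {u v₁ v₂ w : M → ℝ} {x : M} {a b : ℝ}
    (h : diffAt n w x = a • diffAt n v₁ x + b • diffAt n v₂ x) :
    P.energy u w x = a * P.energy u v₁ x + b * P.energy u v₂ x := by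
  simp only [energy, h, _root_.add_apply, _root_.smul_apply, smul_eq_mul]

/-- The pointwise form of the positivity argument: passing from the pair `(u, ψ)` to the modulus
`√(u² + ψ²)` discards the energy of the angle. -/
theorem energy_smoothHypot_le {ε : ℝ} (hε : 0 < ε) {u ψ : M → ℝ} (hu : u ∈ TestFn n M)
    (hψ : ψ ∈ TestFn n M) (x : M) :
    P.energy (smoothHypot ε u ψ) (smoothHypot ε u ψ) x ≤
      P.energy u u x + P.energy ψ ψ x := by
  set N := smoothHypot ε u ψ x + ε with hN
  have hN0 : 0 < N := by have := smoothHypot_nonneg ε u ψ x; positivity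
  have hN2 : N ^ 2 = u x ^ 2 + ψ x ^ 2 + ε ^ 2 := sq_smoothHypot_add ε u ψ x
  have hd := diffAt_smoothHypot hε hu hψ x
  have h1 := P.pair_self_nonneg (ψ x • diffAt n u x - u x • diffAt n ψ x)
  have h2 := congrArg (fun ξ : Cotangent n M x => ξ (P.A x ξ)) hd
  have hs := P.symm x (diffAt n u x) (diffAt n ψ x)
  have e1 := P.energy_self_nonneg u x
  have e2 := P.energy_self_nonneg ψ x
  simp only [← hN, energy, map_add, map_sub, map_smul, _root_.add_apply, _root_.sub_apply,
    _root_.smul_apply, smul_eq_mul] at h1 h2 e1 e2 ⊢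
  refine le_of_mul_le_mul_left ?_ (pow_pos hN0 2)
  have h3 : 0 ≤ ε ^ 2 * (diffAt n u x (P.A x (diffAt n u x)) +
    diffAt n ψ x (P.A x (diffAt n ψ x))) := by positivity
  rw [hN2, mul_add]
  rw [← hN2]
  nlinarith

/-- Where `ψ = 1` is locally constant, at least half of the energy of `arsinh u` is discarded. -/
theorem energy_smoothHypot_add_le {ε : ℝ} (hε : 0 < ε) (hε1 : ε ≤ 1) {u ψ : M → ℝ}
    (hu : u ∈ TestFn n M) (hψ : ψ ∈ TestFn n M) {x : M} (hx : ψ x = 1) (hdx : diffAt n ψ x = 0) :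
    P.energy (smoothHypot ε u ψ) (smoothHypot ε u ψ) x +
      P.energy u u x / (2 * (1 + u x ^ 2)) ≤ P.energy u u x := by
  set N := smoothHypot ε u ψ x + ε with hN
  have hN2 : N ^ 2 = u x ^ 2 + 1 + ε ^ 2 := by
    rw [hN, sq_smoothHypot_add, hx, one_pow]
  have hN2p : 0 < N ^ 2 := by rw [hN2]; positivity
  have hd := diffAt_smoothHypot hε hu hψ x
  rw [hdx, smul_zero, add_zero] at hd
  have h2 := congrArg (fun ξ : Cotangent n M x => ξ (P.A x ξ)) hd
  simp only [← hN, map_smul, _root_.smul_apply, smul_eq_mul] at h2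
  have e1 := P.energy_self_nonneg u x
  have h3 : N ^ 2 * P.energy (smoothHypot ε u ψ) (smoothHypot ε u ψ) x =
      u x ^ 2 * P.energy u u x := by
    unfold energy
    linarith
  have h4 : P.energy u u x / (2 * (1 + u x ^ 2)) ≤ P.energy u u x / N ^ 2 := by
    refine div_le_div_of_nonneg_left e1 hN2p ?_
    rw [hN2]
    nlinarith [sq_nonneg (u x)]
  refine (add_le_add le_rfl h4).trans ?_
  rw [← mul_le_mul_iff_right₀ hN2p, mul_add, h3, mul_div_cancel₀ _ hN2p.ne', hN2]
  nlinarith [sq_nonneg ε]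

/-- The operator with the same principal part and no potential, whose density is the energy
density. -/
def principal : DivFormOperator n M ν where
  A := P.A
  c := fun _ => 0
  symm := P.symm
  posDef := P.posDef
  aemeasurable_A := P.aemeasurable_A
  aemeasurable_c := aemeasurable_const
  elliptic := P.elliptic
  bdd_c := fun _ _ => ⟨0, Eventually.of_forall fun _ _ => by simp⟩

section

variable [T2Space M] [BorelSpace M] [IsManifold 𝓘(ℝ, Euc n) ∞ M] [IsLocallyLebesgue n ν]

theorem integrable_energy {u v : M → ℝ} (hu : u ∈ TestFn n M) (hv : v ∈ TestFn n M) :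
    Integrable (P.energy u v) ν := by
  refine (P.principal.integrable_density hu hv).congr (Eventually.of_forall fun x => ?_)
  simp [density, principal, energy]

theorem q_add {u v : M → ℝ} (hu : u ∈ TestFn n M) (hv : v ∈ TestFn n M) (a b : ℝ) :
    P.q (a • u + b • v) = a ^ 2 * P.q u + 2 * a * b * P.form u v + b ^ 2 * P.q v := by
  have hau := (TestFn n M).smul_mem a hu
  have hbv := (TestFn n M).smul_mem b hv
  have hs := (TestFn n M).add_mem hau hbv
  unfold q
  rw [P.form_add_left hau hbv hs, P.form_smul_left hu, P.form_smul_left hv,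
    P.form_symm u, P.form_symm v, P.form_add_left hau hbv hu, P.form_add_left hau hbv hv,
    P.form_smul_left hu, P.form_smul_left hv, P.form_smul_left hu, P.form_smul_left hv,
    P.form_symm v u]
  ring

theorem q_smul {u : M → ℝ} (hu : u ∈ TestFn n M) (a : ℝ) : P.q (a • u) = a ^ 2 * P.q u := by
  have := P.q_add hu hu a 0
  simpa using this

end

end DivFormOperator

end Energy

/-! ### Logarithmic and Caccioppoli estimates for a nonnegative form -/

/-- The pointwise inequality obtained by testing with `v = χ² u (1 + u²)^(s - 1)`. Here `a` and `b`
are `(1 + u²)^(s - 1)` and `(1 + u²)^(s - 2)`, while `E`, `F`, `G` are the energy densities of `u`,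
of `χ` and of the pair; `Ys` and `Yi` stand for `(1 + u²)^s` and `(1 + u²)^(-1)`. The coefficient
`-(1 - 2s)` is at most `-1/2`, so the main term keeps its sign uniformly in `s`. -/
theorem rpow_test_lower_bound {c C χ u a b s E F G Ys Yi : ℝ} (hc : |c| ≤ C) (hχ : χ ^ 2 ≤ 1)
    (ha : 0 < a) (hb : 0 < b) (hs : 0 < s) (hs4 : s ≤ 1 / 4) (hE : 0 ≤ E) (hF : 0 ≤ F)
    (hua : u ^ 2 * a ≤ Ys) (hbY : b ≤ Yi)
    (hG : 2 * |χ / 2 * (2 * u) * G| ≤ (χ / 2) ^ 2 * E + (2 * u) ^ 2 * F) :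
    χ ^ 2 * (a * E) / 4 ≤ -(2 * χ * (u * a) * G +
      χ ^ 2 * (-(1 - 2 * s) * a + 2 * (1 - s) * b) * E + c * (u * (χ ^ 2 * (u * a)))) +
      4 * (Ys * F) + 2 * (Yi * E) + C * (χ ^ 2 * Ys) := by
  have hC : 0 ≤ C := (abs_nonneg _).trans hc
  have hYi : 0 ≤ Yi := hb.le.trans hbY
  have h3 : c * (u * (χ ^ 2 * (u * a))) ≤ C * (χ ^ 2 * Ys) := by
    calc c * (u * (χ ^ 2 * (u * a))) = c * (χ ^ 2 * (u ^ 2 * a)) := by ring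
      _ ≤ C * (χ ^ 2 * (u ^ 2 * a)) := by
          refine mul_le_mul_of_nonneg_right ((le_abs_self _).trans hc) (by positivity)
      _ ≤ C * (χ ^ 2 * Ys) := by gcongr
  have h2 := le_abs_self (χ / 2 * (2 * u) * G)
  have h4 : 2 * χ * (u * a) * G ≤ a * (χ ^ 2 * E) / 4 + 4 * (Ys * F) := by
    have h5 : 2 * (χ / 2 * (2 * u) * G) ≤ (χ / 2) ^ 2 * E + (2 * u) ^ 2 * F := by linarith
    have h6 := mul_le_mul_of_nonneg_left h5 ha.le
    have h7 := mul_le_mul_of_nonneg_right hua hF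
    linarith
  have h8 : χ ^ 2 * b * E ≤ Yi * E := by
    calc χ ^ 2 * b * E ≤ 1 * Yi * E := by gcongr
      _ = _ := by ring
  have h9 : 0 ≤ a * (χ ^ 2 * E) := by positivity
  have h11 : a * (χ ^ 2 * E) * s ≤ a * (χ ^ 2 * E) * (1 / 4) := by gcongr
  have h12 : 0 ≤ s * (χ ^ 2 * b * E) := by positivity
  linarith

/-- The energy of the test function `v = χ² u (1 + u²)^(s - 1)`, in the notation of
`rpow_test_lower_bound`; since `2s - 2 ≤ -1`, it is bounded by the energies of `arsinh u`
and `χ`, and a constant. -/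
theorem rpow_test_upper_bound {c C χ u a b s E F D Yi : ℝ} (hc : |c| ≤ C) (hχ : χ ^ 2 ≤ 1)
    (ha : 0 < a) (hb : 0 < b) (hs : 0 < s) (hs4 : s ≤ 1 / 4) (hE : 0 ≤ E) (hF : 0 ≤ F)
    (hba : b ≤ a) (hu2a : u ^ 2 * a ^ 2 ≤ 1) (haY : a ^ 2 ≤ Yi)
    (hD : D ≤ 2 * (2 * χ * (u * a)) ^ 2 * F +
      2 * (χ ^ 2 * (-(1 - 2 * s) * a + 2 * (1 - s) * b)) ^ 2 * E) :
    D + c * (χ ^ 2 * (u * a) * (χ ^ 2 * (u * a))) ≤ 8 * F + 8 * (Yi * E) + C * 1 := by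
  have hC : 0 ≤ C := (abs_nonneg _).trans hc
  have hχ4 : (χ ^ 2) ^ 2 ≤ 1 := pow_le_one₀ (sq_nonneg _) hχ
  have h2 : 2 * (2 * χ * (u * a)) ^ 2 * F ≤ 8 * F := by
    calc 2 * (2 * χ * (u * a)) ^ 2 * F = 8 * (χ ^ 2 * (u ^ 2 * a ^ 2) * F) := by ring
      _ ≤ 8 * (1 * 1 * F) := by gcongr
      _ = _ := by ring
  have h3 : 2 * (χ ^ 2 * (-(1 - 2 * s) * a + 2 * (1 - s) * b)) ^ 2 * E ≤ 8 * (Yi * E) := by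
    have e1 : (1 - s) * b ≤ 1 * a := by gcongr; linarith
    have e2 : 0 ≤ (1 - s) * b := mul_nonneg (by linarith) hb.le
    have e3 : (1 - 2 * s) * a ≤ 1 * a := by gcongr; linarith
    have e4 : 0 ≤ (1 - 2 * s) * a := mul_nonneg (by linarith) ha.le
    have h4 : (-(1 - 2 * s) * a + 2 * (1 - s) * b) ^ 2 ≤ (2 * a) ^ 2 := by
      apply sq_le_sq'
      · linarith
      · linarith
    calc 2 * (χ ^ 2 * (-(1 - 2 * s) * a + 2 * (1 - s) * b)) ^ 2 * E =
          2 * ((χ ^ 2) ^ 2 * (-(1 - 2 * s) * a + 2 * (1 - s) * b) ^ 2) * E := by ring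
      _ ≤ 2 * (1 * (2 * a) ^ 2) * E := by gcongr
      _ = 8 * (a ^ 2 * E) := by ring
      _ ≤ _ := by gcongr
  have h4 : c * (χ ^ 2 * (u * a) * (χ ^ 2 * (u * a))) ≤ C * 1 := by
    calc c * (χ ^ 2 * (u * a) * (χ ^ 2 * (u * a))) =
          c * ((χ ^ 2) ^ 2 * (u ^ 2 * a ^ 2)) := by ring
      _ ≤ C * ((χ ^ 2) ^ 2 * (u ^ 2 * a ^ 2)) :=
          mul_le_mul_of_nonneg_right ((le_abs_self _).trans hc) (by positivity)
      _ ≤ C * (1 * 1) := by gcongr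
      _ = _ := by ring
  linarith


section Caccioppoli

variable {n : ℕ} {M : Type*} [TopologicalSpace M] [ChartedSpace (Euc n) M]
  [MeasurableSpace M] {ν : Measure M}
  [T2Space M] [BorelSpace M] [IsManifold 𝓘(ℝ, Euc n) ∞ M] [IsLocallyLebesgue n ν]

namespace DivFormOperator

variable (P : DivFormOperator n M ν)

theorem integrable_energy_mul {u v w : M → ℝ} (hu : u ∈ TestFn n M) (hv : v ∈ TestFn n M)
    (hw : Continuous w) {B : ℝ} (hB : ∀ x, |w x| ≤ B) :
    Integrable (fun x => w x * P.energy u v x) ν :=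
  (P.integrable_energy hu hv).bdd_mul hw.aestronglyMeasurable (Eventually.of_forall hB)

theorem integrable_continuous_mul_energy {u v w : M → ℝ} (hu : u ∈ TestFn n M)
    (hv : v ∈ TestFn n M) (hw : Continuous w) :
    Integrable (fun x => w x * P.energy u v x) ν := by
  obtain ⟨B, hB⟩ := hv.2.exists_bound_of_continuousOn hw.continuousOn
  set K := tsupport v with hK
  have h := (P.integrable_energy hu hv).bdd_mul
    (hw.aestronglyMeasurable.indicator (hv.2.isClosed.measurableSet)) (c := max B 0)
    (f := K.indicator w) (Eventually.of_forall fun x => ?_)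
  · refine h.congr (Eventually.of_forall fun x => ?_)
    by_cases hx : x ∈ K
    · simp [indicator_of_mem hx]
    · simp [energy, diffAt_eq_zero hx]
  · by_cases hx : x ∈ K
    · rw [indicator_of_mem hx]
      exact (hB x hx).trans (le_max_left _ _)
    · rw [indicator_of_notMem hx, norm_zero]
      exact le_max_right _ _

/-- The logarithmic estimate: the form being nonnegative at `√(u² + ψ²)` bounds the energy of
`arsinh u`, where `ψ = 1`, by `q(u) + q(ψ)`. -/
theorem setIntegral_energy_div_le (hP : P.Nonneg) {K : Set M} (hK : IsCompact K) {u ψ : M → ℝ}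
    (hu : u ∈ TestFn n M) (hψ : ψ ∈ TestFn n M) (h1 : ∀ x ∈ K, ψ x = 1 ∧ diffAt n ψ x = 0) :
    ∫ x in K, P.energy u u x / (1 + u x ^ 2) ∂ν ≤ 2 * (P.q u + P.q ψ) := by
  have : IsLocallyFiniteMeasure ν := isLocallyFinite_of_isLocallyLebesgue (n := n)
  have hKm : MeasurableSet K := hK.isClosed.measurableSet
  obtain ⟨C, hC⟩ := P.bdd_c _ (hu.2.isCompact.union hψ.2.isCompact)
  have huc := hu.1.continuous
  have hψc := hψ.1.continuous
  set D := ∫ x, 2 * |C| * (|u x| + |ψ x|) ∂ν with hD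
  have iD : Integrable (fun x => 2 * |C| * (|u x| + |ψ x|)) ν := by
    refine Integrable.const_mul (Integrable.add ?_ ?_) _
    · exact (huc.integrable_of_hasCompactSupport hu.2).abs
    · exact (hψc.integrable_of_hasCompactSupport hψ.2).abs
  have iE : Integrable (fun x => P.energy u u x / (2 * (1 + u x ^ 2))) ν := by
    have := P.integrable_energy_mul hu hu (w := fun x => (2 * (1 + u x ^ 2))⁻¹) (B := 1) ?_ ?_
    · exact this.congr (Eventually.of_forall fun x => by simp only; ring)
    · exact (by fun_prop : Continuous fun x => 2 * (1 + u x ^ 2)).inv₀ fun x => by positivity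
    · intro x
      rw [abs_of_pos (by positivity)]
      exact inv_le_one_of_one_le₀ (by nlinarith [sq_nonneg (u x)])
  have key : ∀ ε : ℝ, 0 < ε → ε ≤ 1 →
      ∫ x in K, P.energy u u x / (2 * (1 + u x ^ 2)) ∂ν ≤ P.q u + P.q ψ + ε * D := by
    intro ε hε hε1
    have hr := TestFn.smoothHypot hε hu hψ
    set r := smoothHypot ε u ψ with hrdef
    have hpt : ∀ᵐ x ∂ν, K.indicator (fun x => P.energy u u x / (2 * (1 + u x ^ 2))) x ≤
        P.density u u x + P.density ψ ψ x - P.density r r x + ε * (2 * |C| * (|u x| + |ψ x|)) := by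
      filter_upwards [hC] with x hx
      have hc : P.c x * (r x * r x - (u x * u x + ψ x * ψ x)) ≤
          ε * (2 * |C| * (|u x| + |ψ x|)) := by
        have e := sq_smoothHypot_add ε u ψ x
        have hr0 := smoothHypot_nonneg ε u ψ x
        have hr1 := smoothHypot_le hε u ψ x
        rw [← hrdef] at e hr0 hr1
        have e2 : r x * r x - (u x * u x + ψ x * ψ x) = -(2 * ε * r x) := by linarith
        rw [e2]
        by_cases hxS : x ∈ tsupport u ∪ tsupport ψ
        · have h2 := (hx hxS).trans (le_abs_self C)
          calc P.c x * -(2 * ε * r x) ≤ |P.c x| * (2 * ε * r x) := by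
                rw [mul_neg, ← neg_mul]
                gcongr
                exact neg_le_abs _
            _ ≤ |C| * (2 * ε * (|u x| + |ψ x|)) := by gcongr
            _ = _ := by ring
        · rw [mem_union, not_or] at hxS
          have hu0 := image_eq_zero_of_notMem_tsupport hxS.1
          have hψ0 := image_eq_zero_of_notMem_tsupport hxS.2
          rw [hu0, hψ0, abs_zero, add_zero] at hr1 ⊢
          rw [le_antisymm hr1 hr0]
          simp
      have h2 : K.indicator (fun x => P.energy u u x / (2 * (1 + u x ^ 2))) x ≤
          P.energy u u x + P.energy ψ ψ x - P.energy r r x := by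
        by_cases hxK : x ∈ K
        · rw [indicator_of_mem hxK]
          have := P.energy_smoothHypot_add_le hε hε1 hu hψ (h1 x hxK).1 (h1 x hxK).2
          have := P.energy_self_nonneg ψ x
          rw [← hrdef] at *
          linarith
        · rw [indicator_of_notMem hxK]
          have := P.energy_smoothHypot_le hε hu hψ x
          rw [← hrdef] at *
          linarith
      simp only [density_eq]
      linarith
    have i1 := P.integrable_density hu hu
    have i2 := P.integrable_density hψ hψ
    have i3 := P.integrable_density hr hr
    have h3 := integral_mono_ae (iE.indicator hKm) (((i1.add i2).sub i3).add (iD.const_mul ε)) hpt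
    have e1 := integral_add' ((i1.add i2).sub i3) (iD.const_mul ε)
    have e2 := integral_sub' (i1.add i2) i3
    have e3 := integral_add' i1 i2
    have e4 : ∀ w, ∫ x, P.density w w x ∂ν = P.q w := fun _ => rfl
    rw [integral_indicator hKm, e1, e2, e3, integral_const_mul, e4, e4, e4] at h3
    have := hP r hr
    linarith
  have hfin : ∫ x in K, P.energy u u x / (2 * (1 + u x ^ 2)) ∂ν ≤ P.q u + P.q ψ := by
    refine ge_of_tendsto (x := 𝓝[>] (0 : ℝ)) (f := fun ε => P.q u + P.q ψ + ε * D) ?_ ?_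
    · have : Tendsto (fun ε : ℝ => P.q u + P.q ψ + ε * D) (𝓝 0) (𝓝 (P.q u + P.q ψ + 0 * D)) :=
        Continuous.tendsto (by fun_prop) 0
      rw [zero_mul, add_zero] at this
      exact this.mono_left nhdsWithin_le_nhds
    · filter_upwards [Ioc_mem_nhdsGT zero_lt_one] with ε hε using key ε hε.1 hε.2
  have e : ∀ x, P.energy u u x / (1 + u x ^ 2) = 2 * (P.energy u u x / (2 * (1 + u x ^ 2))) := by
    intro x
    have : (0 : ℝ) < 1 + u x ^ 2 := by positivity
    field_simp
  simp_rw [e]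
  rw [integral_const_mul]
  linarith

/-- Positivity of `q` at `u + v`. -/
theorem neg_form_le (hP : P.Nonneg) {u v : M → ℝ} (hu : u ∈ TestFn n M) (hv : v ∈ TestFn n M) :
    -P.form u v ≤ (P.q u + P.q v) / 2 := by
  have h := hP _ ((TestFn n M).add_mem ((TestFn n M).smul_mem 1 hu) ((TestFn n M).smul_mem 1 hv))
  rw [P.q_add hu hv] at h
  linarith

/-- Positivity of `q` at `8u - v`; the weight `1/16` lets the term `q(χ² u)` be absorbed in the
Caccioppoli inequality. -/
theorem form_le (hP : P.Nonneg) {u v : M → ℝ} (hu : u ∈ TestFn n M) (hv : v ∈ TestFn n M) :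
    P.form u v ≤ 4 * P.q u + P.q v / 16 := by
  have h := hP _ ((TestFn n M).add_mem ((TestFn n M).smul_mem 8 hu) ((TestFn n M).smul_mem (-1) hv))
  rw [P.q_add hu hv] at h
  linarith

/-- The Caccioppoli inequality; the test function is `χ² u`. -/
theorem integral_sq_mul_energy_le (hP : P.Nonneg) {K : Set M} {C : ℝ}
    (hC : ∀ᵐ x ∂ν, x ∈ K → |P.c x| ≤ C) {u χ : M → ℝ} (hu : u ∈ TestFn n M)
    (hχ : χ ∈ TestFn n M) (hχ1 : ∀ x, |χ x| ≤ 1) (hχK : ∀ x, x ∉ K → χ x = 0) :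
    ∫ x, χ x ^ 2 * P.energy u u x ∂ν ≤ 11 * P.q u + 7 * ∫ x, u x ^ 2 * P.energy χ χ x ∂ν +
      6 * |C| * ∫ x, χ x ^ 2 * u x ^ 2 ∂ν := by
  have huc := hu.1.continuous
  have hχc := hχ.1.continuous
  set v := χ * (χ * u) with hv
  have hvt : v ∈ TestFn n M := TestFn.mul hχ (TestFn.mul hχ hu)
  have hdv : ∀ x, diffAt n v x = (2 * χ x * u x) • diffAt n χ x + χ x ^ 2 • diffAt n u x := by
    intro x
    rw [hv, diffAt_mul hχ (TestFn.mul hχ hu), diffAt_mul hχ hu]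
    simp only [Pi.mul_apply]
    module
  have iX : Integrable (fun x => χ x ^ 2 * P.energy u u x) ν :=
    P.integrable_continuous_mul_energy hu hu (by fun_prop)
  have iU : Integrable (fun x => u x ^ 2 * P.energy χ χ x) ν :=
    P.integrable_continuous_mul_energy hχ hχ (by fun_prop)
  have iE : Integrable (fun x => χ x ^ 2 * u x ^ 2) ν := by
    have : IsLocallyFiniteMeasure ν := isLocallyFinite_of_isLocallyLebesgue (n := n)
    have hs : HasCompactSupport fun x => u x ^ 2 :=
      hu.2.comp_left (g := fun a : ℝ => a ^ 2) (by simp)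
    exact ((hχc.pow 2).mul (huc.pow 2)).integrable_of_hasCompactSupport hs.mul_left
  have hpt : ∀ᵐ x ∂ν, χ x ^ 2 * P.energy u u x / 2 ≤
      P.density u v x + 2 * (u x ^ 2 * P.energy χ χ x) + |C| * (χ x ^ 2 * u x ^ 2) ∧
      P.density v v x ≤ 8 * (u x ^ 2 * P.energy χ χ x) + 2 * (χ x ^ 2 * P.energy u u x) +
        |C| * (χ x ^ 2 * u x ^ 2) := by
    filter_upwards [hC] with x hx
    have hχx : χ x ^ 2 ≤ 1 := by rw [← sq_abs]; exact pow_le_one₀ (abs_nonneg _) (hχ1 x)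
    have hcb : |P.c x| * χ x ^ 2 ≤ |C| * χ x ^ 2 := by
      by_cases hxK : x ∈ K
      · exact mul_le_mul_of_nonneg_right ((hx hxK).trans (le_abs_self C)) (sq_nonneg _)
      · rw [hχK x hxK]; simp
    have hvx : v x = χ x ^ 2 * u x := by simp only [hv, Pi.mul_apply]; ring
    have hE := P.energy_self_nonneg u x
    have hF := P.energy_self_nonneg χ x
    constructor
    · rw [density_eq, P.energy_right (u := u) (hdv x), hvx]
      have h1 := P.abs_energy_le u χ x (χ x) (2 * u x)
      have h2 := neg_abs_le (χ x * (2 * u x) * P.energy u χ x)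
      have h3 : -(|C| * (χ x ^ 2 * u x ^ 2)) ≤ P.c x * (u x * (χ x ^ 2 * u x)) := by
        have := neg_abs_le (P.c x)
        have h4 : 0 ≤ χ x ^ 2 * u x ^ 2 := by positivity
        have h5 := mul_le_mul_of_nonneg_right hcb (sq_nonneg (u x))
        have h6 := mul_le_mul_of_nonneg_right this h4
        linarith
      linarith
    · rw [density_eq, hvx]
      have h1 := P.energy_add_self_le χ u (hdv x)
      have h2 : 2 * (2 * χ x * u x) ^ 2 * P.energy χ χ x ≤ 8 * (u x ^ 2 * P.energy χ χ x) := by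
        have := mul_le_mul_of_nonneg_right hχx (mul_nonneg (sq_nonneg (u x)) hF)
        linarith
      have h3 : 2 * (χ x ^ 2) ^ 2 * P.energy u u x ≤ 2 * (χ x ^ 2 * P.energy u u x) := by
        have := mul_le_mul_of_nonneg_right hχx (mul_nonneg (sq_nonneg (χ x)) hE)
        linarith
      have h4 : P.c x * (χ x ^ 2 * u x * (χ x ^ 2 * u x)) ≤ |C| * (χ x ^ 2 * u x ^ 2) := by
        calc P.c x * (χ x ^ 2 * u x * (χ x ^ 2 * u x)) =
              P.c x * (χ x ^ 2) * (χ x ^ 2 * u x ^ 2) := by ring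
          _ ≤ (|P.c x| * χ x ^ 2) * (χ x ^ 2 * u x ^ 2) := by gcongr; exact le_abs_self _
          _ ≤ (|C| * χ x ^ 2) * (χ x ^ 2 * u x ^ 2) := by gcongr
          _ = χ x ^ 2 * (|C| * (χ x ^ 2 * u x ^ 2)) := by ring
          _ ≤ 1 * (|C| * (χ x ^ 2 * u x ^ 2)) := by gcongr
          _ = _ := one_mul _
      linarith
  have iuv := P.integrable_density hu hvt
  have ivv := P.integrable_density hvt hvt
  have h1 := integral_mono_ae (iX.div_const 2) ((iuv.add (iU.const_mul 2)).add (iE.const_mul |C|))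
    (hpt.mono fun x hx => hx.1)
  have h2 := integral_mono_ae ivv (((iU.const_mul 8).add (iX.const_mul 2)).add (iE.const_mul |C|))
    (hpt.mono fun x hx => hx.2)
  have e1 := integral_add' (iuv.add (iU.const_mul 2)) (iE.const_mul |C|)
  have e2 := integral_add' iuv (iU.const_mul 2)
  have e3 := integral_add' ((iU.const_mul 8).add (iX.const_mul 2)) (iE.const_mul |C|)
  have e4 := integral_add' (iU.const_mul 8) (iX.const_mul 2)
  rw [e1, e2] at h1
  rw [e3, e4] at h2
  simp only [integral_const_mul, integral_div] at h1 h2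
  have h3 := P.form_le hP hu hvt
  have e5 : ∫ x, P.density u v x ∂ν = P.form u v := rfl
  have e6 : ∫ x, P.density v v x ∂ν = P.q v := rfl
  rw [e5] at h1
  rw [e6] at h2
  have hU0 : 0 ≤ ∫ x, u x ^ 2 * P.energy χ χ x ∂ν :=
    integral_nonneg fun x => mul_nonneg (sq_nonneg _) (P.energy_self_nonneg χ x)
  have hE0 : 0 ≤ |C| * ∫ x, χ x ^ 2 * u x ^ 2 ∂ν :=
    mul_nonneg (abs_nonneg _) (integral_nonneg fun x => by positivity)
  have hq0 := hP u hu
  linarith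

/-- The Caccioppoli inequality for small powers of `1 + u²`; the test function is
`χ² u (1 + u²)^(s - 1)`. The constant does not depend on the power `s`. -/
theorem exists_integral_rpow_mul_energy_le (hP : P.Nonneg) {K : Set M} (hK : IsCompact K)
    {χ ψ : M → ℝ} (hχ : χ ∈ TestFn n M) (hχ1 : ∀ x, |χ x| ≤ 1) (hχK : ∀ x, x ∉ K → χ x = 0)
    (hψ : ψ ∈ TestFn n M) (hψ1 : ∀ x ∈ K, ψ x = 1 ∧ diffAt n ψ x = 0) :
    ∃ A : ℝ, 0 ≤ A ∧ ∀ u ∈ TestFn n M, P.q u ≤ 1 → ∀ s : ℝ, 0 < s → s ≤ 1 / 4 →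
      ∫ x, χ x ^ 2 * ((1 + u x ^ 2) ^ (s - 1) * P.energy u u x) ∂ν ≤
        A * (1 + ∫ x, (χ x ^ 2 + P.energy χ χ x) * (1 + u x ^ 2) ^ s ∂ν) := by
  have : IsLocallyFiniteMeasure ν := isLocallyFinite_of_isLocallyLebesgue (n := n)
  have hKm : MeasurableSet K := hK.isClosed.measurableSet
  obtain ⟨C, hC⟩ := P.bdd_c K hK
  set L := 2 * (1 + P.q ψ) with hL
  have hqψ := hP ψ hψ
  have hχc := hχ.1.continuous
  set X := ∫ x, P.energy χ χ x ∂ν with hX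
  have hX0 : 0 ≤ X := integral_nonneg fun x => P.energy_self_nonneg χ x
  set k := ν.real K with hk
  have hk0 : 0 ≤ k := measureReal_nonneg
  refine ⟨2 + 16 * X + 24 * L + 2 * (|C| * k) + 16 + 4 * |C|, by positivity,
    fun u hu hq s hs hs4 => ?_⟩
  have huc := hu.1.continuous
  set Y : M → ℝ := fun x => 1 + u x ^ 2 with hY
  have hY1 : ∀ x, 1 ≤ Y x := fun x => by simp only [hY]; nlinarith [sq_nonneg (u x)]
  have hY0 : ∀ x, 0 < Y x := fun x => one_pos.trans_le (hY1 x)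
  have hYc : Continuous Y := by fun_prop
  have hYr : ∀ a : ℝ, Continuous fun x => Y x ^ a := fun a =>
    hYc.rpow_const fun x => Or.inl (hY0 x).ne'
  set g : ℝ → ℝ := fun t => t * (1 + t ^ 2) ^ (s - 1) with hg
  have hgc : ContDiff ℝ ∞ g := by
    refine contDiff_id.mul (ContDiff.rpow_const_of_ne (by fun_prop) fun t => ?_)
    positivity
  have hgd : ∀ x, HasDerivAt g (-(1 - 2 * s) * Y x ^ (s - 1) + 2 * (1 - s) * Y x ^ (s - 2))
      (u x) := by
    intro x
    have h1 : HasDerivAt (fun t : ℝ => 1 + t ^ 2) (2 * u x) (u x) := by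
      simpa using (hasDerivAt_pow 2 (u x)).const_add 1
    have h2 := (hasDerivAt_id (u x)).mul (h1.rpow_const (p := s - 1) (Or.inl (hY0 x).ne'))
    refine h2.congr_deriv ?_
    have e : (1 + u x ^ 2) ^ (s - 1) = (1 + u x ^ 2) ^ (s - 1 - 1) * (1 + u x ^ 2) := by
      rw [← Real.rpow_add_one (hY0 x).ne']
      congr 1
      ring
    have e2 : s - 2 = s - 1 - 1 := by ring
    simp only [hY, id, e2]
    rw [e]
    ring
  set v := χ * (χ * fun x => g (u x)) with hv
  have hgu : (fun x => g (u x)) ∈ TestFn n M := TestFn.comp hgc (by simp [hg]) hu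
  have hvt : v ∈ TestFn n M := TestFn.mul hχ (TestFn.mul hχ hgu)
  have hdv : ∀ x, diffAt n v x = (2 * χ x * g (u x)) • diffAt n χ x +
      (χ x ^ 2 * (-(1 - 2 * s) * Y x ^ (s - 1) + 2 * (1 - s) * Y x ^ (s - 2))) •
        diffAt n u x := by
    intro x
    rw [hv, diffAt_mul hχ (TestFn.mul hχ hgu), diffAt_mul hχ hgu, diffAt_comp hu x (hgd x)]
    simp only [Pi.mul_apply]
    module
  have iD : Integrable (fun x => χ x ^ 2 * (Y x ^ (s - 1) * P.energy u u x)) ν :=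
    (P.integrable_continuous_mul_energy hu hu ((hχc.pow 2).mul (hYr (s - 1)))).congr
      (Eventually.of_forall fun x => mul_assoc _ _ _)
  have iU : Integrable (fun x => Y x ^ s * P.energy χ χ x) ν :=
    P.integrable_continuous_mul_energy hχ hχ (hYr s)
  have iX := P.integrable_energy hχ hχ
  have hχ2 : HasCompactSupport fun x => χ x ^ 2 :=
    hχ.2.comp_left (g := fun a : ℝ => a ^ 2) (by simp)
  have iE : Integrable (fun x => χ x ^ 2 * Y x ^ s) ν :=
    ((hχc.pow 2).mul (hYr s)).integrable_of_hasCompactSupport hχ2.mul_right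
  have iL : Integrable (K.indicator fun x => P.energy u u x / (1 + u x ^ 2)) ν := by
    refine Integrable.indicator ?_ hKm
    refine (P.integrable_energy_mul hu hu (w := fun x => (Y x)⁻¹) (B := 1)
      (hYc.inv₀ fun x => (hY0 x).ne') fun x => ?_).congr
        (Eventually.of_forall fun x => by simp only [hY]; ring)
    rw [abs_of_pos (inv_pos.2 (hY0 x))]
    exact inv_le_one_of_one_le₀ (hY1 x)
  have iK : Integrable (K.indicator fun _ => (1 : ℝ)) ν :=
    (integrableOn_const hK.measure_lt_top.ne).integrable_indicator hKm
  -- the terms with the energy of `arsinh u` are bounded by the logarithmic estimate, independently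
  -- of `s`
  have hpt : ∀ᵐ x ∂ν, χ x ^ 2 * (Y x ^ (s - 1) * P.energy u u x) / 4 ≤
      -P.density u v x + 4 * (Y x ^ s * P.energy χ χ x) +
        2 * K.indicator (fun x => P.energy u u x / (1 + u x ^ 2)) x +
        |C| * (χ x ^ 2 * Y x ^ s) ∧
      P.density v v x ≤ 8 * P.energy χ χ x +
        8 * K.indicator (fun x => P.energy u u x / (1 + u x ^ 2)) x +
        |C| * K.indicator (fun _ => 1) x := by
    filter_upwards [hC] with x hx
    have hE := P.energy_self_nonneg u x
    have hF := P.energy_self_nonneg χ x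
    have hχx : χ x ^ 2 ≤ 1 := by rw [← sq_abs]; exact pow_le_one₀ (abs_nonneg _) (hχ1 x)
    have hvx : v x = χ x ^ 2 * g (u x) := by simp only [hv, Pi.mul_apply]; ring
    by_cases hxK : x ∈ K
    · rw [indicator_of_mem hxK, indicator_of_mem hxK]
      have hcC : |P.c x| ≤ |C| := (hx hxK).trans (le_abs_self C)
      have hgx : g (u x) = u x * Y x ^ (s - 1) := rfl
      have hs1 : Y x ^ s = Y x ^ (s - 1) * Y x := by
        rw [← Real.rpow_add_one (hY0 x).ne']; congr 1; ring
      have hs2 : Y x ^ (s - 1) = Y x ^ (s - 2) * Y x := by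
        rw [← Real.rpow_add_one (hY0 x).ne']; congr 1; ring
      have hs3 : Y x ^ (s - 2) ≤ (Y x)⁻¹ := by
        rw [← Real.rpow_neg_one]
        exact Real.rpow_le_rpow_of_exponent_le (hY1 x) (by linarith)
      have hs4' : Y x ^ (s - 1) ≤ 1 := Real.rpow_le_one_of_one_le_of_nonpos (hY1 x) (by linarith)
      have hp1 : 0 < Y x ^ (s - 1) := Real.rpow_pos_of_pos (hY0 x) _
      have hp2 : 0 < Y x ^ (s - 2) := Real.rpow_pos_of_pos (hY0 x) _
      have huY : u x ^ 2 = Y x - 1 := by simp only [hY]; ring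
      have huY' : u x ^ 2 ≤ Y x := by rw [huY]; linarith
      have hdiv : P.energy u u x / (1 + u x ^ 2) = (Y x)⁻¹ * P.energy u u x := by
        rw [div_eq_inv_mul]
      rw [hdiv]
      -- `u² (1 + u²)^(s - 1) ≤ (1 + u²)^s`
      have hua : u x ^ 2 * Y x ^ (s - 1) ≤ Y x ^ s := by
        rw [hs1, mul_comm]
        gcongr
      have hu2a : u x ^ 2 * (Y x ^ (s - 1)) ^ 2 ≤ 1 := by
        have h1 : Y x * (Y x ^ (s - 1)) ^ 2 = Y x ^ (2 * s - 1) := by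
          rw [← Real.rpow_natCast, ← Real.rpow_mul (hY0 x).le, mul_comm,
            ← Real.rpow_add_one (hY0 x).ne']
          congr 1; push_cast; ring
        have h2 : Y x ^ (2 * s - 1) ≤ 1 :=
          Real.rpow_le_one_of_one_le_of_nonpos (hY1 x) (by linarith)
        rw [← h1] at h2
        exact (mul_le_mul_of_nonneg_right huY' (sq_nonneg _)).trans h2
      have hba : Y x ^ (s - 2) ≤ Y x ^ (s - 1) := by
        rw [hs2]; exact le_mul_of_one_le_right hp2.le (hY1 x)
      have haY : (Y x ^ (s - 1)) ^ 2 ≤ (Y x)⁻¹ := by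
        have h6 : (Y x ^ (s - 1)) ^ 2 = Y x ^ (2 * s - 2) := by
          rw [← Real.rpow_natCast, ← Real.rpow_mul (hY0 x).le]
          congr 1; push_cast; ring
        rw [h6, ← Real.rpow_neg_one]
        exact Real.rpow_le_rpow_of_exponent_le (hY1 x) (by linarith)
      constructor
      · rw [density_eq, P.energy_right (u := u) (hdv x), hvx, hgx]
        exact rpow_test_lower_bound hcC hχx hp1 hp2 hs hs4 hE hF hua hs3
          (P.abs_energy_le u χ x (χ x / 2) (2 * u x))
      · rw [density_eq, hvx, hgx]
        have h1 := P.energy_add_self_le χ u (hdv x)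
        rw [hgx] at h1
        exact rpow_test_upper_bound hcC hχx hp1 hp2 hs hs4 hE hF hba hu2a haY h1
    · have hχ0 := hχK x hxK
      rw [indicator_of_notMem hxK, indicator_of_notMem hxK]
      have hv0 : v x = 0 := by rw [hvx, hχ0]; ring
      have hdv0 : diffAt n v x = 0 := by rw [hdv x, hχ0]; simp
      have e1 : P.density u v x = 0 := by simp [density, hv0, hdv0]
      have e2 : P.density v v x = 0 := by simp [density, hv0, hdv0]
      rw [e1, e2, hχ0]
      have : 0 < Y x ^ s := Real.rpow_pos_of_pos (hY0 x) _
      constructor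
      · simp only [ne_eq, OfNat.ofNat_ne_zero, not_false_eq_true, zero_pow, zero_mul, zero_div,
          mul_zero, neg_zero, zero_add, add_zero]
        positivity
      · simp only [mul_zero, add_zero]
        positivity
  have iuv := P.integrable_density hu hvt
  have ivv := P.integrable_density hvt hvt
  have h1 := integral_mono_ae (iD.div_const 4) (((iuv.neg.add (iU.const_mul 4)).add
    (iL.const_mul 2)).add (iE.const_mul |C|)) (hpt.mono fun x hx => hx.1)
  have h2 := integral_mono_ae ivv (((iX.const_mul 8).add (iL.const_mul 8)).add (iK.const_mul |C|))
    (hpt.mono fun x hx => hx.2)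
  have e1 := integral_add' ((iuv.neg.add (iU.const_mul 4)).add (iL.const_mul 2)) (iE.const_mul |C|)
  have e2 := integral_add' (iuv.neg.add (iU.const_mul 4)) (iL.const_mul 2)
  have e3 := integral_add' iuv.neg (iU.const_mul 4)
  have e4 := integral_add' ((iX.const_mul 8).add (iL.const_mul 8)) (iK.const_mul |C|)
  have e5 := integral_add' (iX.const_mul 8) (iL.const_mul 8)
  rw [e1, e2, e3, integral_neg'] at h1
  rw [e4, e5] at h2
  simp only [integral_const_mul, integral_div] at h1 h2
  have e6 : ∫ x, P.density u v x ∂ν = P.form u v := rfl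
  have e7 : ∫ x, P.density v v x ∂ν = P.q v := rfl
  have e8 : ∫ x, K.indicator (fun _ => (1 : ℝ)) x ∂ν = k := by
    rw [integral_indicator hKm, setIntegral_const, smul_eq_mul, mul_one]
  rw [e6] at h1
  rw [e7, e8] at h2
  rw [integral_indicator hKm] at h1 h2
  have h3 := P.neg_form_le hP hu hvt
  have h4 := P.setIntegral_energy_div_le hP hK hu hψ hψ1
  have h5 : ∫ x in K, P.energy u u x / (1 + u x ^ 2) ∂ν ≤ L := by rw [hL]; linarith
  have e9 : ∫ x, (χ x ^ 2 + P.energy χ χ x) * (1 + u x ^ 2) ^ s ∂ν =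
      (∫ x, χ x ^ 2 * Y x ^ s ∂ν) + ∫ x, Y x ^ s * P.energy χ χ x ∂ν := by
    rw [← integral_add iE iU]
    congr 1
    ext x
    simp only [hY]
    ring
  rw [e9]
  have hE0 : 0 ≤ ∫ x, χ x ^ 2 * Y x ^ s ∂ν :=
    integral_nonneg fun x => mul_nonneg (sq_nonneg _) (Real.rpow_nonneg (hY0 x).le _)
  have hU0 : 0 ≤ ∫ x, Y x ^ s * P.energy χ χ x ∂ν :=
    integral_nonneg fun x => mul_nonneg (Real.rpow_nonneg (hY0 x).le _) (P.energy_self_nonneg χ x)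
  have hL0 : 0 ≤ L := by positivity
  set TE := ∫ x, χ x ^ 2 * Y x ^ s ∂ν
  set TU := ∫ x, Y x ^ s * P.energy χ χ x ∂ν
  have hCk : 0 ≤ |C| * k := by positivity
  have hC0 := abs_nonneg C
  have m1 : 0 ≤ (2 + 16 * X + 24 * L + 2 * (|C| * k)) * (TE + TU) := by positivity
  have m2 : 0 ≤ |C| * TU := by positivity
  linarith

end DivFormOperator

end Caccioppoli

/-! ### Coordinate balls -/

/-- A closed coordinate ball: a chart `φ` together with a closed ball in its target. The concentric
ball of twice the radius is also required to lie in the target, which leaves room for cutoffs. -/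
structure CoordBall (n : ℕ) (M : Type*) [TopologicalSpace M] [ChartedSpace (Euc n) M] where
  chart : OpenPartialHomeomorph M (Euc n)
  mem_atlas : chart ∈ atlas (Euc n) M
  center : Euc n
  radius : ℝ
  radius_pos : 0 < radius
  closedBall_subset : Metric.closedBall center (2 * radius) ⊆ chart.target

namespace CoordBall

variable {n : ℕ} {M : Type*} [TopologicalSpace M] [ChartedSpace (Euc n) M] (B : CoordBall n M)

/-- The closed ball, as a subset of `ℝⁿ`. -/
def ball : Set (Euc n) := Metric.closedBall B.center B.radius

/-- The closed coordinate ball, as a subset of the manifold. -/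
def carrier : Set M := B.chart.symm '' B.ball

/-- A cutoff function in the coordinates, equal to `1` near the closed ball. -/
def bump : ContDiffBump B.center where
  rIn := 3 / 2 * B.radius
  rOut := 2 * B.radius
  rIn_pos := by have := B.radius_pos; positivity
  rIn_lt_rOut := by have := B.radius_pos; linarith

/-- The function `u` in the coordinates, cut off to a function on `ℝⁿ` that agrees with `u` near
the closed ball. The cutoff vanishes off the target of the chart, so the values of the inverse chart
there do not matter. -/
def rep (u : M → ℝ) (z : Euc n) : ℝ := B.bump z * u (B.chart.symm z)

/-- A function on `ℝⁿ`, read on the manifold in the coordinates and extended by `0`. -/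
def pull (η : Euc n → ℝ) : M → ℝ := B.chart.source.indicator (η ∘ B.chart)

theorem ball_subset_target : B.ball ⊆ B.chart.target :=
  (Metric.closedBall_subset_closedBall (by have := B.radius_pos; linarith)).trans
    B.closedBall_subset

theorem isCompact_ball : IsCompact B.ball := isCompact_closedBall _ _

theorem measurableSet_ball : MeasurableSet B.ball := Metric.isClosed_closedBall.measurableSet

theorem isCompact_symm_image {s : Set (Euc n)} (hs : IsCompact s) (hst : s ⊆ B.chart.target) :
    IsCompact (B.chart.symm '' s) :=
  hs.image_of_continuousOn (B.chart.continuousOn_symm.mono hst)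

theorem isCompact_carrier : IsCompact B.carrier :=
  B.isCompact_symm_image B.isCompact_ball B.ball_subset_target

theorem carrier_subset_source : B.carrier ⊆ B.chart.source := by
  rintro _ ⟨z, hz, rfl⟩
  exact B.chart.map_target (B.ball_subset_target hz)

theorem chart_mem_ball {x : M} (hx : x ∈ B.carrier) : B.chart x ∈ B.ball := by
  obtain ⟨z, hz, rfl⟩ := hx
  rwa [B.chart.right_inv (B.ball_subset_target hz)]

theorem mem_carrier {x : M} (hx : x ∈ B.chart.source) (h : B.chart x ∈ B.ball) :
    x ∈ B.carrier :=
  ⟨_, h, B.chart.left_inv hx⟩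

theorem rep_eventuallyEq (u : M → ℝ) {z : Euc n} (hz : z ∈ B.ball) :
    B.rep u =ᶠ[𝓝 z] u ∘ B.chart.symm := by
  have hR := B.radius_pos
  have h : z ∈ Metric.ball B.center B.bump.rIn := by
    have := Metric.mem_closedBall.1 hz
    rw [Metric.mem_ball]
    show _ < 3 / 2 * B.radius
    linarith
  filter_upwards [B.bump.eventuallyEq_one_of_mem_ball h] with w hw
  simp [rep, hw]

theorem rep_eq (u : M → ℝ) {z : Euc n} (hz : z ∈ B.ball) : B.rep u z = u (B.chart.symm z) :=
  (B.rep_eventuallyEq u hz).self_of_nhds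

theorem rep_chart (u : M → ℝ) {x : M} (hx : x ∈ B.carrier) : B.rep u (B.chart x) = u x := by
  rw [B.rep_eq u (B.chart_mem_ball hx), B.chart.left_inv (B.carrier_subset_source hx)]

theorem rep_add (u v : M → ℝ) : B.rep (u + v) = B.rep u + B.rep v := by
  ext z; simp [rep, mul_add]

theorem rep_sub (u v : M → ℝ) : B.rep (u - v) = B.rep u - B.rep v := by
  ext z; simp [rep, mul_sub]

theorem rep_smul (t : ℝ) (u : M → ℝ) : B.rep (t • u) = t • B.rep u := by
  ext z; simp [rep, mul_left_comm]

theorem bump_eq_zero {z : Euc n} (hz : z ∉ Metric.closedBall B.center (2 * B.radius)) :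
    B.bump z = 0 := by
  refine B.bump.zero_of_le_dist ?_
  rw [Metric.mem_closedBall, not_le] at hz
  exact hz.le

variable (n) in
theorem exists_chart_eq_center (x₀ : M) : ∃ B : CoordBall n M, x₀ ∈ B.chart.source ∧
    B.chart x₀ = B.center := by
  set φ := chartAt (Euc n) x₀
  obtain ⟨r, hr, hsub⟩ := Metric.nhds_basis_closedBall.mem_iff.1
    (φ.open_target.mem_nhds (mem_chart_target (Euc n) x₀))
  exact ⟨⟨φ, chart_mem_atlas _ _, φ x₀, r / 2, by positivity, by
    rwa [mul_div_cancel₀ _ two_ne_zero]⟩, mem_chart_source _ _, rfl⟩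

/-- The shrunken coordinate ball. -/
def shrink {r : ℝ} (hr : 0 < r) (hrB : r ≤ B.radius) :
    CoordBall n M where
  chart := B.chart
  mem_atlas := B.mem_atlas
  center := B.center
  radius := r
  radius_pos := hr
  closedBall_subset := (Metric.closedBall_subset_closedBall (by linarith)).trans
    B.closedBall_subset

theorem shrink_ball_subset {r : ℝ} (hr : 0 < r)
    (hrB : r ≤ B.radius) : (B.shrink hr hrB).ball ⊆ B.ball :=
  Metric.closedBall_subset_closedBall hrB

theorem shrink_rep {r : ℝ} (hr : 0 < r)
    (hrB : r ≤ B.radius) (u : M → ℝ) {z : Euc n} (hz : z ∈ (B.shrink hr hrB).ball) :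
    (B.shrink hr hrB).rep u =ᶠ[𝓝 z] B.rep u :=
  ((B.shrink hr hrB).rep_eventuallyEq u hz).trans
    (B.rep_eventuallyEq u (B.shrink_ball_subset hr hrB hz)).symm

theorem carrier_mem_nhds {x₀ : M} (hx : x₀ ∈ B.chart.source)
    (h : B.chart x₀ = B.center) : B.carrier ∈ 𝓝 x₀ := by
  have h1 : B.chart ⁻¹' B.ball ∈ 𝓝 x₀ := by
    refine (B.chart.continuousAt hx).preimage_mem_nhds ?_
    rw [h]
    exact Metric.closedBall_mem_nhds _ B.radius_pos
  filter_upwards [h1, B.chart.open_source.mem_nhds hx] with x hx1 hx2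
  exact B.mem_carrier hx2 hx1

theorem shrink_carrier_subset {r : ℝ} (hr : 0 < r) (hrB : r ≤ B.radius) :
    (B.shrink hr hrB).carrier ⊆ B.carrier :=
  image_mono (B.shrink_ball_subset hr hrB)

variable [IsManifold 𝓘(ℝ, Euc n) ∞ M]

theorem contDiff_rep {u : M → ℝ} (hu : u ∈ TestFn n M) : ContDiff ℝ ∞ (B.rep u) := by
  rw [contDiff_iff_contDiffAt]
  intro z
  by_cases hz : z ∈ B.chart.target
  · have h1 : ContMDiffOn 𝓘(ℝ, Euc n) 𝓘(ℝ, Euc n) ∞ B.chart.symm B.chart.target :=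
      contMDiffOn_symm_of_mem_maximalAtlas (IsManifold.subset_maximalAtlas B.mem_atlas)
    have h2 : ContDiffOn ℝ ∞ (u ∘ B.chart.symm) B.chart.target := by
      rw [← contMDiffOn_iff_contDiffOn]
      exact hu.1.comp_contMDiffOn h1
    exact B.bump.contDiff.contDiffAt.mul (h2.contDiffAt (B.chart.open_target.mem_nhds hz))
  · have hz' : z ∉ Metric.closedBall B.center (2 * B.radius) := fun h =>
      hz (B.closedBall_subset h)
    have h : B.rep u =ᶠ[𝓝 z] fun _ => 0 := by
      filter_upwards [Metric.isClosed_closedBall.isOpen_compl.mem_nhds hz'] with w hw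
      simp [rep, B.bump_eq_zero hw]
    exact contDiffAt_const.congr_of_eventuallyEq h

theorem continuous_fderiv_rep {u : M → ℝ} (hu : u ∈ TestFn n M) :
    Continuous (fderiv ℝ (B.rep u)) :=
  (B.contDiff_rep hu).continuous_fderiv (by simp)

theorem diffAt_eq_rep [MeasurableSpace M] {u : M → ℝ} (hu : u ∈ TestFn n M) {x : M}
    (hx : x ∈ B.carrier) :
    diffAt n u x = chartCovector n B.chart x (fderiv ℝ (B.rep u) (B.chart x)) := by
  rw [diffAt_eq_chartCovector B.mem_atlas hu (B.carrier_subset_source hx),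
    (B.rep_eventuallyEq u (B.chart_mem_ball hx)).fderiv_eq]

theorem testFn_pull [T2Space M] {η : Euc n → ℝ} (hη : ContDiff ℝ ∞ η)
    (h0 : ∀ z ∉ Metric.closedBall B.center (2 * B.radius), η z = 0) : B.pull η ∈ TestFn n M := by
  set K := B.chart.symm '' Metric.closedBall B.center (2 * B.radius) with hK
  have hKc : IsCompact K := B.isCompact_symm_image (isCompact_closedBall _ _) B.closedBall_subset
  have hzero : ∀ x ∉ K, B.pull η x = 0 := by
    intro x hx
    by_cases hxs : x ∈ B.chart.source
    · rw [pull, indicator_of_mem hxs]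
      exact h0 _ fun h => hx ⟨_, h, B.chart.left_inv hxs⟩
    · rw [pull, indicator_of_notMem hxs]
  refine ⟨fun x => ?_, HasCompactSupport.intro hKc hzero⟩
  by_cases hxs : x ∈ B.chart.source
  · have h1 : ContMDiffOn 𝓘(ℝ, Euc n) 𝓘(ℝ, Euc n) ∞ B.chart B.chart.source :=
      contMDiffOn_of_mem_maximalAtlas (IsManifold.subset_maximalAtlas B.mem_atlas)
    have h2 := hη.contMDiff.comp_contMDiffOn h1
    refine (h2.contMDiffAt (B.chart.open_source.mem_nhds hxs)).congr_of_eventuallyEq ?_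
    filter_upwards [B.chart.open_source.mem_nhds hxs] with w hw
    rw [pull, indicator_of_mem hw]
  · have hxK : x ∉ K := by
      rintro ⟨z, hz, rfl⟩
      exact hxs (B.chart.map_target (B.closedBall_subset hz))
    refine (contMDiffAt_const (c := (0 : ℝ))).congr_of_eventuallyEq ?_
    filter_upwards [hKc.isClosed.isOpen_compl.mem_nhds hxK] with w hw using hzero w hw

theorem pull_apply (η : Euc n → ℝ) {x : M} (hx : x ∈ B.chart.source) :
    B.pull η x = η (B.chart x) := by
  rw [pull, indicator_of_mem hx]; rfl

theorem pull_eq_zero {η : Euc n → ℝ} (h0 : ∀ z ∉ B.ball, η z = 0) {x : M} (hx : x ∉ B.carrier) :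
    B.pull η x = 0 := by
  by_cases hxs : x ∈ B.chart.source
  · rw [B.pull_apply η hxs]
    exact h0 _ fun h => hx (B.mem_carrier hxs h)
  · rw [pull, indicator_of_notMem hxs]

theorem diffAt_pull [T2Space M] [MeasurableSpace M] {η : Euc n → ℝ} (hη : ContDiff ℝ ∞ η)
    (h0 : ∀ z ∉ Metric.closedBall B.center (2 * B.radius), η z = 0) {x : M}
    (hx : x ∈ B.chart.source) :
    diffAt n (B.pull η) x = chartCovector n B.chart x (fderiv ℝ η (B.chart x)) := by
  rw [diffAt_eq_chartCovector B.mem_atlas (B.testFn_pull hη h0) hx]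
  congr 1
  refine Filter.EventuallyEq.fderiv_eq ?_
  filter_upwards [B.chart.open_target.mem_nhds (B.chart.map_source hx)] with w hw
  simp [pull_apply, B.chart.map_target hw, B.chart.right_inv hw]

section Measure

variable [T2Space M] [MeasurableSpace M] [BorelSpace M] {ν : Measure M} [IsLocallyLebesgue n ν]

theorem measurableSet_carrier : MeasurableSet B.carrier :=
  B.isCompact_carrier.isClosed.measurableSet

theorem aemeasurable_chart : AEMeasurable B.chart (ν.restrict B.carrier) :=
  (B.chart.continuousOn.mono B.carrier_subset_source).aemeasurable B.measurableSet_carrier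

variable (ν) in
/-- In the coordinates `ν` is comparable to Lebesgue measure on the ball. -/
theorem exists_measure_bounds : ∃ a b : ℝ≥0, 0 < a ∧ 0 < b ∧
    a • volume.restrict B.ball ≤ (ν.restrict B.carrier).map B.chart ∧
    (ν.restrict B.carrier).map B.chart ≤ b • volume.restrict B.ball := by
  obtain ⟨a, b, ha, h⟩ := IsLocallyLebesgue.bounds (n := n) (ν := ν) _ B.mem_atlas _
    B.isCompact_carrier B.carrier_subset_source
  have hcont := B.chart.continuousOn.mono B.carrier_subset_source
  have key : ∀ s, MeasurableSet s → a * volume (s ∩ B.ball) ≤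
      (ν.restrict B.carrier).map B.chart s ∧
      (ν.restrict B.carrier).map B.chart s ≤ b * volume (s ∩ B.ball) := by
    intro s hs
    rw [Measure.map_apply_of_aemeasurable B.aemeasurable_chart hs,
      Measure.restrict_apply' B.measurableSet_carrier]
    have hm : MeasurableSet (B.chart ⁻¹' s ∩ B.carrier) := by
      obtain ⟨g, hg⟩ : ∃ g : M → Euc n, Measurable g ∧ ∀ x ∈ B.carrier, g x = B.chart x := by
        classical
        exact ⟨B.carrier.piecewise B.chart fun _ => 0,
          hcont.measurable_piecewise continuousOn_const B.measurableSet_carrier,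
          fun x hx => piecewise_eq_of_mem _ _ _ hx⟩
      have : B.chart ⁻¹' s ∩ B.carrier = g ⁻¹' s ∩ B.carrier := by
        ext x
        simp only [mem_inter_iff, mem_preimage]
        exact and_congr_left fun hx => by rw [hg.2 x hx]
      rw [this]
      exact (hg.1 hs).inter B.measurableSet_carrier
    have himg : B.chart '' (B.chart ⁻¹' s ∩ B.carrier) = s ∩ B.ball := by
      ext z
      constructor
      · rintro ⟨x, ⟨hx, hxc⟩, rfl⟩
        exact ⟨hx, B.chart_mem_ball hxc⟩
      · rintro ⟨hz, hzb⟩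
        have e := B.chart.right_inv (B.ball_subset_target hzb)
        exact ⟨B.chart.symm z, ⟨by rwa [mem_preimage, e], ⟨z, hzb, rfl⟩⟩, e⟩
    have := h _ inter_subset_right hm
    rwa [himg] at this
  refine ⟨a, b + 1, ha, by positivity, ?_, ?_⟩
  · refine Measure.le_intro fun s hs _ => ?_
    rw [Measure.smul_apply, Measure.restrict_apply hs]
    exact (key s hs).1
  · refine Measure.le_intro fun s hs _ => (key s hs).2.trans ?_
    rw [Measure.smul_apply, Measure.restrict_apply hs]
    show _ ≤ ((b + 1 : ℝ≥0) : ℝ≥0∞) * _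
    gcongr
    simp

variable (ν) in
/-- Integration in the coordinates is comparable to integration with respect to `ν`. -/
theorem exists_integral_bounds : ∃ a b : ℝ, 0 < a ∧ 0 < b ∧
    (∀ s : Set (Euc n), MeasurableSet s → ENNReal.ofReal a * volume (B.ball ∩ s) ≤
      ν (B.carrier ∩ B.chart ⁻¹' s)) ∧
    (∀ (F : Euc n → ℝ) (G : M → ℝ), Continuous F → (∀ z, 0 ≤ F z) → Integrable G ν →
      (∀ x, 0 ≤ G x) → (∀ᵐ x ∂ν, x ∈ B.carrier → F (B.chart x) ≤ G x) →
      a * ∫ z in B.ball, F z ≤ ∫ x, G x ∂ν) ∧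
    ∀ (F : Euc n → ℝ) (G : M → ℝ), Continuous F → (∀ z, 0 ≤ F z) → Integrable G ν →
      (∀ᵐ x ∂ν, x ∈ B.carrier → G x ≤ F (B.chart x)) → (∀ x ∉ B.carrier, G x ≤ 0) →
      ∫ x, G x ∂ν ≤ b * ∫ z in B.ball, F z := by
  obtain ⟨a, b, ha, hb, h1, h2⟩ := B.exists_measure_bounds ν
  set μ := (ν.restrict B.carrier).map B.chart with hμ
  have hcm := B.measurableSet_carrier
  have hFint : ∀ F : Euc n → ℝ, Continuous F → IntegrableOn F B.ball := fun F hF =>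
    hF.continuousOn.integrableOn_compact B.isCompact_ball
  have hFμ : ∀ F : Euc n → ℝ, Continuous F → Integrable F μ := fun F hF =>
    ((hFint F hF).smul_measure_nnreal).mono_measure h2
  have hmap : ∀ F : Euc n → ℝ, Continuous F → ∫ z, F z ∂μ =
      ∫ x in B.carrier, F (B.chart x) ∂ν := fun F hF =>
    integral_map B.aemeasurable_chart hF.aestronglyMeasurable
  have hFM : ∀ F : Euc n → ℝ, Continuous F →
      IntegrableOn (fun x => F (B.chart x)) B.carrier ν := fun F hF =>
    (hFμ F hF).comp_aemeasurable B.aemeasurable_chart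
  refine ⟨a, b, by exact_mod_cast ha, by exact_mod_cast hb, ?_, ?_, ?_⟩
  · intro s hs
    have := h1 s
    rw [Measure.smul_apply, Measure.restrict_apply hs, hμ,
      Measure.map_apply_of_aemeasurable B.aemeasurable_chart hs,
      Measure.restrict_apply' hcm, inter_comm s, inter_comm _ B.carrier] at this
    rw [ENNReal.ofReal_coe_nnreal]
    exact this
  · intro F G hF hF0 hG hG0 hFG
    calc a * ∫ z in B.ball, F z = ∫ z, F z ∂(a • volume.restrict B.ball) := by
          rw [integral_smul_nnreal_measure]; rfl
      _ ≤ ∫ z, F z ∂μ := integral_mono_measure h1 (Eventually.of_forall hF0) (hFμ F hF)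
      _ = ∫ x in B.carrier, F (B.chart x) ∂ν := hmap F hF
      _ ≤ ∫ x in B.carrier, G x ∂ν := by
          refine setIntegral_mono_on_ae (hFM F hF) hG.integrableOn hcm hFG
      _ ≤ ∫ x, G x ∂ν := setIntegral_le_integral hG (Eventually.of_forall hG0)
  · intro F G hF hF0 hG hGF hG0
    have e : ∫ x, G x ∂ν ≤ ∫ x, B.carrier.indicator G x ∂ν := by
      refine integral_mono hG (hG.indicator hcm) fun x => ?_
      by_cases hx : x ∈ B.carrier
      · rw [indicator_of_mem hx]
      · rw [indicator_of_notMem hx]; exact hG0 x hx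
    rw [integral_indicator hcm] at e
    calc ∫ x, G x ∂ν ≤ ∫ x in B.carrier, G x ∂ν := e
      _ ≤ ∫ x in B.carrier, F (B.chart x) ∂ν :=
          setIntegral_mono_on_ae hG.integrableOn (hFM F hF) hcm hGF
      _ = ∫ z, F z ∂μ := (hmap F hF).symm
      _ ≤ ∫ z, F z ∂(b • volume.restrict B.ball) :=
          integral_mono_measure h2 (Eventually.of_forall hF0) ((hFint F hF).smul_measure_nnreal)
      _ = b * ∫ z in B.ball, F z := by rw [integral_smul_nnreal_measure]; rfl

theorem exists_elliptic (P : DivFormOperator n M ν) : ∃ θ Θ : ℝ, 0 < θ ∧ 0 < Θ ∧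
    ∀ᵐ x ∂ν, x ∈ B.carrier → ∀ ξ : Euc n →L[ℝ] ℝ,
      θ * ‖ξ‖ ^ 2 ≤ chartCovector n B.chart x ξ (P.A x (chartCovector n B.chart x ξ)) ∧
      chartCovector n B.chart x ξ (P.A x (chartCovector n B.chart x ξ)) ≤ Θ * ‖ξ‖ ^ 2 := by
  obtain ⟨θ, Θ, hθ, h⟩ := P.elliptic _ B.mem_atlas _ B.isCompact_carrier B.carrier_subset_source
  refine ⟨θ, |Θ| + 1, hθ, by positivity, ?_⟩
  filter_upwards [h] with x hx hxB ξ
  refine ⟨(hx hxB ξ).1, (hx hxB ξ).2.trans ?_⟩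
  gcongr
  exact (le_abs_self Θ).trans (by linarith)

end Measure

end CoordBall

/-- Radial cutoffs between concentric balls, with the gradient bounded by the inverse of the gap.
The constant does not depend on the radii. -/
theorem exists_cutoff_bound : ∃ L : ℝ, 0 ≤ L ∧ ∀ (n : ℕ) (y : Euc n) (a b : ℝ), 0 < a → a < b →
    ∃ η : Euc n → ℝ, ContDiff ℝ ∞ η ∧ (∀ z, 0 ≤ η z) ∧ (∀ z, η z ≤ 1) ∧
      (∀ z ∈ Metric.closedBall y a, η z = 1) ∧ (∀ z ∉ Metric.ball y b, η z = 0) ∧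
      (∀ z ∉ Metric.closedBall y b, fderiv ℝ η z = 0) ∧ ∀ z, ‖fderiv ℝ η z‖ ≤ L / (b - a) := by
  obtain ⟨L, hL⟩ : ∃ L : ℝ, ∀ t : ℝ, ‖deriv Real.smoothTransition t‖ ≤ L := by
    have hc : Continuous (deriv Real.smoothTransition) :=
      (Real.smoothTransition.contDiff (n := 1)).continuous_deriv le_rfl
    obtain ⟨L, hL⟩ := (isCompact_Icc (a := (0 : ℝ)) (b := 1)).exists_bound_of_continuousOn
      hc.continuousOn
    refine ⟨L, fun t => ?_⟩
    by_cases ht : t ∈ Icc (0 : ℝ) 1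
    · exact hL t ht
    have hL0 : 0 ≤ L := (norm_nonneg _).trans (hL 0 (by simp))
    rw [mem_Icc, not_and_or, not_le, not_le] at ht
    have : ∃ c : ℝ, Real.smoothTransition =ᶠ[𝓝 t] fun _ => c := by
      rcases ht with ht | ht
      · refine ⟨0, ?_⟩
        filter_upwards [Iio_mem_nhds ht] with s hs using Real.smoothTransition.zero_of_nonpos hs.le
      · refine ⟨1, ?_⟩
        filter_upwards [Ioi_mem_nhds ht] with s hs using Real.smoothTransition.one_of_one_le hs.le
    obtain ⟨c, hc⟩ := this
    rw [hc.deriv_eq]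
    simpa using hL0
  have hL0 : 0 ≤ L := (norm_nonneg _).trans (hL 0)
  refine ⟨2 * L, by positivity, fun n y a b ha hab => ?_⟩
  have hb : 0 < b := ha.trans hab
  have hd : 0 < b ^ 2 - a ^ 2 := by nlinarith
  set p : Euc n → ℝ := fun z => (b ^ 2 - ‖z - y‖ ^ 2) / (b ^ 2 - a ^ 2) with hp
  have hp0 : ∀ z ∉ Metric.ball y b, p z ≤ 0 := by
    intro z hz
    rw [Metric.mem_ball, not_lt, dist_eq_norm] at hz
    refine div_nonpos_of_nonpos_of_nonneg ?_ hd.le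
    have : b ^ 2 ≤ ‖z - y‖ ^ 2 := by gcongr
    linarith
  have hpd : ∀ z,
      HasFDerivAt p ((b ^ 2 - a ^ 2)⁻¹ • -((2 : ℕ) • innerSL ℝ (z - y)) : Euc n →L[ℝ] ℝ) z := by
    intro z
    have h1 : HasFDerivAt (fun z : Euc n => ‖z - y‖ ^ 2) (2 • innerSL ℝ (z - y)) z := by
      simpa using ((hasFDerivAt_id z).sub_const y).norm_sq
    have h2 := (h1.const_sub (b ^ 2)).const_mul ((b ^ 2 - a ^ 2)⁻¹)
    refine h2.congr_of_eventuallyEq (Eventually.of_forall fun w => ?_)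
    simp only [hp]
    rw [div_eq_inv_mul]
  have hzero : ∀ z ∉ Metric.closedBall y b,
      (fun z => Real.smoothTransition (p z)) =ᶠ[𝓝 z] fun _ => 0 := by
    intro z hz
    filter_upwards [Metric.isClosed_closedBall.isOpen_compl.mem_nhds hz] with w hw
    exact Real.smoothTransition.zero_of_nonpos
      (hp0 w fun h => hw (Metric.ball_subset_closedBall h))
  have hfz : ∀ z ∉ Metric.closedBall y b,
      fderiv ℝ (fun z => Real.smoothTransition (p z)) z = 0 := by
    intro z hz
    rw [(hzero z hz).fderiv_eq]
    simp
  refine ⟨fun z => Real.smoothTransition (p z), ?_, fun z => Real.smoothTransition.nonneg _,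
    fun z => Real.smoothTransition.le_one _, ?_, ?_, hfz, ?_⟩
  · refine Real.smoothTransition.contDiff.comp ?_
    exact (contDiff_const.sub ((contDiff_id.sub contDiff_const).norm_sq ℝ)).div_const _
  · intro z hz
    refine Real.smoothTransition.one_of_one_le ?_
    rw [Metric.mem_closedBall, dist_eq_norm] at hz
    rw [one_le_div hd]
    have : ‖z - y‖ ^ 2 ≤ a ^ 2 := by gcongr
    linarith
  · intro z hz
    exact Real.smoothTransition.zero_of_nonpos (hp0 z hz)
  · intro z
    by_cases hz : z ∈ Metric.closedBall y b
    · have h1 : HasDerivAt Real.smoothTransition (deriv Real.smoothTransition (p z)) (p z) :=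
        ((Real.smoothTransition.contDiffAt (n := 1)).differentiableAt (by simp)).hasDerivAt
      have h2 := h1.comp_hasFDerivAt z (hpd z)
      have h3 := h2.fderiv
      have e : Real.smoothTransition ∘ p = fun z => Real.smoothTransition (p z) := rfl
      rw [e] at h3
      rw [h3, norm_smul, norm_smul, norm_neg, ← Nat.cast_smul_eq_nsmul ℝ, norm_smul,
        innerSL_apply_norm]
      rw [Metric.mem_closedBall, dist_eq_norm] at hz
      have h4 : ‖(b ^ 2 - a ^ 2)⁻¹‖ * (‖((2 : ℕ) : ℝ)‖ * ‖z - y‖) ≤ 2 / (b - a) := by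
        rw [norm_inv, Real.norm_of_nonneg hd.le, inv_mul_eq_div, div_le_div_iff₀ hd (by linarith)]
        norm_num
        have : 0 < b - a := by linarith
        have h5 : ‖z - y‖ * (b - a) ≤ (b + a) * (b - a) := by gcongr; linarith
        linarith
      calc _ ≤ L * (2 / (b - a)) := by gcongr; exact hL _
        _ = _ := by ring
    · rw [hfz z hz, norm_zero]
      have : 0 < b - a := by linarith
      positivity

/-! ### The quadratic form controls the local `H¹` norm -/

section LocalBound

variable {n : ℕ} {M : Type*} [TopologicalSpace M] [ChartedSpace (Euc n) M]
  [MeasurableSpace M] {ν : Measure M}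
  [T2Space M] [BorelSpace M] [IsManifold 𝓘(ℝ, Euc n) ∞ M] [IsLocallyLebesgue n ν]

namespace CoordBall

variable (P : DivFormOperator n M ν) (B : CoordBall n M)

theorem exists_energy_bounds : ∃ θ Θ : ℝ, 0 < θ ∧ 0 < Θ ∧
    ∀ᵐ x ∂ν, x ∈ B.carrier → ∀ (u : M → ℝ) (ξ : Euc n →L[ℝ] ℝ),
      diffAt n u x = chartCovector n B.chart x ξ →
      θ * ‖ξ‖ ^ 2 ≤ P.energy u u x ∧ P.energy u u x ≤ Θ * ‖ξ‖ ^ 2 := by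
  obtain ⟨θ, Θ, hθ, hΘ, h⟩ := B.exists_elliptic P
  refine ⟨θ, Θ, hθ, hΘ, ?_⟩
  filter_upwards [h] with x hx hxB u ξ hu
  rw [DivFormOperator.energy, hu]
  exact hx hxB ξ

theorem eq_zero_of_notMem_closedBall_two_mul {η : Euc n → ℝ} (h0 : ∀ z ∉ B.ball, η z = 0) :
    ∀ z ∉ Metric.closedBall B.center (2 * B.radius), η z = 0 := fun z hz =>
  h0 z fun h => hz (Metric.closedBall_subset_closedBall (by have := B.radius_pos; linarith) h)

/-- The Caccioppoli inequality on concentric coordinate balls. -/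
theorem exists_setIntegral_fderiv_sq_le (hP : P.Nonneg) : ∃ A : ℝ, 0 ≤ A ∧ ∀ u ∈ TestFn n M,
    ∀ a b : ℝ, 0 < a → a < b → b ≤ B.radius →
    ∫ z in Metric.closedBall B.center a, ‖fderiv ℝ (B.rep u) z‖ ^ 2 ≤
      A * (P.q u + ((b - a) ^ 2)⁻¹ * ∫ z in Metric.closedBall B.center b, B.rep u z ^ 2) := by
  have hloc : IsLocallyFiniteMeasure ν := isLocallyFinite_of_isLocallyLebesgue (n := n)
  obtain ⟨L, hL0, hL⟩ := exists_cutoff_bound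
  obtain ⟨α, β, hα, hβ, -, hlow, hup⟩ := B.exists_integral_bounds ν
  obtain ⟨θ, Θ, hθ, hΘ, hE⟩ := B.exists_energy_bounds P
  obtain ⟨C, hC⟩ := P.bdd_c _ B.isCompact_carrier
  set N := 7 * (β * (Θ * L ^ 2)) + 6 * |C| * (β * B.radius ^ 2) with hN
  have hN0 : 0 ≤ N := by positivity
  refine ⟨(11 + N) / (α * θ), by positivity, fun u hu a b ha hab hbR => ?_⟩
  obtain ⟨η, hη, hη0, hη1, hηa, hηb, hdηb, hdη⟩ := hL n B.center a b ha hab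
  have hba : 0 < b - a := by linarith
  have hηB : ∀ z ∉ B.ball, η z = 0 := fun z hz => hηb z fun h => hz
    (Metric.ball_subset_closedBall (Metric.ball_subset_ball hbR h))
  have hη2 := B.eq_zero_of_notMem_closedBall_two_mul hηB
  have hχ : B.pull η ∈ TestFn n M := B.testFn_pull hη hη2
  set χ := B.pull η with hχdef
  have hχK : ∀ x, x ∉ B.carrier → χ x = 0 := fun x hx => B.pull_eq_zero hηB hx
  have hχe : ∀ x ∈ B.carrier, χ x = η (B.chart x) := fun x hx =>
    B.pull_apply η (B.carrier_subset_source hx)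
  have hχd : ∀ x ∈ B.carrier, diffAt n χ x =
      chartCovector n B.chart x (fderiv ℝ η (B.chart x)) := fun x hx =>
    B.diffAt_pull hη hη2 (B.carrier_subset_source hx)
  have hχ1 : ∀ x, |χ x| ≤ 1 := by
    intro x
    by_cases hx : x ∈ B.carrier
    · rw [hχe x hx, abs_of_nonneg (hη0 _)]; exact hη1 _
    · rw [hχK x hx]; simp
  have hχdt : ∀ x ∉ B.carrier, P.energy χ χ x = 0 := by
    intro x hx
    have : diffAt n χ x = 0 := by
      refine diffAt_eq_zero fun h => hx ?_
      refine (closure_minimal ?_ B.isCompact_carrier.isClosed) h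
      intro w hw
      by_contra hwK
      exact hw (hχK w hwK)
    rw [DivFormOperator.energy, this]; simp
  have h1 := P.integral_sq_mul_energy_le hP hC hu hχ hχ1 hχK
  set f := B.rep u with hf
  have hfc : Continuous f := (B.contDiff_rep hu).continuous
  have hfd : Continuous (fderiv ℝ f) := B.continuous_fderiv_rep hu
  have hηc := hη.continuous
  have hηd : Continuous (fderiv ℝ η) := hη.continuous_fderiv (by simp)
  have huc := hu.1.continuous
  have hχc := hχ.1.continuous
  have hr : ∀ x ∈ B.carrier, f (B.chart x) = u x := fun x hx => B.rep_chart u hx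
  have l1 : α * ∫ z in B.ball, θ * (η z ^ 2 * ‖fderiv ℝ f z‖ ^ 2) ≤
      ∫ x, χ x ^ 2 * P.energy u u x ∂ν := by
    refine hlow _ _ (by fun_prop) (fun z => by positivity)
      (P.integrable_continuous_mul_energy hu hu (by fun_prop))
      (fun x => mul_nonneg (sq_nonneg _) (P.energy_self_nonneg u x)) ?_
    filter_upwards [hE] with x hx hxB
    rw [hχe x hxB]
    have := mul_le_mul_of_nonneg_left (hx hxB u _ (B.diffAt_eq_rep hu hxB)).1
      (sq_nonneg (η (B.chart x)))
    linarith
  have l2 : ∫ x, u x ^ 2 * P.energy χ χ x ∂ν ≤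
      β * ∫ z in B.ball, f z ^ 2 * (Θ * ‖fderiv ℝ η z‖ ^ 2) := by
    refine hup _ _ (by fun_prop) (fun z => by positivity)
      (P.integrable_continuous_mul_energy hχ hχ (by fun_prop)) ?_ ?_
    · filter_upwards [hE] with x hx hxB
      rw [hr x hxB]
      exact mul_le_mul_of_nonneg_left (hx hxB χ _ (hχd x hxB)).2 (sq_nonneg _)
    · intro x hx
      rw [hχdt x hx, mul_zero]
  have l3 : ∫ x, χ x ^ 2 * u x ^ 2 ∂ν ≤ β * ∫ z in B.ball, η z ^ 2 * f z ^ 2 := by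
    refine hup _ _ (by fun_prop) (fun z => by positivity) ?_ ?_ ?_
    · have hs : HasCompactSupport fun x => u x ^ 2 :=
        hu.2.comp_left (g := fun a : ℝ => a ^ 2) (by simp)
      exact ((hχc.pow 2).mul (huc.pow 2)).integrable_of_hasCompactSupport hs.mul_left
    · refine Eventually.of_forall fun x hxB => ?_
      rw [hr x hxB, hχe x hxB]
    · intro x hx
      rw [hχK x hx]; simp
  set I := ∫ z in Metric.closedBall B.center b, f z ^ 2 with hI
  have hbsub : Metric.closedBall B.center b ⊆ B.ball := Metric.closedBall_subset_closedBall hbR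
  have hint : ∀ (F : Euc n → ℝ) (ρ : ℝ), Continuous F →
      IntegrableOn F (Metric.closedBall B.center ρ) := fun F ρ hF =>
    hF.continuousOn.integrableOn_compact (isCompact_closedBall _ _)
  -- integrands vanishing off the ball of radius `b` are bounded by multiples of `f²`
  have hred : ∀ (g : Euc n → ℝ) (c : ℝ), Continuous g → (∀ z, g z ≤ c * f z ^ 2) →
      (∀ z ∉ Metric.closedBall B.center b, g z = 0) → ∫ z in B.ball, g z ≤ c * I := by
    intro g c hg hgc hg0
    rw [setIntegral_eq_of_subset_of_forall_sdiff_eq_zero B.measurableSet_ball hbsub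
      (fun z hz => hg0 z hz.2), hI, ← integral_const_mul]
    exact integral_mono (hint g b hg) (hint _ b (by fun_prop)) hgc
  have m2 : ∫ z in B.ball, f z ^ 2 * (Θ * ‖fderiv ℝ η z‖ ^ 2) ≤
      (Θ * L ^ 2 * ((b - a) ^ 2)⁻¹) * I := by
    refine hred _ _ (by fun_prop) (fun z => ?_) fun z hz => by rw [hdηb z hz]; simp
    have : ‖fderiv ℝ η z‖ ^ 2 ≤ (L / (b - a)) ^ 2 := by gcongr; exact hdη z
    calc f z ^ 2 * (Θ * ‖fderiv ℝ η z‖ ^ 2) ≤ f z ^ 2 * (Θ * (L / (b - a)) ^ 2) := by gcongr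
      _ = _ := by rw [div_pow]; ring
  have m3 : ∫ z in B.ball, η z ^ 2 * f z ^ 2 ≤ (B.radius ^ 2 * ((b - a) ^ 2)⁻¹) * I := by
    refine hred _ _ (by fun_prop) (fun z => ?_) fun z hz => by
      rw [hηb z fun h => hz (Metric.ball_subset_closedBall h)]; simp
    have h2 : 1 ≤ B.radius ^ 2 * ((b - a) ^ 2)⁻¹ := by
      rw [← div_eq_mul_inv, one_le_div (by positivity)]
      gcongr
      linarith
    have h3 : η z ^ 2 ≤ 1 := pow_le_one₀ (hη0 z) (hη1 z)
    exact mul_le_mul_of_nonneg_right (h3.trans h2) (sq_nonneg _)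
  have m1 : ∫ z in Metric.closedBall B.center a, ‖fderiv ℝ f z‖ ^ 2 ≤
      ∫ z in B.ball, η z ^ 2 * ‖fderiv ℝ f z‖ ^ 2 := by
    have hab' : Metric.closedBall B.center a ⊆ B.ball :=
      Metric.closedBall_subset_closedBall (hab.le.trans hbR)
    calc ∫ z in Metric.closedBall B.center a, ‖fderiv ℝ f z‖ ^ 2 =
          ∫ z in Metric.closedBall B.center a, η z ^ 2 * ‖fderiv ℝ f z‖ ^ 2 := by
          refine setIntegral_congr_fun Metric.isClosed_closedBall.measurableSet fun z hz => ?_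
          simp only [hηa z hz, one_pow, one_mul]
      _ ≤ _ := setIntegral_mono_set (hint _ _ (by fun_prop))
          (Eventually.of_forall fun z => by positivity) (LE.le.eventuallyLE hab')
  rw [integral_const_mul] at l1
  rw [div_mul_eq_mul_div, le_div_iff₀ (by positivity)]
  have hq := hP u hu
  set J := ((b - a) ^ 2)⁻¹ with hJ
  have hJ0 : 0 ≤ J := by positivity
  have hI0 : 0 ≤ I := integral_nonneg fun z => sq_nonneg _
  set Z := ∫ z in Metric.closedBall B.center a, ‖fderiv ℝ f z‖ ^ 2 with hZ
  have k1 : Z * (α * θ) ≤ ∫ x, χ x ^ 2 * P.energy u u x ∂ν := by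
    refine le_trans ?_ l1
    have := mul_le_mul_of_nonneg_left m1 (by positivity : 0 ≤ α * θ)
    linarith
  have k2 := l2.trans (mul_le_mul_of_nonneg_left m2 hβ.le)
  have k3 := mul_le_mul_of_nonneg_left (l3.trans (mul_le_mul_of_nonneg_left m3 hβ.le))
    (by positivity : 0 ≤ 6 * |C|)
  have k4 : 0 ≤ 11 * (J * I) := by positivity
  have k5 : 0 ≤ N * P.q u := by positivity
  calc Z * (α * θ) ≤ 11 * P.q u + N * (J * I) := by rw [hN]; linarith
    _ ≤ (11 + N) * (P.q u + J * I) := by linarith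

/-- The Caccioppoli inequality for small powers, in the coordinates. -/
theorem exists_integral_rpow_mul_fderiv_sq_le (hP : P.Nonneg) {η : Euc n → ℝ}
    (hη : ContDiff ℝ ∞ η) (hη0 : ∀ z, 0 ≤ η z) (hη1 : ∀ z, η z ≤ 1)
    (hηB : ∀ z ∉ B.ball, η z = 0) : ∃ A : ℝ, 0 ≤ A ∧ ∀ u ∈ TestFn n M, P.q u ≤ 1 →
    ∀ s : ℝ, 0 < s → s ≤ 1 / 4 →
      ∫ z, η z ^ 2 * ((1 + B.rep u z ^ 2) ^ (s - 1) * ‖fderiv ℝ (B.rep u) z‖ ^ 2) ≤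
        A * (1 + ∫ z, (η z ^ 2 + ‖fderiv ℝ η z‖ ^ 2) * (1 + B.rep u z ^ 2) ^ s) := by
  have hloc : IsLocallyFiniteMeasure ν := isLocallyFinite_of_isLocallyLebesgue (n := n)
  obtain ⟨α, β, hα, hβ, -, hlow, hup⟩ := B.exists_integral_bounds ν
  obtain ⟨θ, Θ, hθ, hΘ, hE⟩ := B.exists_energy_bounds P
  have hη2 := B.eq_zero_of_notMem_closedBall_two_mul hηB
  have hχ : B.pull η ∈ TestFn n M := B.testFn_pull hη hη2
  set χ := B.pull η with hχdef
  have hχK : ∀ x, x ∉ B.carrier → χ x = 0 := fun x hx => B.pull_eq_zero hηB hx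
  have hχe : ∀ x ∈ B.carrier, χ x = η (B.chart x) := fun x hx =>
    B.pull_apply η (B.carrier_subset_source hx)
  have hχd : ∀ x ∈ B.carrier, diffAt n χ x =
      chartCovector n B.chart x (fderiv ℝ η (B.chart x)) := fun x hx =>
    B.diffAt_pull hη hη2 (B.carrier_subset_source hx)
  have hχ1 : ∀ x, |χ x| ≤ 1 := by
    intro x
    by_cases hx : x ∈ B.carrier
    · rw [hχe x hx, abs_of_nonneg (hη0 _)]; exact hη1 _
    · rw [hχK x hx]; simp
  have hχdt : ∀ x ∉ B.carrier, P.energy χ χ x = 0 := by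
    intro x hx
    have : diffAt n χ x = 0 := by
      refine diffAt_eq_zero fun h => hx ?_
      refine (closure_minimal ?_ B.isCompact_carrier.isClosed) h
      intro w hw
      by_contra hwK
      exact hw (hχK w hwK)
    rw [DivFormOperator.energy, this]; simp
  have hbump : ContDiff ℝ ∞ (B.bump : Euc n → ℝ) := B.bump.contDiff
  have hb2 : ∀ z ∉ Metric.closedBall B.center (2 * B.radius), B.bump z = 0 :=
    fun z hz => B.bump_eq_zero hz
  have hψ : B.pull B.bump ∈ TestFn n M := B.testFn_pull hbump hb2
  have hψ1 : ∀ x ∈ B.carrier, B.pull B.bump x = 1 ∧ diffAt n (B.pull B.bump) x = 0 := by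
    intro x hx
    have hxs := B.carrier_subset_source hx
    have hev : (B.bump : Euc n → ℝ) =ᶠ[𝓝 (B.chart x)] 1 := by
      refine B.bump.eventuallyEq_one_of_mem_ball ?_
      have h1 := Metric.mem_closedBall.1 (B.chart_mem_ball hx)
      have hR := B.radius_pos
      rw [Metric.mem_ball]
      show _ < 3 / 2 * B.radius
      linarith
    refine ⟨?_, ?_⟩
    · rw [B.pull_apply _ hxs, hev.self_of_nhds]; rfl
    · rw [B.diffAt_pull hbump hb2 hxs, hev.fderiv_eq]
      ext w
      simp [chartCovector, Pi.one_def]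
  obtain ⟨A, hA0, hA⟩ := P.exists_integral_rpow_mul_energy_le hP B.isCompact_carrier hχ hχ1 hχK
    hψ hψ1
  refine ⟨A * (1 + β * (1 + Θ)) / (α * θ), by positivity, fun u hu hq s hs hs4 => ?_⟩
  have h1 := hA u hu hq s hs hs4
  set f := B.rep u with hf
  have hfc : Continuous f := (B.contDiff_rep hu).continuous
  have hfd : Continuous (fderiv ℝ f) := B.continuous_fderiv_rep hu
  have hηc := hη.continuous
  have hηd : Continuous (fderiv ℝ η) := hη.continuous_fderiv (by simp)
  have huc := hu.1.continuous
  have hχc := hχ.1.continuous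
  have hr : ∀ x ∈ B.carrier, f (B.chart x) = u x := fun x hx => B.rep_chart u hx
  have hfr : ∀ a : ℝ, Continuous fun z => (1 + f z ^ 2) ^ a := fun a =>
    (by fun_prop : Continuous fun z => 1 + f z ^ 2).rpow_const
      fun z => Or.inl (by positivity)
  have hur : ∀ a : ℝ, Continuous fun x => (1 + u x ^ 2) ^ a := fun a =>
    (by fun_prop : Continuous fun x => 1 + u x ^ 2).rpow_const
      fun z => Or.inl (by positivity)
  have hηs : HasCompactSupport η := HasCompactSupport.intro B.isCompact_ball hηB
  have l1 : α * ∫ z in B.ball, θ * (η z ^ 2 * ((1 + f z ^ 2) ^ (s - 1) * ‖fderiv ℝ f z‖ ^ 2)) ≤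
      ∫ x, χ x ^ 2 * ((1 + u x ^ 2) ^ (s - 1) * P.energy u u x) ∂ν := by
    refine hlow _ _ ?_ (fun z => by positivity) ?_ ?_ ?_
    · exact continuous_const.mul ((hηc.pow 2).mul ((hfr _).mul (hfd.norm.pow 2)))
    · exact (P.integrable_continuous_mul_energy hu hu ((hχc.pow 2).mul (hur (s - 1)))).congr
        (Eventually.of_forall fun x => mul_assoc _ _ _)
    · exact fun x => mul_nonneg (sq_nonneg _)
        (mul_nonneg (Real.rpow_nonneg (by positivity) _) (P.energy_self_nonneg u x))
    · filter_upwards [hE] with x hx hxB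
      rw [hχe x hxB, hr x hxB]
      have h2 := (hx hxB u _ (B.diffAt_eq_rep hu hxB)).1
      have h3 : 0 ≤ η (B.chart x) ^ 2 * (1 + u x ^ 2) ^ (s - 1) := by positivity
      have := mul_le_mul_of_nonneg_left h2 h3
      linarith
  have l2 : ∫ x, (χ x ^ 2 + P.energy χ χ x) * (1 + u x ^ 2) ^ s ∂ν ≤
      β * ∫ z in B.ball, (1 + Θ) * ((η z ^ 2 + ‖fderiv ℝ η z‖ ^ 2) * (1 + f z ^ 2) ^ s) := by
    refine hup _ _ ?_ (fun z => by positivity) ?_ ?_ ?_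
    · exact continuous_const.mul (((hηc.pow 2).add (hηd.norm.pow 2)).mul (hfr _))
    · have hχ2 : HasCompactSupport fun x => χ x ^ 2 :=
        hχ.2.comp_left (g := fun a : ℝ => a ^ 2) (by simp)
      have i1 : Integrable (fun x => χ x ^ 2 * (1 + u x ^ 2) ^ s) ν :=
        ((hχc.pow 2).mul (hur s)).integrable_of_hasCompactSupport hχ2.mul_right
      have i2 := P.integrable_continuous_mul_energy hχ hχ (hur s)
      refine (i1.add i2).congr (Eventually.of_forall fun x => ?_)
      simp only [Pi.add_apply]
      ring
    · filter_upwards [hE] with x hx hxB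
      rw [hχe x hxB, hr x hxB]
      have h2 := (hx hxB χ _ (hχd x hxB)).2
      have h3 : 0 ≤ (1 + u x ^ 2) ^ s := Real.rpow_nonneg (by positivity) _
      have h4 : η (B.chart x) ^ 2 + P.energy χ χ x ≤
          (1 + Θ) * (η (B.chart x) ^ 2 + ‖fderiv ℝ η (B.chart x)‖ ^ 2) := by
        have h5 : 0 ≤ Θ * η (B.chart x) ^ 2 := by positivity
        have h6 : 0 ≤ ‖fderiv ℝ η (B.chart x)‖ ^ 2 := by positivity
        linarith
      have := mul_le_mul_of_nonneg_right h4 h3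
      linarith
    · intro x hx
      rw [hχK x hx, hχdt x hx]; simp
  have hsupp : ∀ g : Euc n → ℝ, (∀ z ∉ B.ball, g z = 0) → ∫ z in B.ball, g z = ∫ z, g z :=
    fun g hg => setIntegral_eq_integral_of_forall_compl_eq_zero hg
  have hdη0 : ∀ z ∉ B.ball, fderiv ℝ η z = 0 := by
    intro z hz
    have : η =ᶠ[𝓝 z] fun _ => 0 := by
      filter_upwards [B.isCompact_ball.isClosed.isOpen_compl.mem_nhds hz] with w hw using hηB w hw
    rw [this.fderiv_eq]; simp
  rw [integral_const_mul, hsupp _ fun z hz => by rw [hηB z hz]; simp] at l1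
  rw [integral_const_mul, hsupp _ fun z hz => by rw [hηB z hz, hdη0 z hz]; simp] at l2
  set X := ∫ z, η z ^ 2 * ((1 + f z ^ 2) ^ (s - 1) * ‖fderiv ℝ f z‖ ^ 2)
  set T := ∫ z, (η z ^ 2 + ‖fderiv ℝ η z‖ ^ 2) * (1 + f z ^ 2) ^ s with hT
  have hT0 : 0 ≤ T := integral_nonneg fun z => by positivity
  rw [div_mul_eq_mul_div, le_div_iff₀ (by positivity)]
  have h2 := mul_le_mul_of_nonneg_left l2 hA0
  have h3 : 0 ≤ A * (β * (1 + Θ)) := by positivity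
  have h4 : 0 ≤ A * T := by positivity
  calc X * (α * θ) = α * (θ * X) := by ring
    _ ≤ A * 1 + A * (β * ((1 + Θ) * T)) := by linarith
    _ ≤ _ := by linarith

end CoordBall

namespace DivFormOperator

variable (P : DivFormOperator n M ν)

/-- A test function of small energy is at most `1` off a set of small measure. -/
theorem exists_measure_one_lt_le {W : M → ℝ} (hW : ∀ x, 0 < W x) (hWm : AEMeasurable W ν)
    {l : ℝ≥0} (hl : 0 < l) (hH : P.Hardy W l) {K : Set M} (hK : IsCompact K) {ε : ℝ≥0∞}
    (hε : 0 < ε) : ∃ κ : ℝ, 0 < κ ∧ κ ≤ 1 ∧ ∀ u ∈ TestFn n M, P.q u ≤ κ →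
      ν (K ∩ {x | 1 < |u x|}) ≤ ε := by
  have hloc : IsLocallyFiniteMeasure ν := isLocallyFinite_of_isLocallyLebesgue (n := n)
  -- as `W` is positive everywhere, it is small only on a small part of `K`
  obtain ⟨δ, hδ, hνδ⟩ : ∃ δ : ℝ, 0 < δ ∧ ν (K ∩ {x | W x ≤ δ}) ≤ ε / 2 := by
    have hnull : ∀ m : ℕ, NullMeasurableSet (K ∩ {x | W x ≤ 1 / ((m : ℝ) + 1)}) ν := fun m =>
      hK.isClosed.measurableSet.nullMeasurableSet.inter
        (nullMeasurableSet_le hWm aemeasurable_const)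
    have hanti : Antitone fun m : ℕ => K ∩ {x | W x ≤ 1 / ((m : ℝ) + 1)} := by
      intro i j hij x hx
      have h : W x ≤ 1 / ((j : ℝ) + 1) := hx.2
      exact ⟨hx.1, h.trans (Nat.one_div_le_one_div hij)⟩
    have ht := tendsto_measure_iInter_atTop hnull hanti
      ⟨0, measure_ne_top_of_subset inter_subset_left hK.measure_lt_top.ne⟩
    have hemp : ⋂ m : ℕ, K ∩ {x | W x ≤ 1 / ((m : ℝ) + 1)} = ∅ := by
      refine eq_empty_of_forall_notMem fun x hx => ?_
      obtain ⟨m, hm⟩ := exists_nat_one_div_lt (hW x)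
      exact absurd (mem_iInter.1 hx m).2 (not_le.2 hm)
    rw [hemp, measure_empty] at ht
    obtain ⟨m, hm⟩ := (ht.eventually_le_const (ENNReal.half_pos hε.ne')).exists
    exact ⟨_, by positivity, hm⟩
  set ε' : ℝ≥0∞ := min (ε / 2) 1 with hε'
  have hε'0 : 0 < ε' := lt_min (ENNReal.half_pos hε.ne') one_pos
  have hε't : ε' ≠ ⊤ := ((min_le_right _ _).trans_lt ENNReal.one_lt_top).ne
  set τ := ε'.toReal with hτ
  have hτ0 : 0 < τ := ENNReal.toReal_pos hε'0.ne' hε't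
  refine ⟨min 1 (l * δ * τ), by have : (0 : ℝ) < l := hl
                                positivity, min_le_left _ _, fun u hu hq => ?_⟩
  have hl' : (0 : ℝ) < l := hl
  have hmeas : AEMeasurable (fun x => ENNReal.ofReal (W x * u x ^ 2)) ν :=
    (hWm.mul (hu.1.continuous.pow 2).aemeasurable).ennreal_ofReal
  -- Chebyshev's inequality for `W u²`
  have h1 : ν {x | ENNReal.ofReal δ ≤ ENNReal.ofReal (W x * u x ^ 2)} ≤ ε / 2 := by
    refine (meas_ge_le_lintegral_div hmeas (by simpa using hδ) ENNReal.ofReal_ne_top).trans ?_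
    refine le_trans ?_ (min_le_left (ε / 2) 1)
    rw [ENNReal.div_le_iff (by simpa using hδ) ENNReal.ofReal_ne_top]
    have h2 := (hH u hu).trans (ENNReal.ofReal_le_ofReal (hq.trans (min_le_right _ _)))
    have h3 : ENNReal.ofReal (l * δ * τ) = l * (ε' * ENNReal.ofReal δ) := by
      rw [ENNReal.ofReal_mul (by positivity), ENNReal.ofReal_mul (by positivity), hτ,
        ENNReal.ofReal_toReal hε't, ENNReal.ofReal_coe_nnreal]
      ring
    rw [h3] at h2
    exact (ENNReal.mul_le_mul_iff_right (by exact_mod_cast hl.ne') ENNReal.coe_ne_top).1 h2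
  calc ν (K ∩ {x | 1 < |u x|}) ≤ ν ((K ∩ {x | W x ≤ δ}) ∪
        {x | ENNReal.ofReal δ ≤ ENNReal.ofReal (W x * u x ^ 2)}) := by
        refine measure_mono fun x hx => ?_
        by_cases hxW : W x ≤ δ
        · exact Or.inl ⟨hx.1, hxW⟩
        · refine Or.inr (ENNReal.ofReal_le_ofReal ?_)
          have h2 : 1 ≤ u x ^ 2 := by
            rw [← sq_abs]; exact one_le_pow₀ (le_of_lt hx.2)
          have := (hW x).le
          calc δ = δ * 1 := (mul_one _).symm
            _ ≤ W x * u x ^ 2 := by gcongr; exact (not_le.1 hxW).le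
    _ ≤ ε / 2 + ε / 2 := (measure_union_le _ _).trans (add_le_add hνδ h1)
    _ = ε := ENNReal.add_halves ε

end DivFormOperator

/-- A bound by a constant on the sublevel `q ≤ κ`, for quantities homogeneous of degree two, is a
bound by a multiple of `q`. -/
theorem le_mul_of_forall_sq_mul_le {κ C q I : ℝ} (hκ : 0 < κ) (hq : 0 ≤ q) (hC : 0 ≤ C)
    (h : ∀ t : ℝ, t ^ 2 * q ≤ κ → t ^ 2 * I ≤ C) : I ≤ C / κ * q := by
  refine le_of_forall_pos_le_add fun ε hε => ?_
  set δ := ε * κ / (C + 1) with hδ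
  have hδ0 : 0 < δ := by positivity
  have ht : Real.sqrt (κ / (q + δ)) ^ 2 = κ / (q + δ) := Real.sq_sqrt (by positivity)
  have h1 := h (Real.sqrt (κ / (q + δ))) (by
    rw [ht, div_mul_eq_mul_div, div_le_iff₀ (by positivity)]
    gcongr
    linarith)
  rw [ht, div_mul_eq_mul_div, div_le_iff₀ (by positivity)] at h1
  have h2 : I ≤ C * (q + δ) / κ := by
    rw [le_div_iff₀ hκ]; linarith
  have h3 : C * δ / κ ≤ ε := by
    rw [hδ, div_le_iff₀ hκ, mul_div_assoc', div_le_iff₀ (by positivity)]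
    have : 0 < ε * κ := by positivity
    linarith
  calc I ≤ C * (q + δ) / κ := h2
    _ = C / κ * q + C * δ / κ := by ring
    _ ≤ _ := by gcongr

/-- **The local estimate**: near every point, the `H¹` norm in suitable coordinates is bounded by
the quadratic form. -/
theorem exists_coordBall_integral_le (P : DivFormOperator n M ν) (hP : P.Nonneg) {W : M → ℝ}
    (hW : ∀ x, 0 < W x) (hWm : AEMeasurable W ν) {l : ℝ≥0} (hl : 0 < l) (hH : P.Hardy W l)
    (x₀ : M) : ∃ B : CoordBall n M, x₀ ∈ B.chart.source ∧ B.chart x₀ = B.center ∧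
      ∃ C : ℝ, 0 ≤ C ∧ ∀ u ∈ TestFn n M,
      ∫ z in B.ball, B.rep u z ^ 2 ≤ C * P.q u ∧
      ∫ z in B.ball, ‖fderiv ℝ (B.rep u) z‖ ^ 2 ≤ C * P.q u := by
  obtain ⟨B, hx₀, hxc⟩ := CoordBall.exists_chart_eq_center n x₀
  obtain ⟨η, hη, hη0, hη1, hηB, R', hR', hR'R, hmain⟩ :=
    exists_setIntegral_sq_le B.center B.radius_pos
  have hηB' : ∀ z ∉ B.ball, η z = 0 := fun z hz => hηB z fun h =>
    hz (Metric.ball_subset_closedBall h)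
  obtain ⟨A₁, hA₁, h3⟩ := B.exists_setIntegral_fderiv_sq_le P hP
  obtain ⟨A₂, hA₂, h2⟩ := B.exists_integral_rpow_mul_fderiv_sq_le P hP hη hη0 hη1 hηB'
  obtain ⟨ε, C, hε, hC⟩ := hmain (max A₁ A₂) (le_max_of_le_left hA₁)
  obtain ⟨α, β, hα, hβ, hvol, -, -⟩ := B.exists_integral_bounds ν
  have hαε : 0 < ENNReal.ofReal α * ε := by
    refine pos_iff_ne_zero.2 (mul_ne_zero ?_ hε.ne')
    simpa using hα
  obtain ⟨κ, hκ, hκ1, hsmall⟩ := P.exists_measure_one_lt_le hW hWm hl hH B.isCompact_carrier hαε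
  -- on the sublevel `q ≤ κ` the function is at most `1` on most of the ball
  have hbdd : ∀ u ∈ TestFn n M, P.q u ≤ κ →
      ∫ z in Metric.closedBall B.center R', B.rep u z ^ 2 ≤ C := by
    intro u hu hq
    have hfc : Continuous (B.rep u) := (B.contDiff_rep hu).continuous
    refine hC _ ((B.contDiff_rep hu).of_le (by simp)) ?_ ?_ ?_
    · have hm : MeasurableSet {z | 1 < |B.rep u z|} :=
        (isOpen_lt continuous_const hfc.abs).measurableSet
      have h := hvol _ hm
      have e : B.carrier ∩ B.chart ⁻¹' {z | 1 < |B.rep u z|} = B.carrier ∩ {x | 1 < |u x|} := by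
        ext x
        simp only [mem_inter_iff, mem_preimage, mem_ofPred_eq]
        exact and_congr_right fun hx => by rw [B.rep_chart u hx]
      rw [e] at h
      exact (ENNReal.mul_le_mul_iff_right (by simpa using hα) ENNReal.ofReal_ne_top).1
        (h.trans (hsmall u hu hq))
    · intro s hs hs4
      refine (h2 u hu (hq.trans hκ1) s hs hs4).trans ?_
      refine mul_le_mul_of_nonneg_right (le_max_right _ _) (add_nonneg zero_le_one ?_)
      exact integral_nonneg fun z => by positivity
    · intro a b ha hab hb
      refine (h3 u hu a b ha hab hb.le).trans ?_
      have h4 : 0 ≤ ((b - a) ^ 2)⁻¹ * ∫ z in Metric.closedBall B.center b, B.rep u z ^ 2 :=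
        mul_nonneg (by positivity) (integral_nonneg fun z => sq_nonneg _)
      have h5 : P.q u ≤ 1 := hq.trans hκ1
      refine (mul_le_mul_of_nonneg_left (by linarith) hA₁).trans
        (mul_le_mul_of_nonneg_right (le_max_left _ _) (by linarith))
  have hC0 : 0 ≤ C := by
    have := hbdd 0 (TestFn n M).zero_mem (by
      have := P.q_smul (TestFn n M).zero_mem (0 : ℝ)
      rw [zero_smul] at this
      rw [this]; simpa using hκ.le)
    exact (integral_nonneg fun z => sq_nonneg _).trans this
  have hL2 : ∀ u ∈ TestFn n M, ∫ z in Metric.closedBall B.center R', B.rep u z ^ 2 ≤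
      C / κ * P.q u := by
    intro u hu
    refine le_mul_of_forall_sq_mul_le hκ (hP u hu) hC0 fun t ht => ?_
    rw [← P.q_smul hu] at ht
    have := hbdd _ ((TestFn n M).smul_mem t hu) ht
    rw [B.rep_smul] at this
    simpa only [Pi.smul_apply, smul_eq_mul, mul_pow, integral_const_mul] using this
  have hr : 0 < R' / 2 := by positivity
  have hrB : R' / 2 ≤ B.radius := by linarith
  set D := A₁ * (1 + ((R' - R' / 2) ^ 2)⁻¹ * (C / κ)) with hD
  refine ⟨B.shrink hr hrB, hx₀, hxc, max (C / κ) D,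
    le_max_of_le_left (by positivity), fun u hu => ⟨?_, ?_⟩⟩
  · have e : ∫ z in (B.shrink hr hrB).ball, (B.shrink hr hrB).rep u z ^ 2 =
        ∫ z in (B.shrink hr hrB).ball, B.rep u z ^ 2 :=
      setIntegral_congr_fun (B.shrink hr hrB).measurableSet_ball fun z hz => by
        simp only [(B.shrink_rep hr hrB u hz).self_of_nhds]
    rw [e]
    have hfc : Continuous (B.rep u) := (B.contDiff_rep hu).continuous
    calc ∫ z in (B.shrink hr hrB).ball, B.rep u z ^ 2 ≤
          ∫ z in Metric.closedBall B.center R', B.rep u z ^ 2 := by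
          refine setIntegral_mono_set ?_ (Eventually.of_forall fun z => sq_nonneg _)
            (LE.le.eventuallyLE (Metric.closedBall_subset_closedBall ?_))
          · exact (hfc.pow 2).continuousOn.integrableOn_compact (isCompact_closedBall _ _)
          · show R' / 2 ≤ R'
            linarith
      _ ≤ C / κ * P.q u := hL2 u hu
      _ ≤ _ := mul_le_mul_of_nonneg_right (le_max_left _ _) (hP u hu)
  · have e : ∫ z in (B.shrink hr hrB).ball, ‖fderiv ℝ ((B.shrink hr hrB).rep u) z‖ ^ 2 =
        ∫ z in (B.shrink hr hrB).ball, ‖fderiv ℝ (B.rep u) z‖ ^ 2 :=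
      setIntegral_congr_fun (B.shrink hr hrB).measurableSet_ball fun z hz => by
        simp only [(B.shrink_rep hr hrB u hz).fderiv_eq]
    rw [e]
    have h4 := h3 u hu (R' / 2) R' hr (by linarith) hR'R.le
    refine h4.trans ?_
    refine le_trans ?_ (mul_le_mul_of_nonneg_right (le_max_right _ _) (hP u hu))
    rw [hD, mul_assoc]
    refine mul_le_mul_of_nonneg_left ?_ hA₁
    have h5 := mul_le_mul_of_nonneg_left (hL2 u hu)
      (by positivity : 0 ≤ ((R' - R' / 2) ^ 2)⁻¹)
    linarith

end LocalBound

/-! ### The best constant at infinity -/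

section Decay

variable {n : ℕ} {M : Type*} [TopologicalSpace M] [ChartedSpace (Euc n) M]
  [MeasurableSpace M] {ν : Measure M}

namespace DivFormOperator

variable (P : DivFormOperator n M ν)

/-- Off a compact set the Hardy inequality holds for `V` with an arbitrarily large constant. -/
theorem exists_isCompact_mul_lintegral_le [OpensMeasurableSpace M] [T2Space M] {W V : M → ℝ}
    (hW : ∀ x, 0 < W x) {l : ℝ≥0} (hl : 0 < l) (hH : P.Hardy W l)
    (hVW : Tendsto (fun x => V x / W x) (cocompact M) (𝓝 0)) (a : ℝ≥0) :
    ∃ K : Set M, IsCompact K ∧ ∀ u ∈ TestFn n M,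
      a * ∫⁻ x in Kᶜ, ENNReal.ofReal (V x * u x ^ 2) ∂ν ≤ ENNReal.ofReal (P.q u) := by
  have hl' : (0 : ℝ) < l := hl
  have h1 := hVW.eventually_lt_const (by positivity : (0 : ℝ) < l / (a + 1))
  obtain ⟨K, hK, hKs⟩ := mem_cocompact.1 h1
  refine ⟨K, hK, fun u hu => ?_⟩
  refine le_trans ?_ (hH u hu)
  rw [← lintegral_const_mul' _ _ ENNReal.coe_ne_top, ← lintegral_const_mul' _ _ ENNReal.coe_ne_top]
  refine (setLIntegral_mono' hK.isClosed.measurableSet.compl fun x hx => ?_).trans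
    (setLIntegral_le_lintegral Kᶜ _)
  have h2 : V x / W x < l / (a + 1) := hKs hx
  rw [div_lt_div_iff₀ (hW x) (by positivity)] at h2
  rw [← ENNReal.ofReal_coe_nnreal, ← ENNReal.ofReal_coe_nnreal (p := l),
    ← ENNReal.ofReal_mul a.coe_nonneg, ← ENNReal.ofReal_mul l.coe_nonneg]
  refine ENNReal.ofReal_le_ofReal ?_
  rw [← mul_assoc, ← mul_assoc]
  refine mul_le_mul_of_nonneg_right ?_ (sq_nonneg _)
  by_cases hV : 0 ≤ V x
  · linarith
  · have : (a : ℝ) * V x ≤ 0 := mul_nonpos_of_nonneg_of_nonpos a.coe_nonneg (not_le.1 hV).le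
    have := mul_pos hl' (hW x)
    linarith

/-- Since `V / W` tends to `0` at infinity, the Hardy inequality for `V` holds with every constant
off a suitable compact set. -/
theorem lambdaInfty_eq_top [OpensMeasurableSpace M] [T2Space M] {W V : M → ℝ}
    (hW : ∀ x, 0 < W x) {l : ℝ≥0} (hl : 0 < l) (hH : P.Hardy W l)
    (hVW : Tendsto (fun x => V x / W x) (cocompact M) (𝓝 0)) : P.lambdaInfty V = ⊤ := by
  refine ENNReal.eq_top_of_forall_nnreal_le fun a => ?_
  obtain ⟨K, hK, h⟩ := P.exists_isCompact_mul_lintegral_le hW hl hH hVW a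
  exact le_iSup₂_of_le a ⟨K, hK, fun u hu _ => h u hu⟩ le_rfl

end DivFormOperator

end Decay

/-! ### The compactness estimate -/

section Functionals

variable {n : ℕ} {M : Type*} [TopologicalSpace M] [ChartedSpace (Euc n) M]
  [IsManifold 𝓘(ℝ, Euc n) ∞ M]

namespace CoordBall

variable (B : CoordBall n M)

theorem continuous_rep {u : M → ℝ} (hu : u ∈ TestFn n M) : Continuous (B.rep u) :=
  (B.contDiff_rep hu).continuous

theorem integrableOn_ball_rep {u : M → ℝ} (hu : u ∈ TestFn n M) (p : Euc n) (r : ℝ) :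
    IntegrableOn (B.rep u) (Metric.ball p r) :=
  ((B.continuous_rep hu).continuousOn.integrableOn_compact (isCompact_closedBall p r)).mono_set
    Metric.ball_subset_closedBall

/-- The average of a test function over a ball in the coordinates, as a linear functional. -/
def average (p : Euc n) (r : ℝ) : TestFn n M →ₗ[ℝ] ℝ where
  toFun u := ⨍ z in Metric.ball p r, B.rep u.1 z
  map_add' u v := by
    simp only [setAverage_eq, smul_eq_mul, Submodule.coe_add, rep_add, Pi.add_apply]
    rw [integral_add (B.integrableOn_ball_rep u.2 p r) (B.integrableOn_ball_rep v.2 p r), mul_add]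
  map_smul' t u := by
    simp only [setAverage_eq, smul_eq_mul, Submodule.coe_smul, rep_smul, Pi.smul_apply,
      integral_const_mul, RingHom.id_apply]
    ring

theorem sq_average_le {u : M → ℝ} (hu : u ∈ TestFn n M) {p : Euc n} {r : ℝ} (hr : 0 < r)
    (hsub : Metric.ball p r ⊆ B.ball) : (⨍ z in Metric.ball p r, B.rep u z) ^ 2 ≤
      (volume.real (Metric.ball p r))⁻¹ * ∫ z in B.ball, B.rep u z ^ 2 := by
  set m := ⨍ z in Metric.ball p r, B.rep u z with hm
  set v := volume.real (Metric.ball p r) with hv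
  have hv0 : 0 < v :=
    ENNReal.toReal_pos (Metric.measure_ball_pos volume p hr).ne' measure_ball_lt_top.ne
  have hfc := B.continuous_rep hu
  have i2 : IntegrableOn (fun z => B.rep u z ^ 2) B.ball :=
    (hfc.pow 2).continuousOn.integrableOn_compact B.isCompact_ball
  have i1 := B.integrableOn_ball_rep hu p r
  have hint : ∫ z in Metric.ball p r, B.rep u z = v * m := by
    rw [hm, setAverage_eq, smul_eq_mul, ← hv, mul_inv_cancel_left₀ hv0.ne']
  have h0 : 0 ≤ ∫ z in Metric.ball p r, (B.rep u z - m) ^ 2 :=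
    integral_nonneg fun z => sq_nonneg _
  have e : ∀ z, (B.rep u z - m) ^ 2 = B.rep u z ^ 2 - 2 * m * B.rep u z + m ^ 2 := fun z => by ring
  have ic : IntegrableOn (fun _ : Euc n => m ^ 2) (Metric.ball p r) :=
    integrableOn_const measure_ball_lt_top.ne
  simp only [e] at h0
  have e1 := integral_add' ((i2.mono_set hsub).sub (i1.const_mul (2 * m))) ic
  have e2 := integral_sub' (i2.mono_set hsub) (i1.const_mul (2 * m))
  rw [e2, integral_const_mul, hint, setIntegral_const, smul_eq_mul, ← hv] at e1
  replace h0 := h0.trans_eq e1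
  have h1 : ∫ z in Metric.ball p r, B.rep u z ^ 2 ≤ ∫ z in B.ball, B.rep u z ^ 2 :=
    setIntegral_mono_set i2 (Eventually.of_forall fun z => sq_nonneg _) hsub.eventuallyLE
  rw [inv_mul_eq_div, le_div_iff₀ hv0]
  linarith

end CoordBall

end Functionals

section Compactness

variable {n : ℕ} {M : Type*} [TopologicalSpace M] [ChartedSpace (Euc n) M]
  [MeasurableSpace M] {ν : Measure M}
  [T2Space M] [BorelSpace M] [IsManifold 𝓘(ℝ, Euc n) ∞ M] [IsLocallyLebesgue n ν]

/-- On `S`, the weighted `L²` norm is controlled by a small multiple of `q` and finitely many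
`q`-bounded linear functionals. -/
def SmallModuloFinite (P : DivFormOperator n M ν) (V : M → ℝ) (S : Set M) : Prop :=
  ∀ ε : ℝ, 0 < ε → ∃ (s : Finset (TestFn n M →ₗ[ℝ] ℝ)) (C : ℝ), 0 ≤ C ∧
    (∀ ℓ ∈ s, ∀ u : TestFn n M, ℓ u ^ 2 ≤ C * P.q u.1) ∧
    ∀ u : TestFn n M, ∫⁻ x in S, ENNReal.ofReal (V x * u.1 x ^ 2) ∂ν ≤
      ENNReal.ofReal (ε * P.q u.1 + C * ∑ ℓ ∈ s, ℓ u ^ 2)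

namespace SmallModuloFinite

variable {P : DivFormOperator n M ν} {V : M → ℝ}

theorem mono {S T : Set M} (hT : SmallModuloFinite P V T) (hST : S ⊆ T) :
    SmallModuloFinite P V S := by
  intro ε hε
  obtain ⟨s, C, hC, h1, h2⟩ := hT ε hε
  exact ⟨s, C, hC, h1, fun u => (lintegral_mono_set hST).trans (h2 u)⟩

theorem empty : SmallModuloFinite P V ∅ := fun ε _ =>
  ⟨∅, 0, le_rfl, by simp, by simp⟩

theorem union (hP : P.Nonneg) {S T : Set M} (hS : SmallModuloFinite P V S)
    (hT : SmallModuloFinite P V T) : SmallModuloFinite P V (S ∪ T) := by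
  classical
  intro ε hε
  obtain ⟨s, C, hC, h1, h2⟩ := hS (ε / 2) (by positivity)
  obtain ⟨s', C', hC', h1', h2'⟩ := hT (ε / 2) (by positivity)
  refine ⟨s ∪ s', C + C', by positivity, fun ℓ hℓ u => ?_, fun u => ?_⟩
  · have hq := hP _ u.2
    rw [Finset.mem_union] at hℓ
    rcases hℓ with hℓ | hℓ
    · refine (h1 ℓ hℓ u).trans (mul_le_mul_of_nonneg_right (by linarith) hq)
    · refine (h1' ℓ hℓ u).trans (mul_le_mul_of_nonneg_right (by linarith) hq)
  · have hq := hP _ u.2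
    refine (lintegral_union_le _ _ _).trans ((add_le_add (h2 u) (h2' u)).trans ?_)
    have hs : 0 ≤ ∑ ℓ ∈ s, ℓ u ^ 2 := Finset.sum_nonneg fun _ _ => sq_nonneg _
    have hs' : 0 ≤ ∑ ℓ ∈ s', ℓ u ^ 2 := Finset.sum_nonneg fun _ _ => sq_nonneg _
    rw [← ENNReal.ofReal_add (by positivity) (by positivity)]
    refine ENNReal.ofReal_le_ofReal ?_
    have e1 : ∑ ℓ ∈ s, ℓ u ^ 2 ≤ ∑ ℓ ∈ s ∪ s', ℓ u ^ 2 :=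
      Finset.sum_le_sum_of_subset_of_nonneg Finset.subset_union_left fun _ _ _ => sq_nonneg _
    have e2 : ∑ ℓ ∈ s', ℓ u ^ 2 ≤ ∑ ℓ ∈ s ∪ s', ℓ u ^ 2 :=
      Finset.sum_le_sum_of_subset_of_nonneg Finset.subset_union_right fun _ _ _ => sq_nonneg _
    have e3 := mul_le_mul_of_nonneg_left e1 hC
    have e4 := mul_le_mul_of_nonneg_left e2 hC'
    linarith

/-- In a coordinate ball where the `H¹` norm is bounded by `q`, this is the Rellich theorem; the
functionals are averages over small balls. -/
theorem of_coordBall (hP : P.Nonneg) (hVb : IsLocEssBdd ν V) (B : CoordBall n M) {C : ℝ}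
    (hC : 0 ≤ C)
    (hB : ∀ u ∈ TestFn n M, ∫ z in B.ball, B.rep u z ^ 2 ≤ C * P.q u ∧
      ∫ z in B.ball, ‖fderiv ℝ (B.rep u) z‖ ^ 2 ≤ C * P.q u) {r₀ : ℝ} (hr₀ : 0 < r₀)
    (hr₀B : r₀ < B.radius) :
    SmallModuloFinite P V (B.shrink hr₀ hr₀B.le).carrier := by
  classical
  intro ε hε
  set B' := B.shrink hr₀ hr₀B.le with hB'
  obtain ⟨a, b, ha, hb, -, -, hup⟩ := B'.exists_integral_bounds ν
  obtain ⟨D, hD⟩ := hVb _ B'.isCompact_carrier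
  -- the radius of the small balls makes the gradient term small
  set N := (|D| * b) * (2 ^ (n + 1) * 4 * C) with hN
  have hN0 : 0 ≤ N := by positivity
  obtain ⟨r, hr, hrR, hrε⟩ : ∃ r : ℝ, 0 < r ∧ r₀ + 2 * r ≤ B.radius ∧ N * r ^ 2 ≤ ε := by
    set m := min (min ((B.radius - r₀) / 2) 1) (ε / (N + 1)) with hm
    have h1 : m ≤ 1 := (min_le_left _ _).trans (min_le_right _ _)
    have h2 : m ≤ (B.radius - r₀) / 2 := (min_le_left _ _).trans (min_le_left _ _)
    have h3 : m ≤ ε / (N + 1) := min_le_right _ _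
    have h0 : 0 < m := lt_min (lt_min (by linarith) one_pos) (by positivity)
    refine ⟨m, h0, by linarith, ?_⟩
    rw [le_div_iff₀ (by positivity)] at h3
    have h4 : N * m ^ 2 ≤ N * (m * 1) := by rw [sq]; gcongr
    linarith
  obtain ⟨t, ht, hRel⟩ := exists_finset_setIntegral_sq_le B.center (ρ := r₀) hr
  have htB : ∀ p ∈ t, Metric.ball p r ⊆ B.ball := by
    intro p hp z hz
    have h1 := Metric.mem_closedBall.1 (ht p hp)
    have h2 := Metric.mem_ball.1 hz
    refine Metric.mem_closedBall.2 ((dist_triangle z p B.center).trans ?_)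
    linarith
  set k := (volume.real (Metric.ball (0 : Euc n) r))⁻¹ with hk
  have hk0 : 0 ≤ k := by positivity
  have hkp : ∀ p : Euc n, (volume.real (Metric.ball p r))⁻¹ = k := fun p => by
    rw [hk, Measure.real, Measure.real, Measure.addHaar_ball_center]
  set v := volume.real (Metric.closedBall B.center r₀) with hv
  have hv0 : 0 ≤ v := measureReal_nonneg
  set C' := k * C + |D| * b * (2 * v) * t.card with hC'
  have hC'0 : 0 ≤ C' := by positivity
  refine ⟨t.image fun p => B.average p r, C', hC'0, ?_, fun u => ?_⟩
  · intro ℓ hℓ u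
    obtain ⟨p, hp, rfl⟩ := Finset.mem_image.1 hℓ
    have h1 := B.sq_average_le u.2 hr (htB p hp)
    rw [hkp] at h1
    refine h1.trans ((mul_le_mul_of_nonneg_left (hB _ u.2).1 hk0).trans ?_)
    rw [← mul_assoc]
    refine mul_le_mul_of_nonneg_right ?_ (hP _ u.2)
    rw [hC']
    have : 0 ≤ |D| * b * (2 * v) * t.card := by positivity
    linarith
  have hu := u.2
  have hfc := B.continuous_rep hu
  have huc := hu.1.continuous
  have hcm := B'.measurableSet_carrier
  have hq := hP _ hu
  have iU : Integrable (fun x => |D| * u.1 x ^ 2) ν := by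
    have : IsLocallyFiniteMeasure ν := isLocallyFinite_of_isLocallyLebesgue (n := n)
    have hs : HasCompactSupport fun x => u.1 x ^ 2 :=
      hu.2.comp_left (g := fun a : ℝ => a ^ 2) (by simp)
    exact ((huc.pow 2).integrable_of_hasCompactSupport hs).const_mul _
  have h1 : ∫⁻ x in B'.carrier, ENNReal.ofReal (V x * u.1 x ^ 2) ∂ν ≤
      ENNReal.ofReal (∫ x in B'.carrier, |D| * u.1 x ^ 2 ∂ν) := by
    rw [ofReal_integral_eq_lintegral_ofReal iU.integrableOn
      (Eventually.of_forall fun x => by positivity)]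
    refine lintegral_mono_ae ?_
    filter_upwards [ae_restrict_mem hcm, ae_restrict_of_ae hD] with x hx hxD
    refine ENNReal.ofReal_le_ofReal (mul_le_mul_of_nonneg_right ?_ (sq_nonneg _))
    exact ((le_abs_self _).trans (hxD hx)).trans (le_abs_self D)
  refine h1.trans (ENNReal.ofReal_le_ofReal ?_)
  have h2 : ∫ x in B'.carrier, |D| * u.1 x ^ 2 ∂ν ≤
      b * ∫ z in B'.ball, |D| * B.rep u.1 z ^ 2 := by
    rw [← integral_indicator hcm]
    refine hup _ _ (by fun_prop) (fun z => by positivity) (iU.indicator hcm) ?_ ?_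
    · refine Eventually.of_forall fun x hx => ?_
      rw [indicator_of_mem hx]
      have e : B.rep u.1 (B'.chart x) = u.1 x :=
        B.rep_chart u.1 (B.shrink_carrier_subset hr₀ hr₀B.le hx)
      rw [e]
    · intro x hx
      rw [indicator_of_notMem hx]
  have h3 := hRel (B.rep u.1) ((B.contDiff_rep hu).of_le (by simp))
  have h4 : ∫ z in Metric.closedBall B.center (r₀ + 2 * r), ‖fderiv ℝ (B.rep u.1) z‖ ^ 2 ≤
      C * P.q u.1 := by
    refine le_trans ?_ (hB _ hu).2
    refine setIntegral_mono_set ?_ (Eventually.of_forall fun z => by positivity)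
      (LE.le.eventuallyLE (Metric.closedBall_subset_closedBall hrR))
    exact ((B.continuous_fderiv_rep hu).norm.pow 2).continuousOn.integrableOn_compact
      B.isCompact_ball
  set T := ∑ ℓ ∈ t.image fun p => B.average p r, ℓ u ^ 2 with hS
  have hS0 : 0 ≤ T := Finset.sum_nonneg fun _ _ => sq_nonneg _
  have h5 : ∑ p ∈ t, (⨍ z in Metric.ball p r, B.rep u.1 z) ^ 2 ≤ t.card * T := by
    rw [← nsmul_eq_mul]
    refine Finset.sum_le_card_nsmul _ _ _ fun p hp => ?_
    exact Finset.single_le_sum (f := fun ℓ : TestFn n M →ₗ[ℝ] ℝ => ℓ u ^ 2)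
      (fun _ _ => sq_nonneg _) (Finset.mem_image_of_mem (fun p => B.average p r) hp)
  have h6 : ∫ z in B'.ball, B.rep u.1 z ^ 2 ≤
      2 ^ (n + 1) * (2 * r) ^ 2 * (C * P.q u.1) + 2 * v * (t.card * T) := by
    refine h3.trans (add_le_add ?_ ?_)
    · exact mul_le_mul_of_nonneg_left h4 (by positivity)
    · exact mul_le_mul_of_nonneg_left h5 (by positivity)
  have e2 : b * ∫ z in B'.ball, |D| * B.rep u.1 z ^ 2 =
      |D| * b * ∫ z in B'.ball, B.rep u.1 z ^ 2 := by
    rw [integral_const_mul]; ring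
  have h7 := mul_le_mul_of_nonneg_left h6 (by positivity : 0 ≤ |D| * b)
  have h8 := mul_le_mul_of_nonneg_right hrε hq
  have h9 : 0 ≤ k * C * T := by positivity
  rw [hC']
  rw [hN] at h8
  linarith

/-- The compactness estimate: `V` is dominated by the Hardy weight at infinity and is locally
bounded. -/
theorem univ (hP : P.Nonneg) {W : M → ℝ} (hW : ∀ x, 0 < W x) (hWm : AEMeasurable W ν)
    {l : ℝ≥0} (hl : 0 < l) (hH : P.Hardy W l) (hVb : IsLocEssBdd ν V)
    (hVW : Tendsto (fun x => V x / W x) (cocompact M) (𝓝 0)) :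
    SmallModuloFinite P V univ := by
  -- compact sets are covered by coordinate balls, and off a compact set the Hardy inequality
  -- suffices
  have hloc : ∀ x : M, ∃ S ∈ 𝓝 x, SmallModuloFinite P V S := by
    intro x
    obtain ⟨B, hx, hxc, C, hC, hB⟩ := exists_coordBall_integral_le P hP hW hWm hl hH x
    have hR := B.radius_pos
    have hr : B.radius / 2 < B.radius := by linarith
    refine ⟨_, (B.shrink (half_pos hR) hr.le).carrier_mem_nhds hx hxc,
      of_coordBall hP hVb B hC hB (half_pos hR) hr⟩
  have hcpt : ∀ K : Set M, IsCompact K → SmallModuloFinite P V K := fun K hK =>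
    hK.induction_on empty (fun S T hST hT => hT.mono hST) (fun S T hS hT => hS.union hP hT)
      fun x _ => by
        obtain ⟨S, hS, h⟩ := hloc x
        exact ⟨S, mem_nhdsWithin_of_mem_nhds hS, h⟩
  intro ε hε
  obtain ⟨K, hK, hKV⟩ := P.exists_isCompact_mul_lintegral_le hW hl hH hVW (2 / ε).toNNReal
  obtain ⟨s, C, hC, h1, h2⟩ := hcpt K hK (ε / 2) (by positivity)
  refine ⟨s, C, hC, h1, fun u => ?_⟩
  have hq := hP _ u.2
  have hs : 0 ≤ ∑ ℓ ∈ s, ℓ u ^ 2 := Finset.sum_nonneg fun _ _ => sq_nonneg _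
  have h3 : ∫⁻ x in Kᶜ, ENNReal.ofReal (V x * u.1 x ^ 2) ∂ν ≤ ENNReal.ofReal (ε / 2 * P.q u.1) := by
    have h4 := hKV u.1 u.2
    have h5 : ENNReal.ofReal (2 / ε) ≠ 0 := by
      rw [Ne, ENNReal.ofReal_eq_zero, not_le]; positivity
    refine (ENNReal.mul_le_mul_iff_right h5 ENNReal.ofReal_ne_top).1 (h4.trans ?_)
    rw [← ENNReal.ofReal_mul (by positivity)]
    refine ENNReal.ofReal_le_ofReal (le_of_eq ?_)
    field_simp
  rw [← union_compl_self K]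
  refine (lintegral_union_le _ _ _).trans ((add_le_add (h2 u) h3).trans ?_)
  rw [← ENNReal.ofReal_add (by positivity) (by positivity)]
  refine ENNReal.ofReal_le_ofReal ?_
  linarith

end SmallModuloFinite

end Compactness

/-! ### Compactness of extensions to a completion -/

section CompactExtension

variable {D H : Type*} [SeminormedAddCommGroup D] [NormedSpace ℝ D]
  [NormedAddCommGroup H] [NormedSpace ℝ H]

/-- A map that is small modulo finitely many bounded functionals sends the unit ball to a totally
bounded set. -/
theorem totallyBounded_image_ball_of_finset (j : D →L[ℝ] H)
    (h : ∀ ε : ℝ, 0 < ε → ∃ (s : Finset (D →ₗ[ℝ] ℝ)) (C : ℝ), 0 ≤ C ∧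
      (∀ ℓ ∈ s, ∀ u, ℓ u ^ 2 ≤ C * ‖u‖ ^ 2) ∧
      ∀ u, ‖j u‖ ^ 2 ≤ ε * ‖u‖ ^ 2 + C * ∑ ℓ ∈ s, ℓ u ^ 2) :
    TotallyBounded (j '' Metric.ball 0 1) := by
  rw [Metric.totallyBounded_iff]
  intro δ hδ
  obtain ⟨s, C, hC, hℓ, hj⟩ := h (δ ^ 2 / 8) (by positivity)
  set N := C * s.card with hN
  have hN0 : 0 ≤ N := by positivity
  set η := δ / (2 * (N + 1)) with hη
  have hη0 : 0 < η := by positivity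
  set Φ : D → (s → ℝ) := fun u ℓ => ℓ.1 u with hΦ
  have htb : TotallyBounded (Φ '' Metric.ball 0 1) := by
    refine (isCompact_closedBall (0 : s → ℝ) (Real.sqrt C)).totallyBounded.subset ?_
    rintro _ ⟨u, hu, rfl⟩
    rw [mem_closedBall_zero_iff, pi_norm_le_iff_of_nonneg (Real.sqrt_nonneg _)]
    intro ℓ
    rw [Real.norm_eq_abs]
    refine Real.abs_le_sqrt ((hℓ ℓ.1 ℓ.2 u).trans ?_)
    rw [mem_ball_zero_iff] at hu
    exact mul_le_of_le_one_right hC (pow_le_one₀ (norm_nonneg _) hu.le)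
  obtain ⟨t, hts, htf, ht⟩ := Metric.finite_approx_of_totallyBounded htb η hη0
  have hts' : ∀ y, y ∈ t → ∃ u, u ∈ Metric.ball (0 : D) 1 ∧ Φ u = y := fun y hy => hts hy
  choose! g hg hgΦ using hts'
  refine ⟨(fun y => j (g y)) '' t, htf.image _, ?_⟩
  rintro _ ⟨u, hu, rfl⟩
  obtain ⟨y, hyt, hy⟩ := mem_iUnion₂.1 (ht (mem_image_of_mem Φ hu))
  refine mem_iUnion₂.2 ⟨_, mem_image_of_mem _ hyt, ?_⟩
  rw [Metric.mem_ball, dist_eq_norm, ← map_sub]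
  have h1 := hj (u - g y)
  have h2 : ‖u - g y‖ ≤ 2 := by
    have a := mem_ball_zero_iff.1 hu
    have b := mem_ball_zero_iff.1 (hg y hyt)
    exact (norm_sub_le _ _).trans (by linarith)
  have h3 : ∑ ℓ ∈ s, ℓ (u - g y) ^ 2 ≤ s.card * η ^ 2 := by
    rw [← nsmul_eq_mul]
    refine Finset.sum_le_card_nsmul _ _ _ fun ℓ hℓs => ?_
    have h4 : dist (Φ u ⟨ℓ, hℓs⟩) (y ⟨ℓ, hℓs⟩) < η := (dist_le_pi_dist _ _ _).trans_lt hy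
    have h5 : y ⟨ℓ, hℓs⟩ = ℓ (g y) := by rw [← congrFun (hgΦ y hyt) ⟨ℓ, hℓs⟩]
    rw [h5, Real.dist_eq] at h4
    rw [map_sub, ← sq_abs]
    exact pow_le_pow_left₀ (abs_nonneg _) h4.le 2
  have h6 : N * η ^ 2 ≤ δ ^ 2 / 4 := by
    rw [hη, div_pow, mul_div_assoc', div_le_div_iff₀ (by positivity) (by positivity)]
    have : 0 ≤ δ ^ 2 := sq_nonneg _
    have h7 : N * δ ^ 2 * 4 ≤ δ ^ 2 * (2 * (N + 1)) ^ 2 := by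
      have : 0 ≤ δ ^ 2 * (N ^ 2 + N + 1) := by positivity
      linarith
    exact h7
  have h7 : ‖u - g y‖ ^ 2 ≤ 2 ^ 2 := by gcongr
  have h8 : C * ∑ ℓ ∈ s, ℓ (u - g y) ^ 2 ≤ N * η ^ 2 := by
    rw [hN, mul_assoc]
    exact mul_le_mul_of_nonneg_left h3 hC
  have h9 : δ ^ 2 / 8 * ‖u - g y‖ ^ 2 ≤ δ ^ 2 / 8 * 2 ^ 2 := by gcongr
  have h10 : 0 < δ ^ 2 := by positivity
  exact lt_of_pow_lt_pow_left₀ 2 hδ.le (by linarith)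

/-- The extension to the completion of a bounded map that sends the unit ball to a totally bounded
set is compact. -/
theorem isCompactOperator_of_totallyBounded [CompleteSpace H] (j : D →L[ℝ] H)
    (J : UniformSpace.Completion D →L[ℝ] H)
    (hJ : ∀ u : D, J (u : UniformSpace.Completion D) = j u)
    (h : TotallyBounded (j '' Metric.ball 0 1)) : IsCompactOperator J := by
  refine (isCompactOperator_iff_isCompact_closure_image_ball J.toLinearMap one_pos).2 ?_
  refine TotallyBounded.isCompact_of_isClosed (TotallyBounded.closure ?_) isClosed_closure
  refine h.closure.subset ?_
  rintro _ ⟨ξ, hξ, rfl⟩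
  -- the unit ball of the dense subspace is dense in the unit ball of the completion
  have h1 : ξ ∈ closure (Metric.ball (0 : UniformSpace.Completion D) 1 ∩
      range ((↑) : D → UniformSpace.Completion D)) :=
    UniformSpace.Completion.denseRange_coe.open_subset_closure_inter Metric.isOpen_ball hξ
  refine (closure_mono ?_) (image_closure_subset_closure_image J.continuous ⟨ξ, h1, rfl⟩)
  rintro _ ⟨_, ⟨hu, u, rfl⟩, rfl⟩
  refine ⟨u, ?_, (hJ u).symm⟩
  rw [mem_ball_zero_iff] at hu ⊢
  rwa [UniformSpace.Completion.norm_coe] at hu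

end CompactExtension

/-! ### The embedding into the weighted `L²` space -/

section WeightedL2

variable {n : ℕ} {M : Type*} [TopologicalSpace M] [ChartedSpace (Euc n) M]
  [MeasurableSpace M] {ν : Measure M} {V : M → ℝ}

theorem integrable_weighted_iff (hV : ∀ x, 0 < V x) (hVm : AEMeasurable V ν) {g : M → ℝ} :
    Integrable g (weighted ν V) ↔ Integrable (fun x => V x * g x) ν := by
  rw [weighted, integrable_withDensity_iff_integrable_smul₀' hVm.ennreal_ofReal
    (Eventually.of_forall fun x => ENNReal.ofReal_lt_top)]
  simp only [ENNReal.toReal_ofReal (hV _).le, smul_eq_mul]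

theorem integral_weighted (hV : ∀ x, 0 < V x) (hVm : AEMeasurable V ν) (g : M → ℝ) :
    ∫ x, g x ∂(weighted ν V) = ∫ x, V x * g x ∂ν := by
  rw [weighted, integral_withDensity_eq_integral_toReal_smul₀ hVm.ennreal_ofReal
    (Eventually.of_forall fun x => ENNReal.ofReal_lt_top)]
  simp only [ENNReal.toReal_ofReal (hV _).le, smul_eq_mul]

variable [T2Space M] [SecondCountableTopology M] [BorelSpace M]

theorem TestFn.memLp (hV : ∀ x, 0 < V x) (hVi : LocallyIntegrable V ν) {u : M → ℝ}
    (hu : u ∈ TestFn n M) : MemLp u 2 (weighted ν V) := by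
  refine (memLp_two_iff_integrable_sq hu.1.continuous.aestronglyMeasurable).2 ?_
  refine (integrable_weighted_iff hV hVi.aestronglyMeasurable.aemeasurable).2 ?_
  simpa only [sq] using integrable_mul_testFn hVi hu hu

/-- The inclusion of the test functions into `L²(V dν)`. -/
def testToL2 (n : ℕ) {M : Type*} [TopologicalSpace M] [ChartedSpace (Euc n) M]
    [MeasurableSpace M] [T2Space M] [SecondCountableTopology M] [BorelSpace M]
    {ν : Measure M} {V : M → ℝ} (hV : ∀ x, 0 < V x) (hVi : LocallyIntegrable V ν) :
    TestFn n M →ₗ[ℝ] WeightedL2 ν V where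
  toFun u := (TestFn.memLp hV hVi u.2).toLp u.1
  map_add' _ _ := rfl
  map_smul' _ _ := rfl

theorem coeFn_testToL2 (hV : ∀ x, 0 < V x) (hVi : LocallyIntegrable V ν) (u : TestFn n M) :
    testToL2 n hV hVi u =ᵐ[weighted ν V] u.1 :=
  (TestFn.memLp hV hVi u.2).coeFn_toLp

theorem inner_testToL2 (hV : ∀ x, 0 < V x) (hVi : LocallyIntegrable V ν) (g : WeightedL2 ν V)
    (v : TestFn n M) : inner ℝ g (testToL2 n hV hVi v) = ∫ x, g x * v.1 x ∂(weighted ν V) := by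
  rw [L2.inner_def]
  refine integral_congr_ae ?_
  filter_upwards [coeFn_testToL2 hV hVi v] with x hx
  rw [hx, real_inner_eq_re_inner, RCLike.inner_apply]
  simp [mul_comm]

theorem norm_testToL2_sq (hV : ∀ x, 0 < V x) (hVi : LocallyIntegrable V ν) (u : TestFn n M) :
    ‖testToL2 n hV hVi u‖ ^ 2 = ∫ x, V x * u.1 x ^ 2 ∂ν := by
  rw [← real_inner_self_eq_norm_sq, inner_testToL2,
    ← integral_weighted hV hVi.aestronglyMeasurable.aemeasurable]
  refine integral_congr_ae ?_
  filter_upwards [coeFn_testToL2 hV hVi u] with x hx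
  rw [hx, sq]

end WeightedL2

section Embedding

variable {n : ℕ} {M : Type*} [TopologicalSpace M] [ChartedSpace (Euc n) M]
  [MeasurableSpace M] {ν : Measure M}
  [T2Space M] [SecondCountableTopology M] [BorelSpace M] [IsManifold 𝓘(ℝ, Euc n) ∞ M]
  [IsLocallyLebesgue n ν]
  {P : DivFormOperator n M ν} (hP : P.Nonneg) {V : M → ℝ} (hV : ∀ x, 0 < V x)
  (hVi : LocallyIntegrable V ν)

/-- The inclusion `C₀^∞ → L²(V dν)`, bounded for the norm of `𝒟^{1,2}`. -/
def preEmbedding : PreD12 P hP hV hVi →L[ℝ] WeightedL2 ν V :=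
  LinearMap.mkContinuous (show PreD12 P hP hV hVi →ₗ[ℝ] WeightedL2 ν V from testToL2 n hV hVi) 1
    fun u => by
      rw [one_mul]
      refine le_of_sq_le_sq ?_ (norm_nonneg _)
      rw [PreD12.norm_sq_eq]
      refine (norm_testToL2_sq hV hVi u).trans_le ?_
      exact le_add_of_nonneg_left (hP _ u.toFun_mem)

theorem preEmbedding_apply (u : PreD12 P hP hV hVi) :
    preEmbedding hP hV hVi u = testToL2 n hV hVi ⟨u.toFun, u.toFun_mem⟩ := rfl

/-- The embedding `𝒟^{1,2} → L²(V dν)`: the extension of the inclusion of the test functions to the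
completion. -/
def embedding : D12 P hP hV hVi →L[ℝ] WeightedL2 ν V :=
  (preEmbedding hP hV hVi).extend UniformSpace.Completion.toComplL

theorem embedding_coe (u : PreD12 P hP hV hVi) :
    embedding hP hV hVi (u : D12 P hP hV hVi) = preEmbedding hP hV hVi u :=
  ContinuousLinearMap.extend_eq _ UniformSpace.Completion.denseRange_coe
    (UniformSpace.Completion.isUniformInducing_coe _) u

theorem isCompactOperator_embedding (hS : SmallModuloFinite P V univ) :
    IsCompactOperator (embedding hP hV hVi) := by
  classical
  refine isCompactOperator_of_totallyBounded _ _ (embedding_coe hP hV hVi)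
    (totallyBounded_image_ball_of_finset _ fun ε hε => ?_)
  obtain ⟨s, C, hC, h1, h2⟩ := hS ε hε
  have hq : ∀ u : PreD12 P hP hV hVi, P.q u.toFun ≤ ‖u‖ ^ 2 := by
    intro u
    rw [PreD12.norm_sq_eq]
    exact le_add_of_nonneg_right (integral_nonneg fun x => mul_nonneg (hV x).le (sq_nonneg _))
  refine ⟨s, C, hC, fun ℓ hℓ u => (h1 ℓ hℓ u).trans (mul_le_mul_of_nonneg_left (hq u) hC),
    fun u => ?_⟩
  have hs : 0 ≤ ∑ ℓ ∈ s, ℓ u ^ 2 := Finset.sum_nonneg fun _ _ => sq_nonneg _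
  have hq0 := hP _ u.toFun_mem
  have h3 : ‖preEmbedding hP hV hVi u‖ ^ 2 ≤ ε * P.q u.toFun + C * ∑ ℓ ∈ s, ℓ u ^ 2 := by
    refine (norm_testToL2_sq hV hVi u).trans_le ?_
    have h4 := h2 ⟨u.toFun, u.toFun_mem⟩
    rw [setLIntegral_univ, ← ofReal_integral_eq_lintegral_ofReal] at h4
    · exact (ENNReal.ofReal_le_ofReal_iff (by positivity)).1 h4
    · simpa only [sq] using integrable_mul_testFn hVi u.toFun_mem u.toFun_mem
    · exact Eventually.of_forall fun x => mul_nonneg (hV x).le (sq_nonneg _)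
  exact h3.trans (add_le_add (mul_le_mul_of_nonneg_left (hq u) hε.le) le_rfl)

end Embedding

/-! ### Closability of the form -/

section ClosableEuclidean

/-- The hypothesis is the parametric form of `|b| ≤ 2 √(c a)`. -/
theorem tendsto_zero_of_forall_abs_le {a b : ℕ → ℝ} {c : ℝ} (ha : Tendsto a atTop (𝓝 0))
    (h : ∀ t : ℝ, 0 < t → ∀ k, |b k| ≤ t * a k + c / t) : Tendsto b atTop (𝓝 0) := by
  rw [Metric.tendsto_atTop]
  intro ε hε
  set t := 2 * (|c| + 1) / ε with ht
  have ht0 : 0 < t := by positivity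
  have h1 : Tendsto (fun k => t * a k) atTop (𝓝 (t * 0)) := ha.const_mul t
  rw [mul_zero] at h1
  obtain ⟨N, hN⟩ := eventually_atTop.1 (h1.eventually_lt_const (half_pos hε))
  refine ⟨N, fun k hk => ?_⟩
  have h2 := h t ht0 k
  have h3 : c / t ≤ ε / 2 := by
    rw [ht, div_div_eq_mul_div, div_le_iff₀ (by positivity)]
    have := mul_le_mul_of_nonneg_right (le_abs_self c) hε.le
    linarith
  rw [Real.dist_eq, sub_zero]
  linarith [hN k hk]

variable {n : ℕ}

/-- The gradient of smooth functions is closable in `L²`: if the gradients are Cauchy and the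
functions tend to `0`, so do the gradients on a smaller ball. -/
theorem tendsto_setIntegral_fderiv_sq (y : Euc n) {r R : ℝ} (hr : 0 < r) (hrR : r < R)
    {f : ℕ → Euc n → ℝ} (hf : ∀ k, ContDiff ℝ ∞ (f k))
    (hcau : ∀ ε : ℝ, 0 < ε → ∃ N, ∀ k ≥ N,
      ∫ z in Metric.closedBall y R, ‖fderiv ℝ (f k - f N) z‖ ^ 2 ≤ ε)
    (h0 : Tendsto (fun k => ∫ z in Metric.closedBall y R, f k z ^ 2) atTop (𝓝 0)) :
    Tendsto (fun k => ∫ z in Metric.closedBall y r, ‖fderiv ℝ (f k) z‖ ^ 2) atTop (𝓝 0) := by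
  obtain ⟨L, -, hL⟩ := exists_cutoff_bound
  obtain ⟨η, hη, hη0, hη1, hηr, hηR, -, -⟩ := hL n y r R hr hrR
  have hηR' : ∀ z ∉ Metric.closedBall y R, η z = 0 := fun z hz =>
    hηR z fun h => hz (Metric.ball_subset_closedBall h)
  have hηs : HasCompactSupport η := HasCompactSupport.intro (isCompact_closedBall y R) hηR'
  have hηc := hη.continuous
  have hfc : ∀ k, Continuous (f k) := fun k => (hf k).continuous
  have hfd : ∀ k, Continuous (fderiv ℝ (f k)) := fun k => (hf k).continuous_fderiv (by simp)
  set e : Fin n → Euc n := fun i => EuclideanSpace.single i 1 with he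
  have hd : ∀ i k, Continuous fun z => fderiv ℝ (f k) z (e i) := fun i k =>
    (hfd k).clm_apply continuous_const
  have hint : ∀ (F : Euc n → ℝ) (ρ : ℝ), Continuous F →
      IntegrableOn F (Metric.closedBall y ρ) := fun F ρ hF =>
    hF.continuousOn.integrableOn_compact (isCompact_closedBall _ _)
  have hintη : ∀ F : Euc n → ℝ, Continuous F → Integrable fun z => η z * F z := fun F hF =>
    (hηc.mul hF).integrable_of_hasCompactSupport hηs.mul_right
  -- integrating by parts, the gradients are weakly null against a fixed member of the sequence
  have hweak : ∀ i N, Tendsto (fun k => ∫ z, η z * (fderiv ℝ (f N) z (e i) *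
      fderiv ℝ (f k) z (e i))) atTop (𝓝 0) := by
    intro i N
    set g : Euc n → ℝ := fun z => η z * fderiv ℝ (f N) z (e i) with hg
    have hgd : ContDiff ℝ ∞ g := hη.mul
      (((hf N).fderiv_right (m := ∞) (by simp)).clm_apply contDiff_const)
    have hgs : HasCompactSupport g := hηs.mul_right
    have hg0 : ∀ z ∉ Metric.closedBall y R, g z = 0 := fun z hz => by simp [hg, hηR' z hz]
    have hgdc : Continuous fun z => fderiv ℝ g z (e i) :=
      (hgd.continuous_fderiv (by simp)).clm_apply continuous_const
    have hgds : HasCompactSupport fun z => fderiv ℝ g z (e i) :=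
      (hgs.fderiv ℝ).comp_left (g := fun T : Euc n →L[ℝ] ℝ => T (e i)) (by simp)
    have hgd0 : ∀ z ∉ Metric.closedBall y R, fderiv ℝ g z (e i) = 0 := by
      intro z hz
      have : g =ᶠ[𝓝 z] fun _ => 0 := by
        filter_upwards [Metric.isClosed_closedBall.isOpen_compl.mem_nhds hz] with w hw
        exact hg0 w hw
      rw [this.fderiv_eq]; simp
    have hibp : ∀ k, ∫ z, η z * (fderiv ℝ (f N) z (e i) * fderiv ℝ (f k) z (e i)) =
        -∫ z in Metric.closedBall y R, fderiv ℝ g z (e i) * f k z := by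
      intro k
      rw [setIntegral_eq_integral_of_forall_compl_eq_zero
        (fun z hz => by rw [hgd0 z hz, zero_mul]),
        ← integral_mul_fderiv_eq_neg_fderiv_mul_of_integrable]
      · simp only [hg, mul_assoc]
      · exact (hgdc.mul (hfc k)).integrable_of_hasCompactSupport hgds.mul_right
      · exact (hgd.continuous.mul (hd i k)).integrable_of_hasCompactSupport hgs.mul_right
      · exact (hgd.continuous.mul (hfc k)).integrable_of_hasCompactSupport hgs.mul_right
      · exact fun z _ => hgd.differentiable (by simp) z
      · exact fun z _ => (hf k).differentiable (by simp) z
    refine tendsto_zero_of_forall_abs_le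
      (c := ∫ z in Metric.closedBall y R, (fderiv ℝ g z (e i)) ^ 2) h0 fun t ht k => ?_
    rw [hibp, abs_neg]
    refine (abs_integral_le_integral_abs).trans ?_
    rw [← integral_const_mul, ← integral_div, ← integral_add
      (hint _ R (by fun_prop)) (hint _ R (by fun_prop))]
    refine integral_mono (hint _ R (by fun_prop)) (hint _ R (by fun_prop)) fun z => ?_
    simp only
    set p := fderiv ℝ g z (e i)
    rw [← sub_nonneg]
    have h1 : t * f k z ^ 2 + p ^ 2 / t - |p * f k z| =
        (t * |f k z| - |p|) ^ 2 / t + |p| * |f k z| := by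
      rw [abs_mul, ← sq_abs (f k z), ← sq_abs p]
      field_simp
      ring
    rw [h1]
    positivity
  have hcomp : ∀ i, Tendsto (fun k => ∫ z in Metric.closedBall y r,
      (fderiv ℝ (f k) z (e i)) ^ 2) atTop (𝓝 0) := by
    intro i
    rw [Metric.tendsto_atTop]
    intro ε hε
    obtain ⟨N, hN⟩ := hcau (ε / 2) (half_pos hε)
    have h1 := (hweak i N).eventually_lt_const (by positivity : 0 < ε / 4)
    obtain ⟨N', hN'⟩ := eventually_atTop.1 h1
    refine ⟨max N N', fun k hk => ?_⟩
    have hkN := hN k ((le_max_left _ _).trans hk)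
    have hkN' := hN' k ((le_max_right _ _).trans hk)
    rw [Real.dist_eq, sub_zero, abs_of_nonneg (integral_nonneg fun z => sq_nonneg _)]
    have hNk : Continuous fun z => fderiv ℝ (f N) z (e i) * fderiv ℝ (f k) z (e i) :=
      (hd i N).mul (hd i k)
    have hdiff : Continuous fun z => (fderiv ℝ (f k) z (e i) - fderiv ℝ (f N) z (e i)) ^ 2 :=
      ((hd i k).sub (hd i N)).pow 2
    have e1 : ∫ z in Metric.closedBall y r, (fderiv ℝ (f k) z (e i)) ^ 2 ≤
        ∫ z, η z * (fderiv ℝ (f k) z (e i)) ^ 2 := by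
      rw [setIntegral_congr_fun Metric.isClosed_closedBall.measurableSet
        (g := fun z => η z * (fderiv ℝ (f k) z (e i)) ^ 2)
        fun z hz => by simp only [hηr z hz, one_mul]]
      exact setIntegral_le_integral (hintη _ ((hd i k).pow 2))
        (Eventually.of_forall fun z => mul_nonneg (hη0 z) (sq_nonneg _))
    -- `a² ≤ (a - b)² + 2ab`: the first term is small by the Cauchy property, the second is weakly
    -- null
    have e2 : ∫ z, η z * (fderiv ℝ (f k) z (e i)) ^ 2 ≤
        (∫ z, η z * (fderiv ℝ (f k) z (e i) - fderiv ℝ (f N) z (e i)) ^ 2) +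
        2 * ∫ z, η z * (fderiv ℝ (f N) z (e i) * fderiv ℝ (f k) z (e i)) := by
      rw [← integral_const_mul, ← integral_add (hintη _ hdiff)
        ((hintη _ hNk).const_mul 2)]
      refine integral_mono (hintη _ ((hd i k).pow 2)) ((hintη _ hdiff).add
        ((hintη _ hNk).const_mul 2)) fun z => ?_
      simp only
      have := mul_nonneg (hη0 z) (sq_nonneg (fderiv ℝ (f N) z (e i)))
      linarith
    have e3 : ∫ z, η z * (fderiv ℝ (f k) z (e i) - fderiv ℝ (f N) z (e i)) ^ 2 ≤
        ∫ z in Metric.closedBall y R, ‖fderiv ℝ (f k - f N) z‖ ^ 2 := by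
      rw [← setIntegral_eq_integral_of_forall_compl_eq_zero (s := Metric.closedBall y R)
        (fun z hz => by rw [hηR' z hz, zero_mul])]
      have hc : Continuous fun z => ‖fderiv ℝ (f k - f N) z‖ ^ 2 :=
        (((hf k).sub (hf N)).continuous_fderiv (by simp)).norm.pow 2
      refine integral_mono (hintη _ hdiff).integrableOn (hint _ R hc) fun z => ?_
      have h2 : fderiv ℝ (f k - f N) z = fderiv ℝ (f k) z - fderiv ℝ (f N) z :=
        fderiv_sub ((hf k).differentiable (by simp) z) ((hf N).differentiable (by simp) z)
      have h3 : (fderiv ℝ (f k) z (e i) - fderiv ℝ (f N) z (e i)) ^ 2 ≤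
          ‖fderiv ℝ (f k - f N) z‖ ^ 2 := by
        rw [h2, ← _root_.sub_apply, ← sq_abs]
        refine pow_le_pow_left₀ (abs_nonneg _) ?_ 2
        have := (fderiv ℝ (f k) z - fderiv ℝ (f N) z).le_opNorm (e i)
        simpa [he] using this
      calc η z * (fderiv ℝ (f k) z (e i) - fderiv ℝ (f N) z (e i)) ^ 2 ≤
            1 * ‖fderiv ℝ (f k - f N) z‖ ^ 2 :=
            mul_le_mul (hη1 z) h3 (sq_nonneg _) zero_le_one
        _ = _ := one_mul _
    linarith
  have hsum := tendsto_finsetSum (Finset.univ : Finset (Fin n)) fun i _ => hcomp i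
  rw [Finset.sum_const_zero] at hsum
  refine squeeze_zero (fun k => integral_nonneg fun z => sq_nonneg _) (fun k => ?_) hsum
  have hd2 : ∀ i, Continuous fun z => (fderiv ℝ (f k) z (e i)) ^ 2 := fun i => (hd i k).pow 2
  rw [← integral_finsetSum _ fun i _ => hint _ r (hd2 i)]
  refine integral_mono (hint _ r ((hfd k).norm.pow 2))
    (hint _ r (continuous_finsetSum _ fun i _ => hd2 i)) fun z => ?_
  simp only
  set ξ := fderiv ℝ (f k) z with hξ
  have hS : 0 ≤ ∑ i, ξ (e i) ^ 2 := Finset.sum_nonneg fun _ _ => sq_nonneg _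
  have hn : ‖ξ‖ ≤ Real.sqrt (∑ i, ξ (e i) ^ 2) := by
    refine ξ.opNorm_le_bound (Real.sqrt_nonneg _) fun v => ?_
    have h1 : ξ v = ∑ i, ξ (e i) * v i := by
      conv_lhs => rw [covector_eq_sum ξ]
      simp [he]
    rw [h1, Real.norm_eq_abs, EuclideanSpace.norm_eq, ← Real.sqrt_mul hS]
    refine Real.abs_le_sqrt ?_
    simp only [Real.norm_eq_abs, sq_abs]
    exact Finset.sum_mul_sq_le_sq_mul_sq _ _ _
  calc ‖ξ‖ ^ 2 ≤ Real.sqrt (∑ i, ξ (e i) ^ 2) ^ 2 := by gcongr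
    _ = _ := Real.sq_sqrt hS

end ClosableEuclidean

section Closable

variable {n : ℕ} {M : Type*} [TopologicalSpace M] [ChartedSpace (Euc n) M]
  [MeasurableSpace M] {ν : Measure M}
  [T2Space M] [BorelSpace M] [IsManifold 𝓘(ℝ, Euc n) ∞ M] [IsLocallyLebesgue n ν]

theorem TestFn.integrable_sq {u : M → ℝ} (hu : u ∈ TestFn n M) :
    Integrable (fun x => u x ^ 2) ν := by
  have : IsLocallyFiniteMeasure ν := isLocallyFinite_of_isLocallyLebesgue (n := n)
  have hs : HasCompactSupport fun x => u x ^ 2 :=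
    hu.2.comp_left (g := fun a : ℝ => a ^ 2) (by simp)
  exact (hu.1.continuous.pow 2).integrable_of_hasCompactSupport hs

/-- A sequence that is Cauchy in `L²(K)` and tends to `0` in a weighted `L²` space with positive
weight tends to `0` in `L²(K)`. -/
theorem tendsto_setIntegral_sq_of_weighted {V : M → ℝ} (hV : ∀ x, 0 < V x)
    (hVi : LocallyIntegrable V ν) (hVm : AEMeasurable V ν) {u : ℕ → M → ℝ}
    (hu : ∀ k, u k ∈ TestFn n M) {K : Set M} (hK : IsCompact K)
    (hcau : ∀ ε : ℝ, 0 < ε → ∃ N, ∀ k ≥ N, ∫ x in K, (u k x - u N x) ^ 2 ∂ν ≤ ε)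
    (h0 : Tendsto (fun k => ∫ x, V x * u k x ^ 2 ∂ν) atTop (𝓝 0)) :
    Tendsto (fun k => ∫ x in K, u k x ^ 2 ∂ν) atTop (𝓝 0) := by
  have hloc : IsLocallyFiniteMeasure ν := isLocallyFinite_of_isLocallyLebesgue (n := n)
  have hKm : MeasurableSet K := hK.isClosed.measurableSet
  rw [Metric.tendsto_atTop]
  intro ε hε
  obtain ⟨N, hN⟩ := hcau (ε / 8) (by positivity)
  -- `u N` has small `L²` norm where the weight is small
  obtain ⟨δ, hδ, hsmall⟩ : ∃ δ : ℝ, 0 < δ ∧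
      ∫ x in K, {x | V x ≤ δ}.indicator (fun x => u N x ^ 2) x ∂ν ≤ ε / 8 := by
    have hiN : IntegrableOn (fun x => u N x ^ 2) K ν := (TestFn.integrable_sq (hu N)).integrableOn
    have ht : Tendsto (fun m : ℕ => ∫ x in K,
        {x | V x ≤ 1 / ((m : ℝ) + 1)}.indicator (fun x => u N x ^ 2) x ∂ν) atTop
        (𝓝 (∫ _ in K, (0 : ℝ) ∂ν)) := by
      refine tendsto_integral_of_dominated_convergence (fun x => u N x ^ 2) (fun m => ?_) hiN
        (fun m => Eventually.of_forall fun x => ?_) (Eventually.of_forall fun x => ?_)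
      · exact hiN.aestronglyMeasurable.indicator₀
          ((nullMeasurableSet_le hVm aemeasurable_const).mono_ac
            Measure.absolutelyContinuous_restrict)
      · rw [Real.norm_of_nonneg (indicator_nonneg (fun x _ => sq_nonneg _) _)]
        exact indicator_le_self' (fun x _ => sq_nonneg _) x
      · obtain ⟨m, hm⟩ := exists_nat_one_div_lt (hV x)
        refine tendsto_const_nhds.congr' ?_
        filter_upwards [eventually_ge_atTop m] with k hk
        rw [indicator_of_notMem]
        have : 1 / ((k : ℝ) + 1) ≤ 1 / ((m : ℝ) + 1) := Nat.one_div_le_one_div hk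
        intro h
        have h' : V x ≤ 1 / ((k : ℝ) + 1) := h
        linarith
    rw [integral_zero] at ht
    obtain ⟨m, hm⟩ := (ht.eventually_le_const (by positivity : 0 < ε / 8)).exists
    exact ⟨_, by positivity, hm⟩
  have h1 : Tendsto (fun k => δ⁻¹ * ∫ x, V x * u k x ^ 2 ∂ν) atTop (𝓝 (δ⁻¹ * 0)) :=
    h0.const_mul _
  rw [mul_zero] at h1
  obtain ⟨N', hN'⟩ := eventually_atTop.1 (h1.eventually_lt_const (by positivity : 0 < ε / 8))
  refine ⟨max N N', fun k hk => ?_⟩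
  have hkN := hN k ((le_max_left _ _).trans hk)
  have hkN' := hN' k ((le_max_right _ _).trans hk)
  rw [Real.dist_eq, sub_zero, abs_of_nonneg (integral_nonneg fun z => sq_nonneg _)]
  have ik : Integrable (fun x => u k x ^ 2) ν := TestFn.integrable_sq (hu k)
  have iN : Integrable (fun x => u N x ^ 2) ν := TestFn.integrable_sq (hu N)
  have iD : Integrable (fun x => (u k x - u N x) ^ 2) ν :=
    TestFn.integrable_sq (n := n) ((TestFn n M).sub_mem (hu k) (hu N))
  have iV : Integrable (fun x => V x * u k x ^ 2) ν := by
    simpa only [sq] using integrable_mul_testFn hVi (hu k) (hu k)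
  have iS : IntegrableOn ({x | V x ≤ δ}.indicator fun x => u N x ^ 2) K ν :=
    (iN.indicator₀ (nullMeasurableSet_le hVm aemeasurable_const)).integrableOn
  have h2 : ∫ x in K, u k x ^ 2 ∂ν ≤ 2 * (∫ x in K, (u k x - u N x) ^ 2 ∂ν) +
      2 * (∫ x in K, {x | V x ≤ δ}.indicator (fun x => u N x ^ 2) x ∂ν) +
      δ⁻¹ * ∫ x in K, V x * u k x ^ 2 ∂ν := by
    have e1 := integral_add' ((iD.integrableOn (s := K)).const_mul 2 |>.add (iS.const_mul 2))
      ((iV.integrableOn (s := K)).const_mul δ⁻¹)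
    have e2 := integral_add' ((iD.integrableOn (s := K)).const_mul 2) (iS.const_mul 2)
    rw [e2] at e1
    simp only [integral_const_mul] at e1
    rw [← e1]
    refine integral_mono ik.integrableOn ((((iD.integrableOn (s := K)).const_mul 2).add
      (iS.const_mul 2)).add ((iV.integrableOn (s := K)).const_mul δ⁻¹)) fun x => ?_
    simp only [Pi.add_apply]
    by_cases hx : V x ≤ δ
    · rw [indicator_of_mem (show x ∈ {x | V x ≤ δ} from hx)]
      have : 0 ≤ δ⁻¹ * (V x * u k x ^ 2) := by have := (hV x).le; positivity
      have : 0 ≤ (u k x - 2 * u N x) ^ 2 := sq_nonneg _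
      linarith
    · rw [indicator_of_notMem (show x ∉ {x | V x ≤ δ} from hx)]
      have h3 : 1 ≤ δ⁻¹ * V x := by
        rw [inv_mul_eq_div, one_le_div hδ]; exact (not_le.1 hx).le
      have h4 := mul_le_mul_of_nonneg_right h3 (sq_nonneg (u k x))
      have : 0 ≤ (u k x - u N x) ^ 2 := sq_nonneg _
      linarith
  have h3 : ∫ x in K, V x * u k x ^ 2 ∂ν ≤ ∫ x, V x * u k x ^ 2 ∂ν :=
    setIntegral_le_integral iV (Eventually.of_forall fun x => mul_nonneg (hV x).le (sq_nonneg _))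
  have h4 := mul_le_mul_of_nonneg_left h3 (by positivity : 0 ≤ δ⁻¹)
  linarith

/-- The local energies of a `q`-Cauchy sequence that tends to `0` in `L²(V dν)` tend to `0`. -/
theorem exists_nhds_tendsto_energy {P : DivFormOperator n M ν} (hP : P.Nonneg) {W : M → ℝ}
    (hW : ∀ x, 0 < W x) (hWm : AEMeasurable W ν) {l : ℝ≥0} (hl : 0 < l) (hH : P.Hardy W l)
    {V : M → ℝ} (hV : ∀ x, 0 < V x) (hVi : LocallyIntegrable V ν) (hVm : AEMeasurable V ν)
    {u : ℕ → M → ℝ} (hu : ∀ k, u k ∈ TestFn n M)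
    (hcau : ∀ ε : ℝ, 0 < ε → ∃ N, ∀ i ≥ N, ∀ j ≥ N, P.q (u i - u j) < ε)
    (h0 : Tendsto (fun k => ∫ x, V x * u k x ^ 2 ∂ν) atTop (𝓝 0)) (x₀ : M) :
    ∃ S ∈ 𝓝 x₀, Tendsto (fun k => ∫⁻ x in S,
      ENNReal.ofReal (P.energy (u k) (u k) x + u k x ^ 2) ∂ν) atTop (𝓝 0) := by
  have hloc : IsLocallyFiniteMeasure ν := isLocallyFinite_of_isLocallyLebesgue (n := n)
  obtain ⟨B, hx₀, hxc, C, hC, hB⟩ := exists_coordBall_integral_le P hP hW hWm hl hH x₀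
  have hR := B.radius_pos
  have hcau' : ∀ c : ℝ, 0 ≤ c → ∀ ε : ℝ, 0 < ε → ∃ N, ∀ k ≥ N, c * P.q (u k - u N) ≤ ε := by
    intro c hc ε hε
    obtain ⟨N, hN⟩ := hcau (ε / (c + 1)) (by positivity)
    refine ⟨N, fun k hk => ?_⟩
    have h1 := hN k hk N le_rfl
    rw [lt_div_iff₀ (by positivity)] at h1
    have := hP _ ((TestFn n M).sub_mem (hu k) (hu N))
    linarith
  obtain ⟨a, b, ha, hb, -, hlow, hup⟩ := B.exists_integral_bounds ν
  have hcm := B.measurableSet_carrier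
  have hL2 : Tendsto (fun k => ∫ x in B.carrier, u k x ^ 2 ∂ν) atTop (𝓝 0) := by
    refine tendsto_setIntegral_sq_of_weighted hV hVi hVm hu B.isCompact_carrier ?_ h0
    intro ε hε
    obtain ⟨N, hN⟩ := hcau' (b * C) (by positivity) ε hε
    refine ⟨N, fun k hk => ?_⟩
    have hw := (TestFn n M).sub_mem (hu k) (hu N)
    have iw : Integrable (fun x => (u k x - u N x) ^ 2) ν := TestFn.integrable_sq (n := n) hw
    have hc : Continuous fun z => B.rep (u k - u N) z ^ 2 := (B.continuous_rep hw).pow 2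
    rw [← integral_indicator hcm]
    refine (hup _ _ hc (fun z => sq_nonneg _) (iw.indicator hcm)
      (Eventually.of_forall fun x hx => ?_) fun x hx => ?_).trans ?_
    · rw [indicator_of_mem hx, B.rep_chart _ hx]; rfl
    · rw [indicator_of_notMem hx]
    · refine le_trans ?_ (hN k hk)
      rw [mul_assoc]
      exact mul_le_mul_of_nonneg_left (hB _ hw).1 hb.le
  have hrep0 : Tendsto (fun k => ∫ z in B.ball, B.rep (u k) z ^ 2) atTop (𝓝 0) := by
    have h1 := hL2.const_mul a⁻¹
    rw [mul_zero] at h1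
    refine squeeze_zero (fun k => integral_nonneg fun z => sq_nonneg _) (fun k => ?_) h1
    rw [inv_mul_eq_div, le_div_iff₀ ha, mul_comm, ← integral_indicator hcm]
    refine hlow _ _ ((B.continuous_rep (hu k)).pow 2) (fun z => sq_nonneg _)
      ((TestFn.integrable_sq (hu k)).indicator hcm)
      (fun x => indicator_nonneg (fun _ _ => sq_nonneg _) _) (Eventually.of_forall fun x hx => ?_)
    rw [indicator_of_mem hx, B.rep_chart _ hx]
  have hr : B.radius / 2 < B.radius := by linarith
  set B' := B.shrink (half_pos hR) hr.le with hB'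
  have hgrad : Tendsto (fun k => ∫ z in B'.ball, ‖fderiv ℝ (B.rep (u k)) z‖ ^ 2) atTop (𝓝 0) := by
    refine tendsto_setIntegral_fderiv_sq B.center (half_pos hR) hr
      (fun k => B.contDiff_rep (hu k)) (fun ε hε => ?_) hrep0
    obtain ⟨N, hN⟩ := hcau' C hC ε hε
    refine ⟨N, fun k hk => ?_⟩
    rw [← B.rep_sub]
    exact (hB _ ((TestFn n M).sub_mem (hu k) (hu N))).2.trans (hN k hk)
  obtain ⟨θ, Θ, hθ, hΘ, hE⟩ := B.exists_energy_bounds P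
  obtain ⟨a', b', ha', hb', -, -, hup'⟩ := B'.exists_integral_bounds ν
  have hcm' := B'.measurableSet_carrier
  have hsub : B'.carrier ⊆ B.carrier := B.shrink_carrier_subset _ _
  refine ⟨B'.carrier, B'.carrier_mem_nhds hx₀ hxc, ?_⟩
  have hEn : ∀ k, ∫ x in B'.carrier, P.energy (u k) (u k) x ∂ν ≤
      b' * Θ * ∫ z in B'.ball, ‖fderiv ℝ (B.rep (u k)) z‖ ^ 2 := by
    intro k
    rw [← integral_indicator hcm', mul_assoc, ← integral_const_mul]
    refine hup' _ _ (continuous_const.mul ((B.continuous_fderiv_rep (hu k)).norm.pow 2))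
      (fun z => by positivity) ((P.integrable_energy (hu k) (hu k)).indicator hcm') ?_
      fun x hx => ?_
    · filter_upwards [hE] with x hx hxB
      rw [indicator_of_mem hxB]
      exact (hx (hsub hxB) _ _ (B.diffAt_eq_rep (hu k) (hsub hxB))).2
    · rw [indicator_of_notMem hx]
  have hlim : Tendsto (fun k => ENNReal.ofReal ((b' * Θ * ∫ z in B'.ball,
      ‖fderiv ℝ (B.rep (u k)) z‖ ^ 2) + ∫ x in B.carrier, u k x ^ 2 ∂ν)) atTop (𝓝 0) := by
    have := ENNReal.tendsto_ofReal ((hgrad.const_mul (b' * Θ)).add hL2)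
    simpa using this
  refine tendsto_of_tendsto_of_tendsto_of_le_of_le tendsto_const_nhds hlim (fun k => zero_le)
    fun k => ?_
  have iE := P.integrable_energy (hu k) (hu k)
  have iu : Integrable (fun x => u k x ^ 2) ν := TestFn.integrable_sq (hu k)
  have iEu : Integrable (fun x => P.energy (u k) (u k) x + u k x ^ 2) ν := iE.add iu
  rw [← ofReal_integral_eq_lintegral_ofReal iEu.integrableOn
    (Eventually.of_forall fun x => add_nonneg (P.energy_self_nonneg _ _) (sq_nonneg _))]
  refine ENNReal.ofReal_le_ofReal ?_
  rw [integral_add iE.integrableOn iu.integrableOn]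
  exact add_le_add (hEn k) (setIntegral_mono_set iu.integrableOn
    (Eventually.of_forall fun x => sq_nonneg _) hsub.eventuallyLE)

/-- Closability of `q`: a `q`-Cauchy sequence of test functions that tends to `0` in `L²(V dν)` is
weakly null for the form. -/
theorem tendsto_form_zero {P : DivFormOperator n M ν} (hP : P.Nonneg) {W : M → ℝ}
    (hW : ∀ x, 0 < W x) (hWm : AEMeasurable W ν) {l : ℝ≥0} (hl : 0 < l) (hH : P.Hardy W l)
    {V : M → ℝ} (hV : ∀ x, 0 < V x) (hVi : LocallyIntegrable V ν) (hVm : AEMeasurable V ν)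
    {u : ℕ → M → ℝ} (hu : ∀ k, u k ∈ TestFn n M)
    (hcau : ∀ ε : ℝ, 0 < ε → ∃ N, ∀ i ≥ N, ∀ j ≥ N, P.q (u i - u j) < ε)
    (h0 : Tendsto (fun k => ∫ x, V x * u k x ^ 2 ∂ν) atTop (𝓝 0)) {v : M → ℝ}
    (hv : v ∈ TestFn n M) : Tendsto (fun k => P.form (u k) v) atTop (𝓝 0) := by
  have hloc : IsLocallyFiniteMeasure ν := isLocallyFinite_of_isLocallyLebesgue (n := n)
  set K := tsupport v with hK
  have hKc : IsCompact K := hv.2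
  have hKm : MeasurableSet K := hKc.isClosed.measurableSet
  have iE : ∀ k, Integrable (fun x => P.energy (u k) (u k) x + u k x ^ 2) ν := fun k =>
    (P.integrable_energy (hu k) (hu k)).add (TestFn.integrable_sq (hu k))
  have hlint : Tendsto (fun k => ∫⁻ x in K,
      ENNReal.ofReal (P.energy (u k) (u k) x + u k x ^ 2) ∂ν) atTop (𝓝 0) := by
    refine hKc.induction_on (p := fun S => Tendsto (fun k => ∫⁻ x in S,
      ENNReal.ofReal (P.energy (u k) (u k) x + u k x ^ 2) ∂ν) atTop (𝓝 0)) (by simp)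
      (fun S T hST hT => ?_) (fun S T hS hT => ?_) fun x _ => ?_
    · exact tendsto_of_tendsto_of_tendsto_of_le_of_le tendsto_const_nhds hT (fun k => zero_le)
        fun k => lintegral_mono_set hST
    · have := hS.add hT
      rw [add_zero] at this
      exact tendsto_of_tendsto_of_tendsto_of_le_of_le tendsto_const_nhds this (fun k => zero_le)
        fun k => lintegral_union_le _ _ _
    · obtain ⟨S, hS, h⟩ := exists_nhds_tendsto_energy hP hW hWm hl hH hV hVi hVm hu hcau h0 x
      exact ⟨S, mem_nhdsWithin_of_mem_nhds hS, h⟩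
  have hreal : Tendsto (fun k => ∫ x in K, (P.energy (u k) (u k) x + u k x ^ 2) ∂ν) atTop
      (𝓝 0) := by
    have h1 := (ENNReal.tendsto_toReal ENNReal.zero_ne_top).comp hlint
    refine h1.congr fun k => ?_
    rw [Function.comp_apply, ← ofReal_integral_eq_lintegral_ofReal (iE k).integrableOn
      (Eventually.of_forall fun x => add_nonneg (P.energy_self_nonneg _ _) (sq_nonneg _)),
      ENNReal.toReal_ofReal (integral_nonneg fun x =>
        add_nonneg (P.energy_self_nonneg _ _) (sq_nonneg _))]
  obtain ⟨C, hC⟩ := P.bdd_c K hKc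
  have iv : Integrable (fun x => P.energy v v x + C ^ 2 * v x ^ 2) ν :=
    (P.integrable_energy hv hv).add ((TestFn.integrable_sq hv).const_mul _)
  refine tendsto_zero_of_forall_abs_le (c := ∫ x in K, (P.energy v v x + C ^ 2 * v x ^ 2) ∂ν)
    hreal fun t ht k => ?_
  have hform : P.form (u k) v = ∫ x in K, P.density (u k) v x ∂ν := by
    rw [DivFormOperator.form, setIntegral_eq_integral_of_forall_compl_eq_zero]
    intro x hx
    simp [DivFormOperator.density, diffAt_eq_zero hx, image_eq_zero_of_notMem_tsupport hx]
  rw [hform]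
  refine abs_integral_le_integral_abs.trans ?_
  rw [← integral_const_mul, ← integral_div, ← integral_add ((iE k).integrableOn.const_mul t)
    (iv.integrableOn.div_const t)]
  refine integral_mono_ae (P.integrable_density (hu k) hv).abs.integrableOn
    (((iE k).integrableOn.const_mul t).add (iv.integrableOn.div_const t)) ?_
  filter_upwards [ae_restrict_mem hKm, ae_restrict_of_ae hC] with x hx hxC
  rw [DivFormOperator.density_eq]
  have h1 := P.abs_energy_le (u k) v x t 1
  rw [mul_one, abs_mul, abs_of_pos ht] at h1
  have h2 : |P.c x * (u k x * v x)| ≤ C * (|u k x| * |v x|) := by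
    rw [abs_mul, abs_mul]
    exact mul_le_mul_of_nonneg_right (hxC hx) (by positivity)
  have h3 : 0 ≤ (t * |u k x| - C * |v x|) ^ 2 := sq_nonneg _
  have h4 : t * (C * (|u k x| * |v x|)) ≤ t ^ 2 * u k x ^ 2 / 2 + C ^ 2 * v x ^ 2 / 2 := by
    rw [← sq_abs (u k x), ← sq_abs (v x)]
    linarith
  refine (abs_add_le _ _).trans ?_
  have hEu := P.energy_self_nonneg (u k) x
  have hEv := P.energy_self_nonneg v x
  have key : t * (|P.energy (u k) v x| + |P.c x * (u k x * v x)|) ≤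
      t ^ 2 * (P.energy (u k) (u k) x + u k x ^ 2) + (P.energy v v x + C ^ 2 * v x ^ 2) := by
    have h5 := mul_le_mul_of_nonneg_left h2 ht.le
    have h6 : 0 ≤ t ^ 2 * P.energy (u k) (u k) x := by positivity
    have h7 : 0 ≤ t ^ 2 * u k x ^ 2 := by positivity
    have h8 : 0 ≤ C ^ 2 * v x ^ 2 := by positivity
    linarith
  have e : t * (P.energy (u k) (u k) x + u k x ^ 2) + (P.energy v v x + C ^ 2 * v x ^ 2) / t =
      (t ^ 2 * (P.energy (u k) (u k) x + u k x ^ 2) + (P.energy v v x + C ^ 2 * v x ^ 2)) / t := by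
    field_simp
  rw [e, le_div_iff₀ ht]
  linarith

end Closable

/-! ### Unbounded operators with compact resolvent -/

section Enumeration

/-- An infinite set of reals with finite initial segments is the range of a strictly increasing
sequence tending to `+∞`. -/
theorem exists_strictMono_range_eq {E : Set ℝ} (hE : E.Infinite)
    (hfin : ∀ c, (E ∩ Iic c).Finite) :
    ∃ m : ℕ → ℝ, StrictMono m ∧ Tendsto m atTop atTop ∧ E = range m := by
  have hleast : ∀ A ⊆ E, A.Nonempty → ∃ a, IsLeast A a := by
    rintro A hA ⟨c, hc⟩
    obtain ⟨a, ha⟩ := ((hfin c).subset (inter_subset_inter_left _ hA)).exists_minimal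
      ⟨c, hc, mem_Iic.2 le_rfl⟩
    refine ⟨a, ha.1.1, fun b hb => ?_⟩
    by_contra h
    have hba : b < a := not_le.1 h
    exact h (ha.2 ⟨hb, hba.le.trans ha.1.2⟩ hba.le)
  have hunb : ∀ c, ∃ x ∈ E, c < x := by
    intro c
    by_contra! h
    exact hE ((hfin c).subset fun x hx => ⟨hx, h x hx⟩)
  obtain ⟨a₀, ha₀⟩ := hleast E subset_rfl hE.nonempty
  have hnext : ∀ c, ∃ a, IsLeast (E ∩ Ioi c) a := fun c =>
    hleast _ inter_subset_left (by obtain ⟨x, hx, hcx⟩ := hunb c; exact ⟨x, hx, hcx⟩)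
  choose next hn using hnext
  -- the sequence enumerates `E` by passing to the next element
  set m : ℕ → ℝ := fun k => Nat.rec a₀ (fun _ c => next c) k with hm
  have hms : ∀ k, m (k + 1) = next (m k) := fun _ => rfl
  have hmE : ∀ k, m k ∈ E := by
    intro k
    cases k with
    | zero => exact ha₀.1
    | succ k => exact (hn (m k)).1.1
  have hmono : StrictMono m := strictMono_nat_of_lt_succ fun k => (hn (m k)).1.2
  have hlarge : ∀ c, ∃ k, c < m k := by
    intro c
    by_contra! h
    exact (Set.infinite_range_of_injective hmono.injective)
      ((hfin c).subset (by rintro _ ⟨k, rfl⟩; exact ⟨hmE k, h k⟩))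
  refine ⟨m, hmono, ?_, ?_⟩
  · refine tendsto_atTop_atTop_of_monotone hmono.monotone fun c => ?_
    obtain ⟨k, hk⟩ := hlarge c
    exact ⟨k, hk.le⟩
  · refine Subset.antisymm (fun x hx => ?_) (by rintro _ ⟨k, rfl⟩; exact hmE k)
    by_contra hxr
    have hlt : ∀ k, m k < x := by
      intro k
      induction k with
      | zero => exact lt_of_le_of_ne (ha₀.2 hx) fun h => hxr ⟨0, h⟩
      | succ k ih => exact lt_of_le_of_ne ((hn (m k)).2 ⟨hx, ih⟩) fun h => hxr ⟨k + 1, h⟩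
    obtain ⟨k, hk⟩ := hlarge x
    exact (hlt k).not_gt hk

end Enumeration

section InverseOperator

variable {H : Type*} [NormedAddCommGroup H] [InnerProductSpace ℝ H]

open Module.End in
/-- A compact symmetric operator has only finitely many eigenvalues away from `0`. -/
theorem finite_setOf_hasEigenvalue_ge {S : H →L[ℝ] H} (hS : IsCompactOperator S)
    (hsym : ∀ f g, inner ℝ (S f) g = inner ℝ f (S g)) {δ : ℝ} (hδ : 0 < δ) :
    {μ : ℝ | HasEigenvalue (S : Module.End ℝ H) μ ∧ δ ≤ μ}.Finite := by
  by_contra hinf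
  have hinf' : {μ : ℝ | HasEigenvalue (S : Module.End ℝ H) μ ∧ δ ≤ μ}.Infinite := hinf
  set μ := hinf'.natEmbedding with hμ
  have hvec : ∀ k, ∃ e : H, ‖e‖ = 1 ∧ S e = (μ k : ℝ) • e := by
    intro k
    obtain ⟨v, hv⟩ := (μ k).2.1.exists_hasEigenvector
    have hv0 : ‖v‖ ≠ 0 := norm_ne_zero_iff.2 hv.2
    refine ⟨‖v‖⁻¹ • v, ?_, ?_⟩
    · rw [norm_smul, norm_inv, norm_norm, inv_mul_cancel₀ hv0]
    · have h1 : S v = (μ k : ℝ) • v := hv.apply_eq_smul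
      rw [map_smul, h1, smul_comm]
  -- eigenvectors for distinct eigenvalues are orthogonal, so their images stay at distance at least
  -- `δ` and have no Cauchy subsequence
  choose e he1 heS using hvec
  have horth : ∀ i j, i ≠ j → inner ℝ (e i) (e j) = 0 := by
    intro i j hij
    have h1 := hsym (e i) (e j)
    rw [heS, heS, real_inner_smul_left, real_inner_smul_right] at h1
    have h2 : (μ i : ℝ) - μ j ≠ 0 := by
      rw [sub_ne_zero]
      exact fun h => hij (μ.injective (Subtype.ext h))
    have h3 : ((μ i : ℝ) - μ j) * inner ℝ (e i) (e j) = 0 := by linarith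
    exact (mul_eq_zero.1 h3).resolve_left h2
  obtain ⟨K, hK, hKS⟩ := hS.image_closedBall_subset_compact (f := S.toLinearMap) 1
  have hmem : ∀ k, S (e k) ∈ K := fun k => hKS ⟨e k, by simp [he1 k], rfl⟩
  obtain ⟨a, -, φ, hφ, hlim⟩ := hK.tendsto_subseq hmem
  obtain ⟨N, hN⟩ := Metric.cauchySeq_iff.1 hlim.cauchySeq δ hδ
  have h1 := hN N le_rfl (N + 1) (Nat.le_succ N)
  have hne : φ N ≠ φ (N + 1) := (hφ (Nat.lt_succ_self N)).ne
  simp only [Function.comp_apply] at h1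
  rw [dist_eq_norm] at h1
  have h2 : ‖S (e (φ N)) - S (e (φ (N + 1)))‖ ^ 2 =
      (μ (φ N) : ℝ) ^ 2 + (μ (φ (N + 1)) : ℝ) ^ 2 := by
    rw [@norm_sub_sq_real, heS, heS, real_inner_smul_left, real_inner_smul_right, horth _ _ hne,
      norm_smul, norm_smul, he1, he1]
    simp
  have h3 : δ ≤ μ (φ N) := (μ (φ N)).2.2
  have h4 : δ ^ 2 ≤ (μ (φ N) : ℝ) ^ 2 := by gcongr
  have h5 : ‖S (e (φ N)) - S (e (φ (N + 1)))‖ ^ 2 < δ ^ 2 := by gcongr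
  have h6 : 0 ≤ (μ (φ (N + 1)) : ℝ) ^ 2 := sq_nonneg _
  linarith

/-- The graph of `S⁻¹ - 1`, written without an inverse: `f + g = S⁻¹ f`. -/
def inverseGraph (S : H →L[ℝ] H) : Submodule ℝ (H × H) where
  carrier := {p | p.1 = S (p.1 + p.2)}
  add_mem' := by
    rintro p q hp hq
    have hp' : p.1 = S (p.1 + p.2) := hp
    have hq' : q.1 = S (q.1 + q.2) := hq
    show p.1 + q.1 = S (p.1 + q.1 + (p.2 + q.2))
    rw [add_add_add_comm, map_add, ← hp', ← hq']
  zero_mem' := by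
    show (0 : H) = S (0 + 0)
    simp
  smul_mem' := by
    rintro t p hp
    have hp' : p.1 = S (p.1 + p.2) := hp
    show t • p.1 = S (t • p.1 + t • p.2)
    rw [← smul_add, map_smul, ← hp']

theorem mem_inverseGraph {S : H →L[ℝ] H} {f g : H} :
    (f, g) ∈ inverseGraph S ↔ f = S (f + g) := Iff.rfl

/-- The unbounded operator `S⁻¹ - 1` for an injective `S`. Injectivity makes `inverseGraph S` the
graph of an operator; without it the value is junk. -/
def inverseOperator (S : H →L[ℝ] H) : H →ₗ.[ℝ] H := (inverseGraph S).toLinearPMap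

variable {S : H →L[ℝ] H}

theorem mem_graph_inverseOperator (hinj : ∀ f, S f = 0 → f = 0) {f g : H} :
    (f, g) ∈ (inverseOperator S).graph ↔ f = S (f + g) := by
  rw [inverseOperator, Submodule.toLinearPMap_graph_eq, mem_inverseGraph]
  rintro ⟨f, g⟩ hp (h0 : f = 0)
  have hp' : f = S (f + g) := hp
  rw [h0, zero_add] at hp'
  exact hinj g hp'.symm

theorem inverseOperator_apply_eq_iff (hinj : ∀ f, S f = 0 → f = 0) {f g : H} :
    (∃ h : f ∈ (inverseOperator S).domain, inverseOperator S ⟨f, h⟩ = g) ↔ f = S (f + g) := by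
  rw [← mem_graph_inverseOperator hinj, LinearPMap.mem_graph_iff]
  constructor
  · rintro ⟨h, e⟩
    exact ⟨⟨f, h⟩, rfl, e⟩
  · rintro ⟨⟨x, hx⟩, e, e'⟩
    have e1 : x = f := e
    subst e1
    exact ⟨hx, e'⟩

theorem dense_domain_inverseOperator [CompleteSpace H] (hinj : ∀ f, S f = 0 → f = 0)
    (hsym : ∀ f g, inner ℝ (S f) g = inner ℝ f (S g)) :
    Dense ((inverseOperator S).domain : Set H) := by
  have hsub : LinearMap.range S.toLinearMap ≤ (inverseOperator S).domain := by
    rintro _ ⟨h, rfl⟩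
    obtain ⟨hd, -⟩ := (inverseOperator_apply_eq_iff hinj (f := S h) (g := h - S h)).2 (by simp)
    exact hd
  have hbot : (LinearMap.range S.toLinearMap)ᗮ = ⊥ := by
    rw [Submodule.eq_bot_iff]
    intro f hf
    refine hinj f (ext_inner_left ℝ fun g => ?_)
    rw [← hsym, inner_zero_right]
    exact (Submodule.mem_orthogonal _ _).1 hf _ ⟨g, rfl⟩
  have hd : Dense (LinearMap.range S.toLinearMap : Set H) := by
    rw [Submodule.dense_iff_topologicalClosure_eq_top,
      Submodule.topologicalClosure_eq_top_iff]
    exact hbot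
  exact hd.mono hsub

/-- The inverse of an injective bounded symmetric operator is self-adjoint. -/
theorem isSelfAdjoint_inverseOperator [CompleteSpace H] (hinj : ∀ f, S f = 0 → f = 0)
    (hsym : ∀ f g, inner ℝ (S f) g = inner ℝ f (S g)) : IsSelfAdjoint (inverseOperator S) := by
  rw [LinearPMap.isSelfAdjoint_def]
  refine LinearPMap.eq_of_eq_graph ?_
  rw [LinearPMap.adjoint_graph_eq_graph_adjoint (dense_domain_inverseOperator hinj hsym)]
  ext ⟨a, b⟩
  rw [Submodule.mem_adjoint_iff, mem_graph_inverseOperator hinj]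
  constructor
  · intro h
    refine ext_inner_left ℝ fun k => ?_
    have h1 := h (S k) (k - S k) ((mem_graph_inverseOperator hinj).2 (by simp))
    simp only [inner_sub_left] at h1
    rw [hsym, hsym] at h1
    rw [map_add, inner_add_right]
    linarith
  · intro hab x y hxy
    have hxy' := (mem_graph_inverseOperator hinj).1 hxy
    show inner ℝ y a - inner ℝ x b = 0
    have e1 : inner ℝ (x + y) a = inner ℝ x (a + b) := by
      conv_lhs => rw [hab]
      conv_rhs => rw [hxy']
      rw [hsym]
    rw [inner_add_left, inner_add_right] at e1
    linarith

/-- Every resolvent of `S⁻¹ - 1` factors through `S`. -/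
theorem isCompactOperator_of_isResolventAt (hinj : ∀ f, S f = 0 → f = 0)
    (hS : IsCompactOperator S) {z : ℝ} {R : H →L[ℝ] H}
    (hR : IsResolventAt (inverseOperator S) z R) : IsCompactOperator R := by
  have e : R = S.comp (ContinuousLinearMap.id ℝ H + (1 + z) • R) := by
    ext f
    obtain ⟨h, hf⟩ := hR.1 f
    have h1 := (inverseOperator_apply_eq_iff hinj (f := R f) (g := f + z • R f)).1
      ⟨h, sub_eq_iff_eq_add.1 hf⟩
    rw [ContinuousLinearMap.comp_apply]
    conv_lhs => rw [h1]
    congr 1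
    simp only [_root_.add_apply, ContinuousLinearMap.id_apply, _root_.smul_apply]
    module
  rw [e]
  exact hS.comp_clm _

open Module.End in
theorem mem_eigenspace_inverseOperator_iff (hinj : ∀ f, S f = 0 → f = 0) {z : ℝ} {f : H} :
    f ∈ unboundedEigenspace (inverseOperator S) z ↔ f = (1 + z) • S f := by
  have h : f ∈ unboundedEigenspace (inverseOperator S) z ↔ f = S (f + z • f) :=
    inverseOperator_apply_eq_iff hinj
  rw [h, ← map_smul, add_smul, one_smul]

open Module.End in
theorem unboundedEigenspace_inverseOperator (hinj : ∀ f, S f = 0 → f = 0) {z : ℝ}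
    (hz : 1 + z ≠ 0) : unboundedEigenspace (inverseOperator S) z =
      eigenspace (S : Module.End ℝ H) (1 + z)⁻¹ := by
  ext f
  rw [mem_eigenspace_inverseOperator_iff hinj, mem_eigenspace_iff]
  constructor
  · intro h
    show S f = (1 + z)⁻¹ • f
    conv_rhs => rw [h]
    rw [inv_smul_smul₀ hz]
  · intro h
    have h' : S f = (1 + z)⁻¹ • f := h
    rw [h', smul_inv_smul₀ hz]

open Module.End in
/-- The spectrum of `S⁻¹ - 1` is given by the eigenvalues of the compact operator `S`. -/
theorem mem_unboundedSpectrum_inverseOperator_iff [CompleteSpace H] (hinj : ∀ f, S f = 0 → f = 0)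
    (hS : IsCompactOperator S) {z : ℝ} : z ∈ unboundedSpectrum (inverseOperator S) ↔
      1 + z ≠ 0 ∧ HasEigenvalue (S : Module.End ℝ H) (1 + z)⁻¹ := by
  constructor
  · intro hz
    by_contra hcon
    apply hz
    by_cases hz0 : 1 + z = 0
    · refine ⟨S, fun f => ?_, fun u => ?_⟩
      · have hz1 : z = -1 := by linarith
        obtain ⟨h, e⟩ := (inverseOperator_apply_eq_iff hinj (f := S f) (g := f + z • S f)).2 (by
          rw [hz1]; congr 1; module)
        exact ⟨h, by rw [e]; abel⟩
      · have h1 := (inverseOperator_apply_eq_iff hinj (f := (u : H))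
          (g := inverseOperator S u)).1 ⟨u.2, rfl⟩
        conv_rhs => rw [h1]
        congr 1
        have hz1 : z = -1 := by linarith
        rw [hz1]
        module
    · have hne : ¬ HasEigenvalue (S : Module.End ℝ H) (1 + z)⁻¹ := fun h => hcon ⟨hz0, h⟩
      have hres := (hS.hasEigenvalue_or_mem_resolventSet (inv_ne_zero hz0)).resolve_left hne
      obtain ⟨U, hU⟩ := hres
      -- `U` is the operator `(1 + z)⁻¹ - S`
      set G : H →L[ℝ] H := ((U⁻¹ : (H →L[ℝ] H)ˣ) : H →L[ℝ] H) with hG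
      have hUa : ∀ f, (U : H →L[ℝ] H) f = (1 + z)⁻¹ • f - S f := by
        intro f
        rw [hU, _root_.sub_apply, ContinuousLinearMap.algebraMap_apply]
      have hUG : ∀ f, (U : H →L[ℝ] H) (G f) = f := fun f =>
        DFunLike.congr_fun U.mul_inv f
      have hGU : ∀ f, G ((U : H →L[ℝ] H) f) = f := fun f =>
        DFunLike.congr_fun U.inv_mul f
      refine ⟨(1 + z)⁻¹ • G.comp S, fun f => ?_, fun u => ?_⟩
      · set r := ((1 + z)⁻¹ • G.comp S) f with hr
        have h1 : (1 + z)⁻¹ • r - S r = (1 + z)⁻¹ • S f := by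
          rw [← hUa, hr, _root_.smul_apply, map_smul, ContinuousLinearMap.comp_apply, hUG]
        have h2 : r = S (r + (f + z • r)) := by
          have h3 : (1 + z) • ((1 + z)⁻¹ • r - S r) = (1 + z) • ((1 + z)⁻¹ • S f) := by rw [h1]
          rw [smul_sub, smul_inv_smul₀ hz0, smul_inv_smul₀ hz0, sub_eq_iff_eq_add] at h3
          conv_lhs => rw [h3]
          simp only [map_add, map_smul]
          module
        obtain ⟨h, e⟩ := (inverseOperator_apply_eq_iff hinj).2 h2
        exact ⟨h, by rw [e]; abel⟩
      · have h1 := (inverseOperator_apply_eq_iff hinj (f := (u : H))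
          (g := inverseOperator S u)).1 ⟨u.2, rfl⟩
        rw [_root_.smul_apply, ContinuousLinearMap.comp_apply, ← map_smul]
        conv_rhs => rw [← hGU (u : H), hUa]
        congr 1
        have h2 : S (inverseOperator S u) = (u : H) - S (u : H) := by
          rw [eq_sub_iff_add_eq, ← map_add, add_comm]
          exact h1.symm
        rw [map_sub, map_smul, h2]
        have h3 : S (u : H) = (1 + z)⁻¹ • ((1 + z) • S (u : H)) := (inv_smul_smul₀ hz0 _).symm
        conv_rhs => rw [h3]
        rw [← smul_sub]
        congr 1
        module
  · rintro ⟨hz0, hev⟩ ⟨R, hR⟩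
    obtain ⟨v, hv⟩ := hev.exists_hasEigenvector
    have hv' : v ∈ unboundedEigenspace (inverseOperator S) z := by
      rw [unboundedEigenspace_inverseOperator hinj hz0]
      exact hv.1
    obtain ⟨h, e⟩ := hv'
    have h1 := hR.2 ⟨v, h⟩
    rw [e, sub_self, map_zero] at h1
    exact hv.2 h1.symm

open Module.End in
/-- A positive injective compact operator on an infinite-dimensional space has infinitely many
eigenvalues, so `S⁻¹ - 1` has discrete spectrum. -/
theorem hasDiscreteSpectrum_inverseOperator [CompleteSpace H] (hinf : ¬ FiniteDimensional ℝ H)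
    (hinj : ∀ f, S f = 0 → f = 0) (hsym : ∀ f g, inner ℝ (S f) g = inner ℝ f (S g))
    (hpos : ∀ f, 0 ≤ inner ℝ (S f) f) (hS : IsCompactOperator S) :
    HasDiscreteSpectrum (inverseOperator S) := by
  have hevpos : ∀ μ, HasEigenvalue (S : Module.End ℝ H) μ → 0 < μ := by
    intro μ hμ
    obtain ⟨v, hv⟩ := hμ.exists_hasEigenvector
    have h1 : S v = μ • v := hv.apply_eq_smul
    have h2 := hpos v
    rw [h1, real_inner_smul_left, real_inner_self_eq_norm_sq] at h2
    have h3 : 0 < ‖v‖ ^ 2 := by have := norm_pos_iff.2 hv.2; positivity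
    have h4 : 0 ≤ μ := nonneg_of_mul_nonneg_left h2 h3
    refine lt_of_le_of_ne h4 fun h => hv.2 (hinj v ?_)
    rw [h1, ← h, zero_smul]
  set σ : Set ℝ := {μ | HasEigenvalue (S : Module.End ℝ H) μ} with hσ
  have hfd : ∀ μ ∈ σ, FiniteDimensional ℝ (eigenspace (S : Module.End ℝ H) μ) := fun μ hμ =>
    ContinuousLinearMap.finite_dimensional_eigenspace hS μ (hevpos μ hμ).ne'
  have hσinf : σ.Infinite := by
    intro hfin
    have hbot := ContinuousLinearMap.orthogonalComplement_iSup_eigenspaces_eq_bot hS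
      (fun f g => hsym f g)
    have hsup : (⨆ μ, eigenspace (S : Module.End ℝ H) μ) =
        ⨆ μ : σ, eigenspace (S : Module.End ℝ H) μ := by
      refine le_antisymm (iSup_le fun μ => ?_) (iSup_le fun μ => le_iSup _ (μ : ℝ))
      by_cases hμ : HasEigenvalue (S : Module.End ℝ H) μ
      · exact le_iSup (fun μ : σ => eigenspace (S : Module.End ℝ H) μ) ⟨μ, hμ⟩
      · rw [hasEigenvalue_iff, not_not] at hμ
        rw [hμ]
        exact bot_le
    have : Finite σ := hfin
    have : ∀ μ : σ, FiniteDimensional ℝ (eigenspace (S : Module.End ℝ H) (μ : ℝ)) :=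
      fun μ => hfd μ μ.2
    have hfds : FiniteDimensional ℝ ↥(⨆ μ, eigenspace (S : Module.End ℝ H) μ) := by
      rw [hsup]
      exact Submodule.finiteDimensional_iSup _
    have htop := (Submodule.orthogonal_eq_bot_iff).1 hbot
    apply hinf
    rw [htop] at hfds
    exact Module.Finite.equiv (Submodule.topEquiv (R := ℝ) (M := H))
  have hspec : unboundedSpectrum (inverseOperator S) = (fun μ => μ⁻¹ - 1) '' σ := by
    ext z
    rw [mem_unboundedSpectrum_inverseOperator_iff hinj hS]
    constructor
    · rintro ⟨-, h⟩
      exact ⟨_, h, by simp⟩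
    · rintro ⟨μ, hμ, rfl⟩
      have e : 1 + (μ⁻¹ - 1) = μ⁻¹ := by ring
      simp only [e, inv_inv]
      exact ⟨inv_ne_zero (hevpos μ hμ).ne', hμ⟩
  have hEinf : (unboundedSpectrum (inverseOperator S)).Infinite := by
    rw [hspec]
    refine hσinf.image fun a _ b _ hab => ?_
    exact inv_injective (sub_left_injective hab)
  have hEfin : ∀ c, (unboundedSpectrum (inverseOperator S) ∩ Iic c).Finite := by
    intro c
    have hδ : 0 < (|c| + 1)⁻¹ := by positivity
    refine ((finite_setOf_hasEigenvalue_ge hS hsym hδ).image fun μ => μ⁻¹ - 1).subset ?_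
    rw [hspec]
    rintro _ ⟨⟨μ, hμ, rfl⟩, hc⟩
    refine ⟨μ, ⟨hμ, ?_⟩, rfl⟩
    have hc' : μ⁻¹ - 1 ≤ c := hc
    refine inv_le_of_inv_le₀ (hevpos μ hμ) ?_
    linarith [le_abs_self c]
  obtain ⟨m, hm, hmt, hmr⟩ := exists_strictMono_range_eq hEinf hEfin
  refine ⟨m, hm, hmt, hmr, fun k => ?_⟩
  have hk : m k ∈ unboundedSpectrum (inverseOperator S) := hmr ▸ mem_range_self k
  obtain ⟨h0, hev⟩ := (mem_unboundedSpectrum_inverseOperator_iff hinj hS).1 hk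
  rw [unboundedEigenspace_inverseOperator hinj h0]
  exact ⟨hev, hfd _ hev⟩

end InverseOperator

/-! ### Density of the test functions and the dimension of the weighted `L²` space -/

section TestDense

variable {n : ℕ} {M : Type*} [TopologicalSpace M] [ChartedSpace (Euc n) M]
  [MeasurableSpace M] {ν : Measure M}
  [T2Space M] [SecondCountableTopology M] [BorelSpace M] [IsManifold 𝓘(ℝ, Euc n) ∞ M]
  [IsLocallyLebesgue n ν]
  {V : M → ℝ} (hV : ∀ x, 0 < V x) (hVi : LocallyIntegrable V ν)

/-- The test functions are dense in `L²(V dν)`. -/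
theorem eq_zero_of_forall_inner_testToL2 {f : WeightedL2 ν V}
    (h : ∀ v : TestFn n M, inner ℝ f (testToL2 n hV hVi v) = 0) : f = 0 := by
  have hlc : LocallyCompactSpace M := ChartedSpace.locallyCompactSpace (Euc n) M
  have hVm : AEMeasurable V ν := hVi.aestronglyMeasurable.aemeasurable
  have hfm : StronglyMeasurable f := Lp.stronglyMeasurable f
  have i1 : Integrable (fun x => V x * f x ^ 2) ν :=
    (integrable_weighted_iff hV hVm).1 ((memLp_two_iff_integrable_sq
      hfm.aestronglyMeasurable).1 (Lp.memLp f))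
  have hloc : LocallyIntegrable (fun x => V x * f x) ν := by
    refine (hVi.add i1.locallyIntegrable).mono
      (hVm.aestronglyMeasurable.mul hfm.aestronglyMeasurable) (Eventually.of_forall fun x => ?_)
    have hVx := (hV x).le
    rw [Pi.add_apply, Real.norm_of_nonneg (add_nonneg hVx (mul_nonneg hVx (sq_nonneg _))),
      norm_mul, Real.norm_of_nonneg hVx, Real.norm_eq_abs, ← sq_abs (f x)]
    have h1 : |f x| ≤ 1 + |f x| ^ 2 := by nlinarith [sq_nonneg (|f x| - 1), abs_nonneg (f x)]
    have := mul_le_mul_of_nonneg_left h1 hVx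
    linarith
  have h0 := ae_eq_zero_of_integral_contMDiff_smul_eq_zero 𝓘(ℝ, Euc n) hloc fun g hg hgs => by
    have h1 := h ⟨g, hg, hgs⟩
    rw [inner_testToL2, integral_weighted hV hVm] at h1
    rw [← h1]
    refine integral_congr_ae (Eventually.of_forall fun x => ?_)
    simp only [smul_eq_mul]
    ring
  refine (Lp.eq_zero_iff_ae_eq_zero).2 ?_
  refine (withDensity_absolutelyContinuous ν _).ae_eq ?_
  filter_upwards [h0] with x hx
  exact (mul_eq_zero.1 hx).resolve_left (hV x).ne'

/-- The lower bounds on the density make `ν` positive on nonempty open sets. -/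
theorem measure_pos_of_isOpen (n : ℕ) {M : Type*} [TopologicalSpace M] [ChartedSpace (Euc n) M]
    [MeasurableSpace M] [T2Space M] [BorelSpace M] [IsManifold 𝓘(ℝ, Euc n) ∞ M] (ν : Measure M)
    [IsLocallyLebesgue n ν] {U : Set M} (hU : IsOpen U) (hne : U.Nonempty) : 0 < ν U := by
  obtain ⟨x, hx⟩ := hne
  obtain ⟨B, hxs, hxc⟩ := CoordBall.exists_chart_eq_center n x
  obtain ⟨a, b, ha, hb, hvol, -, -⟩ := B.exists_integral_bounds ν
  set s := B.chart.target ∩ B.chart.symm ⁻¹' U with hs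
  have hso : IsOpen s := B.chart.isOpen_inter_preimage_symm hU
  have hcs : B.center ∈ s := by
    rw [← hxc]
    exact ⟨B.chart.map_source hxs, by rwa [mem_preimage, B.chart.left_inv hxs]⟩
  have h1 : 0 < volume (B.ball ∩ s) := by
    refine Measure.measure_pos_of_mem_nhds volume (x := B.center) ?_
    exact Filter.inter_mem (Metric.closedBall_mem_nhds _ B.radius_pos) (hso.mem_nhds hcs)
  have h2 := hvol s hso.measurableSet
  refine (ENNReal.mul_pos (by simpa using ha) h1.ne').trans_le (h2.trans (measure_mono ?_))
  rintro y ⟨hy, hys⟩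
  have := hys.2
  rwa [mem_preimage, B.chart.left_inv (B.carrier_subset_source hy)] at this

/-- On a manifold of positive dimension `L²(V dν)` is infinite-dimensional: disjoint sets have
orthogonal indicators. -/
theorem not_finiteDimensional_weightedL2 [Nonempty M] (hn : 0 < n) (hV : ∀ x, 0 < V x)
    (hVi : LocallyIntegrable V ν) (hν : IsLocallyLebesgue n ν) :
    ¬ FiniteDimensional ℝ (WeightedL2 ν V) := by
  have hlc : LocallyCompactSpace M := ChartedSpace.locallyCompactSpace (Euc n) M
  have hVm : AEMeasurable V ν := hVi.aestronglyMeasurable.aemeasurable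
  have : Nonempty (Fin n) := ⟨⟨0, hn⟩⟩
  have hMinf : Infinite M := by
    obtain ⟨x⟩ := (inferInstance : Nonempty M)
    obtain ⟨B, -, -⟩ := CoordBall.exists_chart_eq_center n x
    have h1 : B.ball.Infinite :=
      infinite_of_mem_nhds B.center (Metric.closedBall_mem_nhds _ B.radius_pos)
    have h2 : (B.chart.symm '' B.ball).Infinite :=
      h1.image (B.chart.symm.injOn.mono B.ball_subset_target)
    exact infinite_univ_iff.1 (h2.mono (subset_univ _))
  obtain ⟨U, hUi, hUo, hUd⟩ := exists_seq_infinite_isOpen_pairwise_disjoint M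
  have hcpt : ∀ k, ∃ K : Set M, IsCompact K ∧ K ⊆ U k ∧ (interior K).Nonempty := by
    intro k
    obtain ⟨x, hx⟩ := (hUi k).nonempty
    obtain ⟨K, hK, hxK, hKU⟩ := exists_compact_subset (hUo k) hx
    exact ⟨K, hK, hKU, ⟨x, hxK⟩⟩
  choose K hK hKU hKi using hcpt
  have hKm : ∀ k, MeasurableSet (K k) := fun k => (hK k).isClosed.measurableSet
  have hfin : ∀ k, weighted ν V (K k) ≠ ⊤ := by
    intro k
    rw [weighted, withDensity_apply _ (hKm k)]
    exact (hVi.integrableOn_isCompact (hK k)).lintegral_lt_top.ne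
  have hpos : ∀ k, weighted ν V (K k) ≠ 0 := by
    intro k h0
    rw [weighted, withDensity_apply_eq_zero' hVm.ennreal_ofReal] at h0
    have e : {x | ENNReal.ofReal (V x) ≠ 0} ∩ K k = K k := by
      refine inter_eq_right.2 fun x _ => ?_
      show ENNReal.ofReal (V x) ≠ 0
      simpa using hV x
    rw [e] at h0
    exact (measure_pos_of_isOpen n ν isOpen_interior (hKi k)).ne'
      (measure_mono_null interior_subset h0)
  set e : ℕ → WeightedL2 ν V := fun k => indicatorConstLp 2 (hKm k) (hfin k) (1 : ℝ) with he
  have hinner : ∀ i j, inner ℝ (e i) (e j) = (weighted ν V).real (K i ∩ K j) := by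
    intro i j
    rw [he]
    simp only [L2.inner_indicatorConstLp_indicatorConstLp]
    simp
  have hli : LinearIndependent ℝ e := by
    refine linearIndependent_of_ne_zero_of_inner_eq_zero (fun k h0 => ?_) fun i j hij => ?_
    · have h1 := hinner k k
      rw [h0, inner_zero_left, inter_self] at h1
      exact (ENNReal.toReal_pos (hpos k) (hfin k)).ne h1
    · show inner ℝ (e i) (e j) = 0
      have hd : Disjoint (K i) (K j) := (hUd hij).mono (hKU i) (hKU j)
      rw [hinner, hd.inter_eq]
      simp
  intro hfd
  exact not_finite_iff_infinite.2 (inferInstance : Infinite ℕ) hli.finite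

end TestDense

/-! ### The Friedrichs operator -/

section FormEmbedding

variable {n : ℕ} {M : Type*} [TopologicalSpace M] [ChartedSpace (Euc n) M]
  [MeasurableSpace M] {ν : Measure M}
  [T2Space M] [SecondCountableTopology M] [BorelSpace M] [IsManifold 𝓘(ℝ, Euc n) ∞ M]
  [IsLocallyLebesgue n ν]
  {P : DivFormOperator n M ν} (hP : P.Nonneg) {V : M → ℝ} (hV : ∀ x, 0 < V x)
  (hVi : LocallyIntegrable V ν)

theorem norm_sq_eq_q_add (u : PreD12 P hP hV hVi) :
    ‖u‖ ^ 2 = P.q u.toFun + ‖preEmbedding hP hV hVi u‖ ^ 2 := by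
  rw [PreD12.norm_sq_eq]
  congr 1
  exact (norm_testToL2_sq hV hVi ⟨u.toFun, u.toFun_mem⟩).symm

/-- The form in terms of the two inner products, which extends it to the completion. -/
theorem form_eq_inner_sub (u v : PreD12 P hP hV hVi) :
    P.form u.toFun v.toFun = inner ℝ (u : D12 P hP hV hVi) (v : D12 P hP hV hVi) -
      inner ℝ (preEmbedding hP hV hVi u) (preEmbedding hP hV hVi v) := by
  have h1 : inner ℝ (preEmbedding hP hV hVi u) (preEmbedding hP hV hVi v) =
      ∫ x, V x * (u.toFun x * v.toFun x) ∂ν := by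
    refine (inner_testToL2 hV hVi _ ⟨v.toFun, v.toFun_mem⟩).trans ?_
    rw [← integral_weighted hV hVi.aestronglyMeasurable.aemeasurable]
    refine integral_congr_ae ?_
    filter_upwards [coeFn_testToL2 hV hVi ⟨u.toFun, u.toFun_mem⟩] with x hx
    rw [preEmbedding_apply, hx]
  rw [UniformSpace.Completion.inner_coe, h1]
  exact (add_sub_cancel_right _ _).symm

theorem exists_seq_tendsto_coe (ξ : D12 P hP hV hVi) :
    ∃ u : ℕ → PreD12 P hP hV hVi, Tendsto (fun k => (u k : D12 P hP hV hVi)) atTop (𝓝 ξ) := by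
  obtain ⟨x, hx, hlim⟩ := mem_closure_iff_seq_limit.1 (UniformSpace.Completion.denseRange_coe ξ)
  choose u hu using hx
  exact ⟨u, by simpa only [hu] using hlim⟩

theorem eq_zero_of_forall_inner_coe {ξ : D12 P hP hV hVi}
    (h : ∀ v : PreD12 P hP hV hVi, inner ℝ ξ (v : D12 P hP hV hVi) = 0) : ξ = 0 := by
  exact UniformSpace.Completion.denseRange_coe.eq_zero_of_inner_left ℝ h

/-- A sequence of test functions converging in `𝒟^{1,2}` is `q`-Cauchy. -/
theorem q_cauchy_of_tendsto {u : ℕ → PreD12 P hP hV hVi} {ξ : D12 P hP hV hVi}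
    (hu : Tendsto (fun k => (u k : D12 P hP hV hVi)) atTop (𝓝 ξ)) :
    ∀ ε : ℝ, 0 < ε → ∃ N, ∀ i ≥ N, ∀ j ≥ N, P.q ((u i).toFun - (u j).toFun) < ε := by
  intro ε hε
  obtain ⟨N, hN⟩ := Metric.cauchySeq_iff.1 hu.cauchySeq (Real.sqrt ε) (Real.sqrt_pos.2 hε)
  refine ⟨N, fun i hi j hj => ?_⟩
  have h1 := hN i hi j hj
  rw [dist_eq_norm, ← UniformSpace.Completion.coe_sub, UniformSpace.Completion.norm_coe,
    Real.lt_sqrt (norm_nonneg _), norm_sq_eq_q_add] at h1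
  have h2 : P.q ((u i).toFun - (u j).toFun) = P.q (u i - u j).toFun := rfl
  rw [h2]
  have := sq_nonneg ‖preEmbedding hP hV hVi (u i - u j)‖
  linarith

theorem tendsto_preEmbedding {u : ℕ → PreD12 P hP hV hVi} {ξ : D12 P hP hV hVi}
    (hu : Tendsto (fun k => (u k : D12 P hP hV hVi)) atTop (𝓝 ξ)) :
    Tendsto (fun k => preEmbedding hP hV hVi (u k)) atTop (𝓝 (embedding hP hV hVi ξ)) := by
  have := ((embedding hP hV hVi).continuous.tendsto ξ).comp hu
  simpa only [Function.comp_def, embedding_coe] using this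

theorem tendsto_form {u : ℕ → PreD12 P hP hV hVi} {ξ : D12 P hP hV hVi}
    (hu : Tendsto (fun k => (u k : D12 P hP hV hVi)) atTop (𝓝 ξ)) (v : PreD12 P hP hV hVi) :
    Tendsto (fun k => P.form (u k).toFun v.toFun) atTop
      (𝓝 (inner ℝ ξ (v : D12 P hP hV hVi) -
        inner ℝ (embedding hP hV hVi ξ) (preEmbedding hP hV hVi v))) := by
  simp only [form_eq_inner_sub]
  exact (hu.inner tendsto_const_nhds).sub
    ((tendsto_preEmbedding hP hV hVi hu).inner tendsto_const_nhds)

/-- `𝒟^{1,2}` is a space of functions: this is the closability of `q`. -/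
theorem embedding_injective {W : M → ℝ} (hW : ∀ x, 0 < W x) (hWm : AEMeasurable W ν) {l : ℝ≥0}
    (hl : 0 < l) (hH : P.Hardy W l) : Function.Injective (embedding hP hV hVi) := by
  rw [injective_iff_map_eq_zero]
  intro ξ hξ
  obtain ⟨u, hu⟩ := exists_seq_tendsto_coe hP hV hVi ξ
  have h0 : Tendsto (fun k => ∫ x, V x * (u k).toFun x ^ 2 ∂ν) atTop (𝓝 0) := by
    have h1 := (tendsto_preEmbedding hP hV hVi hu).norm.pow 2
    rw [hξ, norm_zero, zero_pow two_ne_zero] at h1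
    exact h1.congr fun k => norm_testToL2_sq hV hVi ⟨(u k).toFun, (u k).toFun_mem⟩
  refine eq_zero_of_forall_inner_coe hP hV hVi fun v => ?_
  have h1 := tendsto_form hP hV hVi hu v
  rw [hξ, inner_zero_left, sub_zero] at h1
  exact tendsto_nhds_unique h1 (tendsto_form_zero hP hW hWm hl hH hV hVi
    hVi.aestronglyMeasurable.aemeasurable (fun k => (u k).toFun_mem)
    (q_cauchy_of_tendsto hP hV hVi hu) h0 v.toFun_mem)

/-- The operator `j j†`, where `j` is the embedding `𝒟^{1,2} → L²(V dν)`. By the Riesz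
representation theorem, `j† h` is the weak solution of `(V⁻¹P + 1) u = h`, so `j j†` is the inverse
of `V⁻¹P + 1`. -/
def friedrichsInverse : WeightedL2 ν V →L[ℝ] WeightedL2 ν V :=
  (embedding hP hV hVi).comp (ContinuousLinearMap.adjoint (embedding hP hV hVi))

theorem inner_friedrichsInverse (f g : WeightedL2 ν V) :
    inner ℝ (friedrichsInverse hP hV hVi f) g = inner ℝ
      (ContinuousLinearMap.adjoint (embedding hP hV hVi) f)
      (ContinuousLinearMap.adjoint (embedding hP hV hVi) g) := by
  rw [friedrichsInverse, ContinuousLinearMap.comp_apply, ContinuousLinearMap.adjoint_inner_right]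

theorem friedrichsInverse_symm (f g : WeightedL2 ν V) :
    inner ℝ (friedrichsInverse hP hV hVi f) g = inner ℝ f (friedrichsInverse hP hV hVi g) := by
  rw [inner_friedrichsInverse, real_inner_comm, ← inner_friedrichsInverse, real_inner_comm]

theorem friedrichsInverse_nonneg (f : WeightedL2 ν V) :
    0 ≤ inner ℝ (friedrichsInverse hP hV hVi f) f := by
  rw [inner_friedrichsInverse]
  exact real_inner_self_nonneg

theorem friedrichsInverse_injective (f : WeightedL2 ν V) (hf : friedrichsInverse hP hV hVi f = 0) :
    f = 0 := by
  have h1 := inner_friedrichsInverse hP hV hVi f f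
  rw [hf, inner_zero_left, real_inner_self_eq_norm_sq] at h1
  have h2 : ContinuousLinearMap.adjoint (embedding hP hV hVi) f = 0 :=
    norm_eq_zero.1 (pow_eq_zero_iff two_ne_zero |>.1 h1.symm)
  refine eq_zero_of_forall_inner_testToL2 (n := n) hV hVi fun v => ?_
  have h3 := ContinuousLinearMap.adjoint_inner_left (embedding hP hV hVi)
    ((show PreD12 P hP hV hVi from v : PreD12 P hP hV hVi) : D12 P hP hV hVi) f
  rw [h2, inner_zero_left, embedding_coe] at h3
  exact h3.symm

/-- The Friedrichs operator is the operator `S⁻¹ - 1` with `S = j j†`. -/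
theorem friedrichsRel_iff (f g : WeightedL2 ν V) :
    FriedrichsRel P V f g ↔ f = friedrichsInverse hP hV hVi (f + g) := by
  have hint : ∀ v : PreD12 P hP hV hVi, inner ℝ g (preEmbedding hP hV hVi v) =
      ∫ x, g x * v.toFun x ∂(weighted ν V) := fun v =>
    inner_testToL2 hV hVi g ⟨v.toFun, v.toFun_mem⟩
  have hadj : ∀ v : PreD12 P hP hV hVi, inner ℝ
      (ContinuousLinearMap.adjoint (embedding hP hV hVi) (f + g)) (v : D12 P hP hV hVi) =
      inner ℝ f (preEmbedding hP hV hVi v) + inner ℝ g (preEmbedding hP hV hVi v) := fun v => by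
    rw [ContinuousLinearMap.adjoint_inner_left, embedding_coe, inner_add_left]
  have hlp : ∀ u : ℕ → PreD12 P hP hV hVi,
      Tendsto (fun k => preEmbedding hP hV hVi (u k)) atTop (𝓝 f) ↔
      Tendsto (fun k => eLpNorm (fun x => (u k).toFun x - f x) 2 (weighted ν V)) atTop (𝓝 0) := by
    intro u
    rw [Lp.tendsto_Lp_iff_tendsto_eLpNorm']
    refine iff_of_eq (congrArg (fun F => Tendsto F atTop (𝓝 0)) (funext fun k => ?_))
    refine eLpNorm_congr_ae ?_
    filter_upwards [coeFn_testToL2 hV hVi ⟨(u k).toFun, (u k).toFun_mem⟩] with x hx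
    rw [Pi.sub_apply, preEmbedding_apply, hx]
  constructor
  · rintro ⟨u, hu, hlim, hcau, hform⟩
    set U : ℕ → PreD12 P hP hV hVi := fun k => (⟨u k, hu k⟩ : TestFn n M) with hU
    have hUf : Tendsto (fun k => preEmbedding hP hV hVi (U k)) atTop (𝓝 f) := (hlp U).2 hlim
    have hC : CauchySeq fun k => (U k : D12 P hP hV hVi) := by
      rw [Metric.cauchySeq_iff]
      intro ε hε
      obtain ⟨N₁, h₁⟩ := hcau (ε ^ 2 / 2) (by positivity)
      obtain ⟨N₂, h₂⟩ := Metric.cauchySeq_iff.1 hUf.cauchySeq (ε / 2) (by positivity)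
      refine ⟨max N₁ N₂, fun i hi j hj => ?_⟩
      have a1 := h₁ i ((le_max_left _ _).trans hi) j ((le_max_left _ _).trans hj)
      have a2 := h₂ i ((le_max_right _ _).trans hi) j ((le_max_right _ _).trans hj)
      rw [dist_eq_norm, ← map_sub] at a2
      rw [dist_eq_norm, ← UniformSpace.Completion.coe_sub, UniformSpace.Completion.norm_coe]
      refine lt_of_pow_lt_pow_left₀ 2 hε.le ?_
      rw [norm_sq_eq_q_add]
      have a3 : P.q (U i - U j).toFun = P.q (u i - u j) := rfl
      have a4 : ‖preEmbedding hP hV hVi (U i - U j)‖ ^ 2 < (ε / 2) ^ 2 := by gcongr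
      rw [a3]
      linarith [sq_nonneg ε, (by ring : (ε / 2) ^ 2 = ε ^ 2 / 4)]
    obtain ⟨ξ, hξ⟩ := cauchySeq_tendsto_of_complete hC
    have hjξ : embedding hP hV hVi ξ = f :=
      tendsto_nhds_unique (tendsto_preEmbedding hP hV hVi hξ) hUf
    have hξe : ξ = ContinuousLinearMap.adjoint (embedding hP hV hVi) (f + g) := by
      rw [← sub_eq_zero]
      refine eq_zero_of_forall_inner_coe hP hV hVi fun v => ?_
      have h1 := tendsto_nhds_unique (tendsto_form hP hV hVi hξ v) (hform v.toFun v.toFun_mem)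
      rw [hjξ, ← hint] at h1
      rw [inner_sub_left, hadj]
      linarith
    rw [friedrichsInverse, ContinuousLinearMap.comp_apply, ← hξe, hjξ]
  · intro hf
    set ξ := ContinuousLinearMap.adjoint (embedding hP hV hVi) (f + g) with hξ
    have hjξ : embedding hP hV hVi ξ = f := hf.symm
    obtain ⟨u, hu⟩ := exists_seq_tendsto_coe hP hV hVi ξ
    refine ⟨fun k => (u k).toFun, fun k => (u k).toFun_mem, ?_, q_cauchy_of_tendsto hP hV hVi hu,
      fun v hv => ?_⟩
    · rw [← hlp, ← hjξ]
      exact tendsto_preEmbedding hP hV hVi hu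
    · set v' : PreD12 P hP hV hVi := (⟨v, hv⟩ : TestFn n M) with hv'
      have h1 := tendsto_form hP hV hVi hu v'
      rw [hjξ, hadj, add_sub_cancel_left, hint] at h1
      exact h1

end FormEmbedding
end

/-! ### Discreteness of the spectrum and compactness of the embedding -/

theorem theorem5p6 (n : ℕ) (hn : 2 ≤ n)
    {M : Type*} [TopologicalSpace M] [T2Space M] [SecondCountableTopology M] [ConnectedSpace M]
    [ChartedSpace (Euc n) M] [IsManifold 𝓘(ℝ, Euc n) ∞ M]
    [MeasurableSpace M] [BorelSpace M]
    (ν : Measure M) [IsLocallyLebesgue n ν]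
    (P : DivFormOperator n M ν) (hP : P.Nonneg)
    (W : M → ℝ) (hW : ∀ x, 0 < W x) (hWm : AEMeasurable W ν)
    (hHardy : ∃ l : ℝ≥0, 0 < l ∧ P.Hardy W l)
    (V : M → ℝ) (hV : ∀ x, 0 < V x) (hVm : AEMeasurable V ν)
    (hVW : Tendsto (fun x => V x / W x) (cocompact M) (𝓝 0)) :
    P.lambdaInfty V = ⊤ ∧
    (IsLocEssBdd ν V →
      ∃ T : WeightedL2 ν V →ₗ.[ℝ] WeightedL2 ν V,
        (∀ f g, (f, g) ∈ T.graph ↔ FriedrichsRel P V f g) ∧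
        IsSelfAdjoint T ∧
        HasDiscreteSpectrum T ∧
        ∀ z : ℝ, z ∉ unboundedSpectrum T →
          ∃ R : WeightedL2 ν V →L[ℝ] WeightedL2 ν V, IsResolventAt T z R ∧ IsCompactOperator R) ∧
    (P.AgmonComplete W → ∀ hVb : IsLocEssBdd ν V,
      ∃ j : D12 P hP hV (hVb.locallyIntegrable (n := n) hVm) →L[ℝ] WeightedL2 ν V,
        (∀ u : PreD12 P hP hV (hVb.locallyIntegrable (n := n) hVm),
          j (u : D12 P hP hV (hVb.locallyIntegrable (n := n) hVm)) =ᵐ[weighted ν V] u.toFun) ∧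
        Function.Injective j ∧ IsCompactOperator j) := by
  obtain ⟨l, hl, hH⟩ := hHardy
  refine ⟨P.lambdaInfty_eq_top hW hl hH hVW, fun hVb => ?_, fun _ hVb => ?_⟩
  · have hVi := hVb.locallyIntegrable (n := n) hVm
    have hS : IsCompactOperator (friedrichsInverse hP hV hVi) :=
      (isCompactOperator_embedding hP hV hVi
        (SmallModuloFinite.univ hP hW hWm hl hH hVb hVW)).comp_clm _
    have hinj := friedrichsInverse_injective hP hV hVi
    have hsym := friedrichsInverse_symm hP hV hVi
    refine ⟨inverseOperator (friedrichsInverse hP hV hVi), fun f g => ?_,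
      isSelfAdjoint_inverseOperator hinj hsym, ?_, fun z hz => ?_⟩
    · rw [mem_graph_inverseOperator hinj, friedrichsRel_iff hP hV hVi]
    · exact hasDiscreteSpectrum_inverseOperator
        (not_finiteDimensional_weightedL2 (n := n) (by omega) hV hVi inferInstance)
        hinj hsym (friedrichsInverse_nonneg hP hV hVi) hS
    · obtain ⟨R, hR⟩ := not_not.1 hz
      exact ⟨R, hR, isCompactOperator_of_isResolventAt hinj hS hR⟩
  · refine ⟨embedding hP hV (hVb.locallyIntegrable (n := n) hVm), fun u => ?_,
      embedding_injective hP hV _ hW hWm hl hH, isCompactOperator_embedding hP hV _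
        (SmallModuloFinite.univ hP hW hWm hl hH hVb hVW)⟩
    rw [embedding_coe]
    exact coeFn_testToL2 hV (hVb.locallyIntegrable (n := n) hVm) ⟨u.toFun, u.toFun_mem⟩
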